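/- Let $(M_2,g_2)$ be a non-empty supermanifold of dimension $q|n$ (a second countable Hausdorff space with a sheaf of $\mathbb Z_2$-graded algebras locally isomorphic to $C^\infty_U\otimes\Lambda\mathbb R^n$, $U\subseteq\mathbb R^q$ open) with an even Riemannian metric $g_2$ (a non-degenerate, supersymmetric pairing of degree $0$ on vector fields, of arbitrary signature). Let $h:\mathbb R\to\mathbb R$ be a smooth nowhere vanishing function, and let $M=\mathbb R^{1|0}\times M_2$ carry the warped product metric $g_\mu=-dt\otimes dt+h(t)^2g_2$, $\mu=h^2$. Write $\nabla^{L,\mu}$ and $\nabla^{L,M_2}$ for the Levi-Civita connections (the torsion-free metric-compatible affine connections) of $g_\mu$ and $g_2$. Put $P=\partial_t$ and let $$\widehat\nabla^\mu_XY=\nabla^{L,\mu}_XY+(-1)^{|X||Y|}g_\mu(Y,P)\,X$$ for homogeneous vector fields $X,Y$ on $M$ (the semi-symmetric non-metric connection). For an affine connection $\nabla$ let $R_\nabla(X,Y)Z=\nabla_X\nabla_YZ-(-1)^{|X||Y|}\nabla_Y\nabla_XZ-\nabla_{[X,Y]}Z$ and $$\mathrm{Ric}_\nabla(X,Y)=\sum_I(-1)^{|\partial_{x^I}|(|\partial_{x^I}|+|X|+|Y|)}\,\tfrac12\big[R_\nabla(\partial_{x^I},X)Y+(-1)^{|X||Y|}R_\nabla(\partial_{x^I},Y)X\big]^I,$$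 where $[\;\cdot\;]^I$ is the coefficient of $\partial_{x^I}$. A triple $(N,g,\nabla)$ is Einstein with Einstein constant $\lambda\in\mathbb R$ if $\mathrm{Ric}_\nabla(X,Y)=\lambda\,g(X,Y)$ for all vector fields $X,Y$. Assume $q-n\notin\{0,1\}$ and let $\lambda_0\in\mathbb R$. Then $(M,g_\mu,\widehat\nabla^\mu)$ is Einstein with Einstein constant $-\lambda_0$ if and only if there is a $\lambda_N\in\mathbb R$ such that $(M_2,g_2,\nabla^{L,M_2})$ is Einstein with Einstein constant $-\lambda_N$ and one of the following two conditions holds: (1) $\lambda_0=\lambda_N=0$ and $h(t)=c_1e^{t}$ for all $t$, with a constant $c_1$; (2) $\lambda_0=q-n$ and $h$ is a constant $c_1=\pm\sqrt{\lambda_N/(q-n)}$ (so $c_1=\sqrt{\lambda_N/(q-n)}$ if $h>0$). -/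

import Mathlib

open scoped TensorProduct ContDiff
open TopologicalSpace

universe u v

set_option linter.unusedSectionVars false
set_option linter.checkUnivs false

noncomputable section

namespace SuperGeom

/-! ### Smooth functions on an open subset of `ℝ^ι` -/

section Smooth

variable {ι : Type} [Fintype ι] [DecidableEq ι] {ι' : Type} [Fintype ι'] [DecidableEq ι']

/-- Extension by zero of a function defined on an open set. -/
def ext0 {U : Opens (ι → ℝ)} (f : U → ℝ) : (ι → ℝ) → ℝ :=
  Function.extend (Subtype.val : U → (ι → ℝ)) f 0

theorem ext0_apply {U : Opens (ι → ℝ)} (f : U → ℝ) (x : U) : ext0 f x = f x :=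
  Subtype.val_injective.extend_apply f 0 x

/-- Smoothness on `U` may be tested on any function that agrees with `f` on `U`. -/
theorem contDiffOn_ext0_iff {U : Opens (ι → ℝ)} (f : U → ℝ) (g : (ι → ℝ) → ℝ)
    (h : ∀ x : U, f x = g x) :
    ContDiffOn ℝ ∞ (ext0 f) U ↔ ContDiffOn ℝ ∞ g U := by
  apply contDiffOn_congr
  intro x hx
  rw [← h ⟨x, hx⟩]
  exact ext0_apply f ⟨x, hx⟩

/-- The algebra `C^∞(U)` of smooth real functions on the open set `U ⊆ ℝ^ι`. -/
def CInf (U : Opens (ι → ℝ)) : Subalgebra ℝ (U → ℝ) where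
  carrier := {f | ContDiffOn ℝ ∞ (ext0 f) U}
  mul_mem' {f g} hf hg :=
    (contDiffOn_ext0_iff (f * g) (ext0 f * ext0 g)
      fun x => by simp [ext0_apply]).2 (ContDiffOn.mul hf hg)
  add_mem' {f g} hf hg :=
    (contDiffOn_ext0_iff (f + g) (ext0 f + ext0 g)
      fun x => by simp [ext0_apply]).2 (ContDiffOn.add hf hg)
  algebraMap_mem' r :=
    (contDiffOn_ext0_iff _ (fun _ => r) fun x => by simp).2 contDiffOn_const

/-- Restriction to `U` of a function that is smooth on `U`. -/
def CInf.mk {U : Opens (ι → ℝ)} (g : (ι → ℝ) → ℝ) (hg : ContDiffOn ℝ ∞ g U) : CInf U :=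
  ⟨fun x => g x, (contDiffOn_ext0_iff _ g fun _ => rfl).2 hg⟩

theorem CInf.contDiffOn {U : Opens (ι → ℝ)} (f : CInf U) : ContDiffOn ℝ ∞ (ext0 f.1) U := f.2

theorem CInf.differentiableAt {U : Opens (ι → ℝ)} (f : CInf U) (x : U) :
    DifferentiableAt ℝ (ext0 f.1) x :=
  ((CInf.contDiffOn f).differentiableOn (by simp)).differentiableAt (U.isOpen.mem_nhds x.2)

/-- If `f` is the restriction of `g`, the derivative of `f` is that of `g`. -/
theorem CInf.fderiv_eq {U : Opens (ι → ℝ)} (f : U → ℝ) (g : (ι → ℝ) → ℝ)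
    (h : ∀ x : U, f x = g x) (x : U) : fderiv ℝ (ext0 f) x = fderiv ℝ g x := by
  apply Filter.EventuallyEq.fderiv_eq
  filter_upwards [U.isOpen.mem_nhds x.2] with y hy
  rw [← h ⟨y, hy⟩]
  exact ext0_apply f ⟨y, hy⟩

/-- The partial derivative `∂/∂x^a` on `C^∞(U)`. -/
def CInf.pderiv (U : Opens (ι → ℝ)) (a : ι) : CInf U →ₗ[ℝ] CInf U where
  toFun f := CInf.mk (fun x => fderiv ℝ (ext0 f.1) x (Pi.single a 1))
    (((CInf.contDiffOn f).fderiv_of_isOpen U.isOpen (m := ∞) (by simp)).clm_apply contDiffOn_const)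
  map_add' f g := by
    apply Subtype.ext
    funext x
    show fderiv ℝ (ext0 (f.1 + g.1)) x _ = fderiv ℝ (ext0 f.1) x _ + fderiv ℝ (ext0 g.1) x _
    rw [CInf.fderiv_eq (f.1 + g.1) (ext0 f.1 + ext0 g.1) (fun x => by simp [ext0_apply]) x,
      fderiv_add (CInf.differentiableAt f x) (CInf.differentiableAt g x)]
    rfl
  map_smul' r f := by
    apply Subtype.ext
    funext x
    show fderiv ℝ (ext0 (r • f.1)) x _ = r • fderiv ℝ (ext0 f.1) x _
    rw [CInf.fderiv_eq (r • f.1) (r • ext0 f.1) (fun x => by simp [ext0_apply]) x,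
      fderiv_const_smul (CInf.differentiableAt f x)]
    rfl

theorem CInf.pderiv_apply {U : Opens (ι → ℝ)} (a : ι) (f : CInf U) (x : U) :
    (CInf.pderiv U a f).1 x = fderiv ℝ (ext0 f.1) x (Pi.single a 1) := rfl

theorem CInf.pderiv_mul {U : Opens (ι → ℝ)} (a : ι) (f g : CInf U) :
    CInf.pderiv U a (f * g) = f * CInf.pderiv U a g + CInf.pderiv U a f * g := by
  apply Subtype.ext
  funext x
  show fderiv ℝ (ext0 (f.1 * g.1)) x _ =
    f.1 x * fderiv ℝ (ext0 g.1) x _ + fderiv ℝ (ext0 f.1) x _ * g.1 x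
  rw [CInf.fderiv_eq (f.1 * g.1) (ext0 f.1 * ext0 g.1) (fun x => by simp [ext0_apply]) x,
    fderiv_mul (CInf.differentiableAt f x) (CInf.differentiableAt g x)]
  simp [ext0_apply]
  ring

/-- The coordinate function `x^a`. -/
def CInf.coord (U : Opens (ι → ℝ)) (a : ι) : CInf U :=
  CInf.mk (fun x => x a) (contDiff_apply ℝ ℝ a).contDiffOn

/-- Pull-back of smooth functions along the smooth map `U → V` with components `u`. -/
def CInf.pull {U : Opens (ι' → ℝ)} {V : Opens (ι → ℝ)} (u : ι → CInf U)
    (h : ∀ x : U, (fun a => (u a).1 x) ∈ V) : CInf V →ₐ[ℝ] CInf U where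
  toFun f := ⟨fun x => f.1 ⟨fun a => (u a).1 x, h x⟩, by
    refine (contDiffOn_ext0_iff _ (ext0 f.1 ∘ fun x a => ext0 (u a).1 x) fun x => ?_).2 ?_
    · simp only [Function.comp, ext0_apply]
      exact (ext0_apply f.1 ⟨fun a => (u a).1 x, h x⟩).symm
    · refine (CInf.contDiffOn f).comp (contDiffOn_pi.2 fun a => CInf.contDiffOn (u a)) fun x hx => ?_
      have := h ⟨x, hx⟩
      have e : (fun a => ext0 (u a).1 x) = fun a => (u a).1 ⟨x, hx⟩ :=
        funext fun a => ext0_apply (u a).1 ⟨x, hx⟩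
      show (fun a => ext0 (u a).1 x) ∈ V
      rw [e]
      exact this⟩
  map_one' := rfl
  map_mul' _ _ := rfl
  map_zero' := rfl
  map_add' _ _ := rfl
  commutes' _ := rfl

end Smooth

/-! ### Superdomains -/

section Superdomain

variable {ι : Type} [Fintype ι] [DecidableEq ι] {ι' : Type} [Fintype ι'] [DecidableEq ι']
  {κ : Type} [Fintype κ] [DecidableEq κ]

/-- The exterior algebra `Λ ℝ^κ`. -/
abbrev Grass (κ : Type) : Type := ExteriorAlgebra ℝ (κ → ℝ)

/-- The algebra `C^∞(U) ⊗ Λ ℝ^κ` of superfunctions on the superdomain over `U`. -/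
abbrev SFun (κ : Type) (U : Opens (ι → ℝ)) : Type := CInf U ⊗[ℝ] Grass κ

instance (U : Opens (ι → ℝ)) : Ring (SFun κ U) := Algebra.TensorProduct.instRing

instance (U : Opens (ι → ℝ)) : AddGroup (SFun κ U) := Ring.toAddCommGroup.toAddGroup

/-- The odd coordinate `ξ^B` as an element of the exterior algebra. -/
def xi (B : κ) : Grass κ := ExteriorAlgebra.ι ℝ (Pi.single B 1)

/-- The sign `(-1)^{a b}`. -/
def sgn (a b : ZMod 2) : ℝ := (-1) ^ (a.val * b.val)

/-- The degree of the coordinate `x^I` (and of `∂_{x^I}`): the even coordinates are indexed by `ι`,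
the odd ones by `κ`. -/
def deg : ι ⊕ κ → ZMod 2 := Sum.elim (fun _ => 0) (fun _ => 1)

/-- A smooth function as a superfunction. -/
def SFun.ofCInf {U : Opens (ι → ℝ)} : CInf U →ₐ[ℝ] SFun κ U :=
  Algebra.TensorProduct.includeLeft

/-- A constant Grassmann element as a superfunction. -/
def SFun.ofGrass {U : Opens (ι → ℝ)} : Grass κ →ₐ[ℝ] SFun κ U :=
  Algebra.TensorProduct.includeRight

/-- The superfunctions of degree `p`. -/
def SFun.homog (κ : Type) (U : Opens (ι → ℝ)) (p : ZMod 2) : Submodule ℝ (SFun κ U) :=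
  LinearMap.range (LinearMap.lTensor (CInf U)
    (CliffordAlgebra.evenOdd (0 : QuadraticForm ℝ (κ → ℝ)) p).subtype)

/-- The operator `f ↦ (-1)^{p |f|} f`. -/
def SFun.twist {U : Opens (ι → ℝ)} (p : ZMod 2) : SFun κ U →ₗ[ℝ] SFun κ U :=
  if p = 0 then LinearMap.id
  else LinearMap.lTensor (CInf U)
    (CliffordAlgebra.involute (Q := (0 : QuadraticForm ℝ (κ → ℝ)))).toLinearMap

/-- The body of a superfunction: the smooth function obtained by throwing away the odd
coordinates. -/
def SFun.body {U : Opens (ι → ℝ)} : SFun κ U →ₐ[ℝ] CInf U :=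
  (Algebra.TensorProduct.rid ℝ ℝ (CInf U)).toAlgHom.comp
    (Algebra.TensorProduct.map (AlgHom.id ℝ (CInf U)) ExteriorAlgebra.algebraMapInv)

/-- The coordinate vector fields `∂_{x^I}` acting on superfunctions: partial derivatives for the
even coordinates, left derivatives (contractions) for the odd ones. -/
def SFun.d {U : Opens (ι → ℝ)} : ι ⊕ κ → SFun κ U →ₗ[ℝ] SFun κ U
  | Sum.inl a => LinearMap.rTensor (Grass κ) (CInf.pderiv U a)
  | Sum.inr B => LinearMap.lTensor (CInf U)
      (CliffordAlgebra.contractLeft (Q := (0 : QuadraticForm ℝ (κ → ℝ))) (LinearMap.proj B))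

/-- The coordinate superfunctions `x^I`. -/
def SFun.coord (U : Opens (ι → ℝ)) : ι ⊕ κ → SFun κ U
  | Sum.inl a => SFun.ofCInf (CInf.coord U a)
  | Sum.inr B => SFun.ofGrass (xi B)

/-- Pull-back of superfunctions along the smooth map `U → V` with components `u`, the odd
coordinates being preserved. -/
def SFun.pull {U : Opens (ι' → ℝ)} {V : Opens (ι → ℝ)} (u : ι → CInf U)
    (h : ∀ x : U, (fun a => (u a).1 x) ∈ V) : SFun κ V →ₐ[ℝ] SFun κ U :=
  Algebra.TensorProduct.map (CInf.pull u h) (AlgHom.id ℝ (Grass κ))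

/-- Restriction of superfunctions to a smaller open set. -/
def SFun.res {U V : Opens (ι → ℝ)} (h : U ≤ V) : SFun κ V →ₐ[ℝ] SFun κ U :=
  SFun.pull (CInf.coord U) fun x => h x.2

theorem SFun.pull_tmul {U : Opens (ι' → ℝ)} {V : Opens (ι → ℝ)} (u : ι → CInf U)
    (h : ∀ x : U, (fun a => (u a).1 x) ∈ V) (f : CInf V) (w : Grass κ) :
    SFun.pull u h (f ⊗ₜ w) = CInf.pull u h f ⊗ₜ w := rfl

theorem SFun.tmul_mem_homog {U : Opens (ι → ℝ)} {p : ZMod 2} (f : CInf U) (w : Grass κ)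
    (hw : w ∈ CliffordAlgebra.evenOdd (0 : QuadraticForm ℝ (κ → ℝ)) p) :
    f ⊗ₜ w ∈ SFun.homog κ U p :=
  ⟨f ⊗ₜ ⟨w, hw⟩, rfl⟩

theorem SFun.homog_induction {U : Opens (ι → ℝ)} {p : ZMod 2} {P : SFun κ U → Prop}
    (h0 : P 0) (ht : ∀ f : CInf U, ∀ w : Grass κ,
      w ∈ CliffordAlgebra.evenOdd (0 : QuadraticForm ℝ (κ → ℝ)) p → P (f ⊗ₜ w))
    (ha : ∀ x y, P x → P y → P (x + y)) {x : SFun κ U} (hx : x ∈ SFun.homog κ U p) : P x := by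
  obtain ⟨y, rfl⟩ := hx
  induction y using TensorProduct.induction_on with
  | zero => simpa using h0
  | tmul f w => exact ht f w.1 w.2
  | add a b h1 h2 => rw [map_add]; exact ha _ _ h1 h2

theorem SFun.pull_mem_homog {U : Opens (ι' → ℝ)} {V : Opens (ι → ℝ)} (u : ι → CInf U)
    (h : ∀ x : U, (fun a => (u a).1 x) ∈ V) {p : ZMod 2} {x : SFun κ V}
    (hx : x ∈ SFun.homog κ V p) : SFun.pull u h x ∈ SFun.homog κ U p := by
  refine SFun.homog_induction (P := fun x => SFun.pull u h x ∈ SFun.homog κ U p)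
    ?_ ?_ ?_ hx
  · simp
  · intro f w hw
    exact SFun.tmul_mem_homog _ _ hw
  · intro x y h1 h2
    rw [map_add]
    exact Submodule.add_mem _ h1 h2

theorem SFun.ofCInf_mul_mem_homog {U : Opens (ι → ℝ)} (f : CInf U) {p : ZMod 2} {x : SFun κ U}
    (hx : x ∈ SFun.homog κ U p) : SFun.ofCInf f * x ∈ SFun.homog κ U p := by
  refine SFun.homog_induction (P := fun x => SFun.ofCInf f * x ∈ SFun.homog κ U p)
    ?_ ?_ ?_ hx
  · simp
  · intro g w hw
    have : SFun.ofCInf f * (g ⊗ₜ[ℝ] w) = (f * g) ⊗ₜ[ℝ] w := by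
      simp [SFun.ofCInf, Algebra.TensorProduct.tmul_mul_tmul]
    rw [this]
    exact SFun.tmul_mem_homog _ _ hw
  · intro x y h1 h2
    rw [mul_add]
    exact Submodule.add_mem _ h1 h2

theorem SFun.ofCInf_mem_homog {U : Opens (ι → ℝ)} (f : CInf U) :
    (SFun.ofCInf f : SFun κ U) ∈ SFun.homog κ U 0 :=
  SFun.tmul_mem_homog f 1
    (CliffordAlgebra.one_le_evenOdd_zero _ (Submodule.one_le.1 le_rfl))

theorem SFun.ofCInf_comm {U : Opens (ι → ℝ)} (f : CInf U) (x : SFun κ U) :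
    SFun.ofCInf f * x = x * SFun.ofCInf f := by
  induction x using TensorProduct.induction_on with
  | zero => simp
  | tmul g w => simp [SFun.ofCInf, Algebra.TensorProduct.tmul_mul_tmul, mul_comm]
  | add a b h1 h2 => rw [mul_add, add_mul, h1, h2]

/-- Composition of pull-backs. -/
theorem SFun.pull_pull {ι'' : Type} [Fintype ι''] [DecidableEq ι''] {U : Opens (ι'' → ℝ)}
    {V : Opens (ι' → ℝ)} {W : Opens (ι → ℝ)} (u : ι' → CInf U)
    (hu : ∀ x : U, (fun a => (u a).1 x) ∈ V) (w : ι → CInf V)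
    (hw : ∀ x : V, (fun a => (w a).1 x) ∈ W) (z : ι → CInf U)
    (hz : ∀ x : U, (fun a => (z a).1 x) ∈ W) (e : ∀ a, CInf.pull u hu (w a) = z a)
    (x : SFun κ W) : SFun.pull u hu (SFun.pull w hw x) = SFun.pull z hz x := by
  obtain rfl : (fun a => CInf.pull u hu (w a)) = z := funext e
  induction x using TensorProduct.induction_on with
  | zero => simp
  | tmul f w' => rfl
  | add a b h1 h2 => simp only [map_add, h1, h2]

theorem SFun.body_tmul {U : Opens (ι → ℝ)} (f : CInf U) (w : Grass κ) :
    SFun.body (f ⊗ₜ[ℝ] w : SFun κ U) = ExteriorAlgebra.algebraMapInv w • f := by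
  simp [SFun.body]

theorem SFun.body_ofCInf {U : Opens (ι → ℝ)} (f : CInf U) :
    SFun.body (SFun.ofCInf f : SFun κ U) = f := by
  simp [SFun.ofCInf, SFun.body_tmul]

theorem SFun.body_pull {U : Opens (ι' → ℝ)} {V : Opens (ι → ℝ)} (u : ι → CInf U)
    (h : ∀ x : U, (fun a => (u a).1 x) ∈ V) (x : SFun κ V) :
    SFun.body (SFun.pull u h x) = CInf.pull u h (SFun.body x) := by
  induction x using TensorProduct.induction_on with
  | zero => simp
  | tmul f w => rw [SFun.pull_tmul, SFun.body_tmul, SFun.body_tmul, map_smul]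
  | add a b h1 h2 => simp only [map_add, h1, h2]

/-- A morphism from the superdomain over `U` to `ℝ^{ι|κ}`, given by the pull-backs of the
coordinates: even superfunctions and odd superfunctions (the latter recorded through the algebra
homomorphism from the exterior algebra that they generate). -/
@[ext]
structure SMap (κ : Type) [DecidableEq κ] (U : Opens (ι → ℝ)) where
  even : ι → SFun κ U
  even_mem : ∀ a, even a ∈ SFun.homog κ U 0
  odd : Grass κ →ₐ[ℝ] SFun κ U
  odd_mem : ∀ B : κ, odd (xi B) ∈ SFun.homog κ U 1

namespace SMap

variable {U : Opens (ι → ℝ)}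

/-- The inclusion of `U`, given by the coordinates themselves. -/
def incl (U : Opens (ι → ℝ)) : SMap κ U where
  even a := SFun.ofCInf (CInf.coord U a)
  even_mem _ := SFun.ofCInf_mem_homog _
  odd := SFun.ofGrass
  odd_mem _ := SFun.tmul_mem_homog _ _ (CliffordAlgebra.ι_mem_evenOdd_one _ _)

/-- The pull-back of the coordinate `x^K`. -/
def coord (c : SMap κ U) : ι ⊕ κ → SFun κ U
  | Sum.inl a => c.even a
  | Sum.inr B => c.odd (xi B)

/-- The super Jacobian matrix: `∂_{x^I} = ∑ K, jac I K • ∂_{x'^K}`. -/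
def jac (c : SMap κ U) (I K : ι ⊕ κ) : SFun κ U := SFun.d I (c.coord K)

/-- The body of the morphism maps `U` into `V`. -/
def MapsTo (c : SMap κ U) (V : Opens (ι → ℝ)) : Prop :=
  ∀ x : U, (fun a => (SFun.body (c.even a)).1 x) ∈ V

/-- Restriction of a morphism to a smaller open set. -/
def restrict (c : SMap κ U) {W : Opens (ι → ℝ)} (h : W ≤ U) : SMap κ W where
  even a := SFun.res h (c.even a)
  even_mem a := SFun.pull_mem_homog _ _ (c.even_mem a)
  odd := (SFun.res h).comp c.odd
  odd_mem B := SFun.pull_mem_homog _ _ (c.odd_mem B)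

/-- The nilpotent part of the pull-back of the even coordinate `x^a`. -/
def nil (c : SMap κ U) (a : ι) : SFun κ U := c.even a - SFun.ofCInf (SFun.body (c.even a))

/-- The term `∑ ν^{a₁} ⋯ ν^{a_k} (∂_{a₁} ⋯ ∂_{a_k} F) ∘ body` of the Taylor expansion of a smooth
function `F` around the body of the morphism, `ν` being its nilpotent part. -/
def taylorTerm (c : SMap κ U) {V : Opens (ι → ℝ)} (h : c.MapsTo V) :
    ℕ → (CInf V →ₗ[ℝ] SFun κ U)
  | 0 => SFun.ofCInf.toLinearMap ∘ₗ (CInf.pull (fun a => SFun.body (c.even a)) h).toLinearMap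
  | k + 1 => ∑ a, LinearMap.mulLeft ℝ (c.nil a) ∘ₗ taylorTerm c h k ∘ₗ CInf.pderiv V a

/-- Pull-back of a smooth function of the even coordinates: the Taylor expansion around the body
(finite, because products of more than `|κ|` nilpotent parts vanish). -/
def taylor (c : SMap κ U) {V : Opens (ι → ℝ)} (h : c.MapsTo V) : CInf V →ₗ[ℝ] SFun κ U :=
  ∑ k ∈ Finset.range (Fintype.card κ + 1), ((k.factorial : ℝ)⁻¹) • c.taylorTerm h k

/-- Pull-back of superfunctions along a morphism (substitution of the coordinates). -/
def subst (c : SMap κ U) {V : Opens (ι → ℝ)} (h : c.MapsTo V) : SFun κ V →ₗ[ℝ] SFun κ U :=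
  LinearMap.mul' ℝ (SFun κ U) ∘ₗ TensorProduct.map (c.taylor h) c.odd.toLinearMap

end SMap

/-! ### Vector fields, connections and curvature on a superdomain -/

/-- Vector fields `X = ∑ X^I ∂_{x^I}` on the superdomain over `U`. -/
abbrev Vect (κ : Type) (U : Opens (ι → ℝ)) : Type := ι ⊕ κ → SFun κ U

namespace Vect

variable {U : Opens (ι → ℝ)}

/-- The vector field `X` is homogeneous of degree `p`. -/
def IsHomog (p : ZMod 2) (X : Vect κ U) : Prop := ∀ I, X I ∈ SFun.homog κ U (p + deg I)

/-- The coordinate vector field `∂_{x^I}`. -/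
def frame (I : ι ⊕ κ) : Vect κ U := Pi.single I 1

/-- The action `X(f)` of a vector field on a superfunction. -/
def act (X : Vect κ U) (f : SFun κ U) : SFun κ U := ∑ I, X I * SFun.d I f

/-- Right multiplication `X · f`, that is `(-1)^{|X||f|} f X` for homogeneous `X` and `f`. -/
def rmul (X : Vect κ U) (f : SFun κ U) : Vect κ U := fun I => X I * SFun.twist (deg I) f

/-- The bracket `[X, Y] = X Y - (-1)^{|X||Y|} Y X` of vector fields of degrees `a` and `b`. -/
def bracket (a b : ZMod 2) (X Y : Vect κ U) : Vect κ U :=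
  fun K => X.act (Y K) - sgn a b • Y.act (X K)

/-- The pairing `⟨X, Y⟩_g` with components `g I J = ⟨∂_{x^I}, ∂_{x^J}⟩_g` of an even metric. -/
def pair (g : ι ⊕ κ → ι ⊕ κ → SFun κ U) (X Y : Vect κ U) : SFun κ U :=
  ∑ I, ∑ J, X I * SFun.twist (deg I) (Y J) * g I J

end Vect

/-- Affine connections on the superdomain over `U`. -/
structure AffineConnection (κ : Type) [Fintype κ] (U : Opens (ι → ℝ)) where
  cov : Vect κ U → Vect κ U → Vect κ U
  cov_homog : ∀ a b X Y, X.IsHomog a → Y.IsHomog b → (cov X Y).IsHomog (a + b)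
  cov_add_left : ∀ X Y Z, cov (X + Y) Z = cov X Z + cov Y Z
  cov_add_right : ∀ X Y Z, cov X (Y + Z) = cov X Y + cov X Z
  cov_smul_left : ∀ (f : SFun κ U) X Y, cov (f • X) Y = f • cov X Y
  leibniz : ∀ (a r : ZMod 2) (X Y : Vect κ U) (f : SFun κ U), X.IsHomog a →
    f ∈ SFun.homog κ U r → cov X (f • Y) = X.act f • Y + sgn a r • (f • cov X Y)

section Connection

variable {U : Opens (ι → ℝ)}

/-- `D` is the Levi-Civita connection of the metric `g`: torsion free and metric compatible. -/
def AffineConnection.IsLeviCivita (D : AffineConnection κ U)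
    (g : ι ⊕ κ → ι ⊕ κ → SFun κ U) : Prop :=
  (∀ a b X Y, X.IsHomog a → Y.IsHomog b →
    D.cov X Y - sgn a b • D.cov Y X - Vect.bracket a b X Y = 0) ∧
  (∀ a b X Y Z, X.IsHomog a → Y.IsHomog b →
    X.act (Vect.pair g Y Z) =
      Vect.pair g (D.cov X Y) Z + sgn a b • Vect.pair g Y (D.cov X Z))

/-- The curvature `R(X, Y)Z` for `X`, `Y` homogeneous of degrees `a`, `b`. -/
def curvature (cov : Vect κ U → Vect κ U → Vect κ U) (a b : ZMod 2) (X Y Z : Vect κ U) :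
    Vect κ U :=
  cov X (cov Y Z) - sgn a b • cov Y (cov X Z) - cov (Vect.bracket a b X Y) Z

/-- The Ricci tensor `Ric(X, Y)` for `X`, `Y` homogeneous of degrees `a`, `b`: the supertrace of
the curvature, symmetrized. -/
def ricci (cov : Vect κ U → Vect κ U → Vect κ U) (a b : ZMod 2) (X Y : Vect κ U) : SFun κ U :=
  ∑ I, (sgn (deg I) (deg I + a + b) * (1 / 2)) •
    (curvature cov (deg I) a (Vect.frame I) X Y I +
      sgn a b • curvature cov (deg I) b (Vect.frame I) Y X I)

/-- The semi-symmetric non-metric connection `∇_X Y + X · g(Y, P)`. -/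
def semiSymm (cov : Vect κ U → Vect κ U → Vect κ U) (g : ι ⊕ κ → ι ⊕ κ → SFun κ U)
    (P : Vect κ U) (X Y : Vect κ U) : Vect κ U :=
  cov X Y + X.rmul (Vect.pair g Y P)

end Connection

end Superdomain

/-! ### Supermanifolds -/

section Manifold

variable {ι : Type} [Fintype ι] [DecidableEq ι] {κ : Type} [Fintype κ] [DecidableEq κ]

/-- The part of the target of the chart `φ` that is also covered by the chart `ψ`. -/
def overlap {X : Type u} [TopologicalSpace X] (φ ψ : OpenPartialHomeomorph X (ι → ℝ)) :
    Opens (ι → ℝ) :=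
  ⟨(φ.symm.trans ψ).source, (φ.symm.trans ψ).open_source⟩

/-- A supermanifold of dimension `|ι| | |κ|`: a second countable Hausdorff space with an atlas of
superdomains, glued along isomorphisms of superdomains over the coordinate changes of the
underlying space. -/
structure Supermanifold (ι κ : Type) [Fintype ι] [DecidableEq ι] [Fintype κ] [DecidableEq κ] where
  carrier : Type u
  [top : TopologicalSpace carrier]
  [t2 : T2Space carrier]
  [sc : SecondCountableTopology carrier]
  Index : Type v
  chart : Index → OpenPartialHomeomorph carrier (ι → ℝ)
  cover : ∀ x, ∃ i, x ∈ (chart i).source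
  trans : ∀ i j, SMap κ (overlap (chart i) (chart j))
  trans_body : ∀ i j (x : overlap (chart i) (chart j)) a,
    (SFun.body ((trans i j).even a)).1 x = chart j ((chart i).symm x.1) a
  trans_self : ∀ i, trans i i = SMap.incl _
  cocycle : ∀ i j k (W : Opens (ι → ℝ)) (hij : W ≤ overlap (chart i) (chart j))
    (hik : W ≤ overlap (chart i) (chart k))
    (hjk : ((trans i j).restrict hij).MapsTo (overlap (chart j) (chart k))) K,
    ((trans i j).restrict hij).subst hjk ((trans j k).coord K) =
      SFun.res hik ((trans i k).coord K)

attribute [instance] Supermanifold.top Supermanifold.t2 Supermanifold.sc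

namespace Supermanifold

/-- The open set of `ℝ^ι` on which the `i`-th superdomain lives. -/
def dom (M : Supermanifold.{u, v} ι κ) (i : M.Index) : Opens (ι → ℝ) :=
  ⟨(M.chart i).target, (M.chart i).open_target⟩

/-- The domain of the coordinate change from chart `i` to chart `j`. -/
abbrev ovl (M : Supermanifold.{u, v} ι κ) (i j : M.Index) : Opens (ι → ℝ) :=
  overlap (M.chart i) (M.chart j)

theorem mem_overlap {X : Type u} [TopologicalSpace X] (φ ψ : OpenPartialHomeomorph X (ι → ℝ))
    (x : ι → ℝ) : x ∈ overlap φ ψ ↔ x ∈ φ.target ∧ φ.symm x ∈ ψ.source := by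
  show x ∈ (φ.symm.trans ψ).source ↔ _
  simp

theorem ovl_le (M : Supermanifold.{u, v} ι κ) (i j : M.Index) : M.ovl i j ≤ M.dom i :=
  fun x hx => ((mem_overlap _ _ x).1 hx).1

theorem trans_mapsTo (M : Supermanifold.{u, v} ι κ) (i j : M.Index) :
    (M.trans i j).MapsTo (M.dom j) := by
  intro x
  have : (fun a => (SFun.body ((M.trans i j).even a)).1 x) =
      M.chart j ((M.chart i).symm x.1) := funext fun a => M.trans_body i j x a
  rw [this]
  exact (M.chart j).map_source ((mem_overlap _ _ x.1).1 x.2).2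

end Supermanifold

/-- Vector fields on a supermanifold, given by their components in the charts. -/
structure VectorField (M : Supermanifold.{u, v} ι κ) where
  comp : ∀ i, Vect κ (M.dom i)
  comp_trans : ∀ i j K, (M.trans i j).subst (M.trans_mapsTo i j) (comp j K) =
    ∑ I, SFun.res (M.ovl_le i j) (comp i I) * (M.trans i j).jac I K

/-- Even Riemannian metrics on a supermanifold (of arbitrary signature), given by their components
`comp i I J = ⟨∂_{x^I}, ∂_{x^J}⟩_g` in the charts: homogeneous of degree zero, supersymmetric,
non-degenerate, and compatible with the coordinate changes. -/
structure EvenMetric (M : Supermanifold.{u, v} ι κ) where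
  comp : ∀ i, ι ⊕ κ → ι ⊕ κ → SFun κ (M.dom i)
  comp_homog : ∀ i I J, comp i I J ∈ SFun.homog κ (M.dom i) (deg I + deg J)
  comp_symm : ∀ i I J, comp i I J = sgn (deg I) (deg J) • comp i J I
  nondeg : ∀ i, IsUnit (Matrix.of (comp i))
  comp_trans : ∀ i j I J, SFun.res (M.ovl_le i j) (comp i I J) =
    ∑ K, ∑ L, sgn (deg K) (deg J + deg L) • ((M.trans i j).jac I K * (M.trans i j).jac J L *
      (M.trans i j).subst (M.trans_mapsTo i j) (comp j K L))

namespace EvenMetric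

variable {M : Supermanifold.{u, v} ι κ}

/-- The Levi-Civita connection of a metric, given in the charts. On each chart it is the only
torsion free and metric compatible affine connection, so that no compatibility with the coordinate
changes has to be imposed. -/
structure LeviCivita (g : EvenMetric M) where
  conn : ∀ i, AffineConnection κ (M.dom i)
  isLeviCivita : ∀ i, (conn i).IsLeviCivita (g.comp i)

/-- `(M, g, cov)` is Einstein with Einstein constant `lam`: `Ric(X, Y) = lam g(X, Y)` for all
(homogeneous) vector fields, `Ric` being the Ricci tensor of the connection `cov`. -/
def IsEinsteinFor (g : EvenMetric M) (cov : ∀ i, Vect κ (M.dom i) → Vect κ (M.dom i) →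
    Vect κ (M.dom i)) (lam : ℝ) : Prop :=
  ∀ i a b (X Y : Vect κ (M.dom i)), X.IsHomog a → Y.IsHomog b →
    ricci (cov i) a b X Y = lam • Vect.pair (g.comp i) X Y

/-- `(M, g, ∇^L)` is Einstein with Einstein constant `lam`. -/
def IsEinstein (g : EvenMetric M) (lam : ℝ) : Prop :=
  ∃ D : g.LeviCivita, g.IsEinsteinFor (fun i => (D.conn i).cov) lam

/-- `(M, g, ∇̂)` is Einstein with Einstein constant `lam`, where `∇̂` is the semi-symmetric
non-metric connection `∇̂_X Y = ∇^L_X Y + X · g(Y, P)`. -/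
def IsEinsteinSemiSymm (g : EvenMetric M) (P : VectorField M) (lam : ℝ) : Prop :=
  ∃ D : g.LeviCivita,
    g.IsEinsteinFor (fun i => semiSymm (D.conn i).cov (g.comp i) (P.comp i)) lam

end EvenMetric

end Manifold

/-! ### The product with the real line and the warped product -/

section Product

variable {ι : Type} [Fintype ι] [DecidableEq ι] {κ : Type} [Fintype κ] [DecidableEq κ]

/-- `ℝ × ℝ^ι = ℝ^{Option ι}`; the coordinate `t` of the first factor has index `none`. -/
def consHomeo (ι : Type) : ℝ × (ι → ℝ) ≃ₜ (Option ι → ℝ) where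
  toFun p o := o.elim p.1 p.2
  invFun z := (z none, fun a => z (some a))
  left_inv _ := rfl
  right_inv z := funext fun o => by cases o <;> rfl
  continuous_toFun := by
    refine continuous_pi fun o => ?_
    cases o with
    | none => exact continuous_fst
    | some a => exact (continuous_apply a).comp continuous_snd
  continuous_invFun := by fun_prop

/-- The chart `id × φ` of `ℝ × X`. -/
def lineChart {X : Type u} [TopologicalSpace X] (φ : OpenPartialHomeomorph X (ι → ℝ)) :
    OpenPartialHomeomorph (ℝ × X) (Option ι → ℝ) :=
  ((OpenPartialHomeomorph.refl ℝ).prod φ).transHomeomorph (consHomeo ι)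

theorem mem_lineChart_target {X : Type u} [TopologicalSpace X]
    (φ : OpenPartialHomeomorph X (ι → ℝ)) (z : Option ι → ℝ) :
    z ∈ (lineChart φ).target ↔ (fun a => z (some a)) ∈ φ.target := by
  show ((consHomeo ι).symm z) ∈ (Set.univ : Set ℝ) ×ˢ φ.target ↔ _
  simp only [Set.mem_prod, Set.mem_univ, true_and]
  rfl

theorem mem_overlap_lineChart {X : Type u} [TopologicalSpace X]
    (φ ψ : OpenPartialHomeomorph X (ι → ℝ)) (z : Option ι → ℝ) :
    z ∈ overlap (lineChart φ) (lineChart ψ) ↔ (fun a => z (some a)) ∈ overlap φ ψ := by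
  rw [Supermanifold.mem_overlap, Supermanifold.mem_overlap, mem_lineChart_target]
  refine and_congr Iff.rfl ?_
  show ((z none, φ.symm fun a => z (some a)) : ℝ × X) ∈ (Set.univ : Set ℝ) ×ˢ ψ.source ↔ _
  simp only [Set.mem_prod, Set.mem_univ, true_and]

/-- The function `H(t)` on an open subset of `ℝ × ℝ^ι`. -/
def timeFn (W : Opens (Option ι → ℝ)) (H : ℝ → ℝ) (hH : ContDiff ℝ ∞ H) : CInf W :=
  CInf.mk (fun z => H (z none)) (hH.comp (contDiff_apply ℝ ℝ none)).contDiffOn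

/-- Pull-back of functions along the projection `ℝ × ℝ^ι → ℝ^ι`. -/
def CInf.pr {W : Opens (Option ι → ℝ)} {V : Opens (ι → ℝ)}
    (h : ∀ z : W, (fun a => z.1 (some a)) ∈ V) : CInf V →ₐ[ℝ] CInf W :=
  CInf.pull (fun a => CInf.coord W (some a)) h

/-- Pull-back of superfunctions along the projection `ℝ × ℝ^ι → ℝ^ι`. -/
def SFun.pr {W : Opens (Option ι → ℝ)} {V : Opens (ι → ℝ)}
    (h : ∀ z : W, (fun a => z.1 (some a)) ∈ V) : SFun κ V →ₐ[ℝ] SFun κ W :=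
  SFun.pull (fun a => CInf.coord W (some a)) h

theorem SFun.pr_tmul {W : Opens (Option ι → ℝ)} {V : Opens (ι → ℝ)}
    (h : ∀ z : W, (fun a => z.1 (some a)) ∈ V) (f : CInf V) (w : Grass κ) :
    SFun.pr h (f ⊗ₜ[ℝ] w) = CInf.pr h f ⊗ₜ[ℝ] w := rfl

theorem SFun.body_pr {W : Opens (Option ι → ℝ)} {V : Opens (ι → ℝ)}
    (h : ∀ z : W, (fun a => z.1 (some a)) ∈ V) (x : SFun κ V) :
    SFun.body (SFun.pr h x) = CInf.pr h (SFun.body x) := SFun.body_pull _ _ x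

/-- The morphism `id × c` of superdomains. -/
def SMap.line {U : Opens (ι → ℝ)} (c : SMap κ U) (W : Opens (Option ι → ℝ))
    (h : ∀ z : W, (fun a => z.1 (some a)) ∈ U) : SMap κ W where
  even o := o.elim (SFun.ofCInf (CInf.coord W none)) fun a => SFun.pr h (c.even a)
  even_mem o := by
    cases o with
    | none => exact SFun.ofCInf_mem_homog _
    | some a => exact SFun.pull_mem_homog _ _ (c.even_mem a)
  odd := (SFun.pr h).comp c.odd
  odd_mem B := SFun.pull_mem_homog _ _ (c.odd_mem B)

section Lemmas

variable {W W' : Opens (Option ι → ℝ)} {U V : Opens (ι → ℝ)}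

theorem CInf.fderiv_pr (h : ∀ z : W, (fun a => z.1 (some a)) ∈ V) (F : CInf V) (z : W)
    (y : Option ι → ℝ) : fderiv ℝ (ext0 (CInf.pr h F).1) z y =
      fderiv ℝ (ext0 F.1) (fun a => z.1 (some a)) fun a => y (some a) := by
  rw [CInf.fderiv_eq (CInf.pr h F).1 (fun z => ext0 F.1 (fun a => z (some a)))
    (fun x => (ext0_apply F.1 ⟨fun a => x.1 (some a), h x⟩).symm) z]
  have h1 : HasFDerivAt (fun z : Option ι → ℝ => fun a : ι => z (some a))
      (ContinuousLinearMap.pi fun a => ContinuousLinearMap.proj (some a)) z.1 :=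
    ContinuousLinearMap.hasFDerivAt
      (ContinuousLinearMap.pi fun a : ι => ContinuousLinearMap.proj (R := ℝ)
        (φ := fun _ : Option ι => ℝ) (some a))
  have h2 := (CInf.differentiableAt F ⟨fun a => z.1 (some a), h z⟩).hasFDerivAt.comp z.1 h1
  have h3 := h2.fderiv
  simp only [Function.comp_def] at h3
  rw [h3]
  rfl

theorem CInf.pderiv_none_pr (h : ∀ z : W, (fun a => z.1 (some a)) ∈ V) (F : CInf V) :
    CInf.pderiv W none (CInf.pr h F) = 0 := by
  apply Subtype.ext
  funext z
  rw [CInf.pderiv_apply, CInf.fderiv_pr]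
  have h4 : (fun a : ι => (Pi.single none 1 : Option ι → ℝ) (some a)) = 0 := by
    ext a; simp
  rw [h4, map_zero]
  rfl

theorem CInf.pderiv_some_pr (h : ∀ z : W, (fun a => z.1 (some a)) ∈ V) (F : CInf V) (b : ι) :
    CInf.pderiv W (some b) (CInf.pr h F) = CInf.pr h (CInf.pderiv V b F) := by
  apply Subtype.ext
  funext z
  rw [CInf.pderiv_apply, CInf.fderiv_pr]
  have h4 : (fun a : ι => (Pi.single (some b) 1 : Option ι → ℝ) (some a)) = Pi.single b 1 := by
    ext a; simp [Pi.single_apply]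
  rw [h4]
  rfl

theorem CInf.pderiv_some_timeFn (H : ℝ → ℝ) (hH : ContDiff ℝ ∞ H) (b : ι) :
    CInf.pderiv W (some b) (timeFn W H hH) = 0 := by
  apply Subtype.ext
  funext z
  rw [CInf.pderiv_apply, CInf.fderiv_eq (timeFn W H hH).1 (fun z => H (z none)) (fun _ => rfl) z]
  have h1 : HasFDerivAt (fun z : Option ι → ℝ => z none)
      (ContinuousLinearMap.proj (R := ℝ) (φ := fun _ : Option ι => ℝ) none) z.1 :=
    hasFDerivAt_apply none z.1
  have h2 := ((hH.differentiable (by simp)) (z.1 none)).hasFDerivAt.comp z.1 h1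
  have h3 := h2.fderiv
  simp only [Function.comp_def] at h3
  rw [h3]
  show (fderiv ℝ H _) ((Pi.single (some b) 1 : Option ι → ℝ) none) = 0
  rw [Pi.single_eq_of_ne (by simp), map_zero]

theorem SFun.d_pr_none (h : ∀ z : W, (fun a => z.1 (some a)) ∈ V) (F : SFun κ V) :
    SFun.d (Sum.inl none) (SFun.pr h F) = 0 := by
  induction F using TensorProduct.induction_on with
  | zero => simp
  | tmul f w =>
    show CInf.pderiv W none (CInf.pr h f) ⊗ₜ[ℝ] w = 0
    rw [CInf.pderiv_none_pr, TensorProduct.zero_tmul]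
  | add a b h1 h2 => rw [map_add, map_add, h1, h2, add_zero]

/-- The index in `Option ι ⊕ κ` of a coordinate of the second factor. -/
def up : ι ⊕ κ → Option ι ⊕ κ := Sum.map some _root_.id

theorem deg_up (I : ι ⊕ κ) : deg (up I) = deg I := by cases I <;> rfl

theorem SFun.d_pr_up (h : ∀ z : W, (fun a => z.1 (some a)) ∈ V) (I : ι ⊕ κ) (F : SFun κ V) :
    SFun.d (up I) (SFun.pr h F) = SFun.pr h (SFun.d I F) := by
  induction F using TensorProduct.induction_on with
  | zero => simp
  | tmul f w =>
    cases I with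
    | inl a =>
      show CInf.pderiv W (some a) (CInf.pr h f) ⊗ₜ[ℝ] w =
        CInf.pr h (CInf.pderiv V a f) ⊗ₜ[ℝ] w
      rw [CInf.pderiv_some_pr]
    | inr B => rfl
  | add a b h1 h2 => simp only [map_add, h1, h2]

theorem SMap.line_mapsTo {c : SMap κ U} (hW : ∀ z : W, (fun a => z.1 (some a)) ∈ U)
    (hc : c.MapsTo V) (hV : ∀ z : Option ι → ℝ, (fun a => z (some a)) ∈ V → z ∈ W') :
    (c.line W hW).MapsTo W' := by
  intro z
  apply hV
  have := hc ⟨_, hW z⟩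
  convert this using 2 with a
  show (SFun.body (SFun.pr hW (c.even a))).1 z = _
  rw [SFun.body_pr]
  rfl

theorem SMap.taylorTerm_line {c : SMap κ U} (hW : ∀ z : W, (fun a => z.1 (some a)) ∈ U)
    (hc : c.MapsTo V) (hV : ∀ z : W', (fun a => z.1 (some a)) ∈ V)
    (hl : (c.line W hW).MapsTo W') (H : ℝ → ℝ) (hH : ContDiff ℝ ∞ H) (k : ℕ) (F : CInf V) :
    (c.line W hW).taylorTerm hl k
        (timeFn W' H hH * CInf.pr hV F) =
      SFun.ofCInf (timeFn W H hH) * SFun.pr hW (c.taylorTerm hc k F) := by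
  induction k generalizing F with
  | zero =>
    show SFun.ofCInf (CInf.pull _ hl _) = SFun.ofCInf _ * SFun.pr hW (SFun.ofCInf _)
    have e : ∀ f : CInf U, SFun.pr hW (SFun.ofCInf f : SFun κ U) =
        SFun.ofCInf (CInf.pr hW f) := fun f => rfl
    rw [e, ← map_mul]
    congr 1
    apply Subtype.ext
    funext z
    have e0 : (SFun.body ((c.line W hW).even none)).1 z = z.1 none := by
      show (SFun.body (SFun.ofCInf (CInf.coord W none) : SFun κ W)).1 z = _
      rw [SFun.body_ofCInf]
      rfl
    have e1 : ∀ a, (SFun.body ((c.line W hW).even (some a))).1 z =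
        (SFun.body (c.even a)).1 ⟨fun a => z.1 (some a), hW z⟩ := by
      intro a
      show (SFun.body (SFun.pr hW (c.even a))).1 z = _
      rw [SFun.body_pr]
      rfl
    show H ((SFun.body ((c.line W hW).even none)).1 z) *
        F.1 ⟨fun a => (SFun.body ((c.line W hW).even (some a))).1 z, _⟩ =
      H (z.1 none) * F.1 ⟨fun a => (SFun.body (c.even a)).1 ⟨fun a => z.1 (some a), hW z⟩, _⟩
    rw [e0]
    exact congrArg (fun y => H (z.1 none) * F.1 y) (Subtype.ext (funext e1))
  | succ k ih =>
    simp only [SMap.taylorTerm, LinearMap.sum_apply, LinearMap.comp_apply,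
      LinearMap.mulLeft_apply, map_sum, map_mul, Finset.mul_sum]
    rw [Fintype.sum_option]
    have e0 : (c.line W hW).nil none = 0 := by
      show SFun.ofCInf _ - SFun.ofCInf (SFun.body (SFun.ofCInf _)) = 0
      rw [SFun.body_ofCInf, sub_self]
    rw [e0, zero_mul, zero_add]
    refine Finset.sum_congr rfl fun a _ => ?_
    have e1 : (c.line W hW).nil (some a) = SFun.pr hW (c.nil a) := by
      show SFun.pr hW (c.even a) - SFun.ofCInf (SFun.body (SFun.pr hW (c.even a))) = _
      rw [SMap.nil, map_sub]
      congr 1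
      rw [SFun.body_pr]
      rfl
    rw [CInf.pderiv_mul, CInf.pderiv_some_timeFn, zero_mul, add_zero, CInf.pderiv_some_pr,
      ih, e1, ← mul_assoc, ← mul_assoc, SFun.ofCInf_comm]

theorem SMap.subst_line {c : SMap κ U} (hW : ∀ z : W, (fun a => z.1 (some a)) ∈ U)
    (hc : c.MapsTo V) (hV : ∀ z : W', (fun a => z.1 (some a)) ∈ V)
    (hl : (c.line W hW).MapsTo W') (H : ℝ → ℝ) (hH : ContDiff ℝ ∞ H) (F : SFun κ V) :
    (c.line W hW).subst hl (SFun.ofCInf (timeFn W' H hH) * SFun.pr hV F) =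
      SFun.ofCInf (timeFn W H hH) * SFun.pr hW (c.subst hc F) := by
  induction F using TensorProduct.induction_on with
  | zero => simp
  | tmul f w =>
    have e : SFun.ofCInf (timeFn W' H hH) * SFun.pr hV (f ⊗ₜ[ℝ] w) =
        (timeFn W' H hH * CInf.pr hV f) ⊗ₜ[ℝ] w := by
      rw [SFun.pr_tmul]
      simp [SFun.ofCInf, Algebra.TensorProduct.tmul_mul_tmul]
    rw [e]
    simp only [SMap.subst, LinearMap.comp_apply, TensorProduct.map_tmul, LinearMap.mul'_apply,
      map_mul, AlgHom.toLinearMap_apply]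
    rw [← mul_assoc]
    congr 1
    simp only [SMap.taylor, LinearMap.sum_apply, LinearMap.smul_apply, map_sum, map_smul,
      Finset.mul_sum, SMap.taylorTerm_line hW hc hV hl, mul_smul_comm]
  | add a b h1 h2 => simp only [map_add, mul_add, h1, h2]

theorem SMap.subst_line_pr {c : SMap κ U} (hW : ∀ z : W, (fun a => z.1 (some a)) ∈ U)
    (hc : c.MapsTo V) (hV : ∀ z : W', (fun a => z.1 (some a)) ∈ V)
    (hl : (c.line W hW).MapsTo W') (F : SFun κ V) :
    (c.line W hW).subst hl (SFun.pr hV F) = SFun.pr hW (c.subst hc F) := by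
  have h := SMap.subst_line hW hc hV hl (fun _ => 1) contDiff_const F
  have e : ∀ W : Opens (Option ι → ℝ),
      (SFun.ofCInf (timeFn W (fun _ => 1) contDiff_const) : SFun κ W) = 1 := fun W => rfl
  rwa [e, e, one_mul, one_mul] at h

theorem index_cases (I : Option ι ⊕ κ) : I = Sum.inl none ∨ ∃ I' : ι ⊕ κ, I = up I' := by
  rcases I with (_ | a) | B
  · exact Or.inl rfl
  · exact Or.inr ⟨Sum.inl a, rfl⟩
  · exact Or.inr ⟨Sum.inr B, rfl⟩

theorem sum_index {A : Type} [AddCommMonoid A] (f : Option ι ⊕ κ → A) :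
    ∑ I, f I = f (Sum.inl none) + ∑ I : ι ⊕ κ, f (up I) := by
  rw [Fintype.sum_sum_type, Fintype.sum_option, Fintype.sum_sum_type, add_assoc]
  rfl

theorem SMap.line_coord_up (c : SMap κ U) (hW : ∀ z : W, (fun a => z.1 (some a)) ∈ U)
    (K : ι ⊕ κ) : (c.line W hW).coord (up K) = SFun.pr hW (c.coord K) := by
  cases K <;> rfl

theorem SMap.line_jac_up_up (c : SMap κ U) (hW : ∀ z : W, (fun a => z.1 (some a)) ∈ U)
    (I K : ι ⊕ κ) : (c.line W hW).jac (up I) (up K) = SFun.pr hW (c.jac I K) := by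
  rw [SMap.jac, SMap.line_coord_up, SFun.d_pr_up]
  rfl

theorem SMap.line_jac_none_up (c : SMap κ U) (hW : ∀ z : W, (fun a => z.1 (some a)) ∈ U)
    (K : ι ⊕ κ) : (c.line W hW).jac (Sum.inl none) (up K) = 0 := by
  rw [SMap.jac, SMap.line_coord_up, SFun.d_pr_none]

theorem CInf.pderiv_coord (a b : ι) (V : Opens (ι → ℝ)) :
    CInf.pderiv V a (CInf.coord V b) = if a = b then 1 else 0 := by
  apply Subtype.ext
  funext z
  rw [CInf.pderiv_apply, CInf.fderiv_eq (CInf.coord V b).1 (fun z => z b) (fun _ => rfl) z,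
    (hasFDerivAt_apply b z.1).fderiv]
  show (Pi.single a (1 : ℝ) : ι → ℝ) b = _
  split_ifs with h
  · subst h; simp
  · rw [Pi.single_eq_of_ne (Ne.symm h)]; rfl

theorem SMap.line_jac_none_none (c : SMap κ U) (hW : ∀ z : W, (fun a => z.1 (some a)) ∈ U) :
    (c.line W hW).jac (Sum.inl none) (Sum.inl none) = 1 := by
  show CInf.pderiv W none (CInf.coord W none) ⊗ₜ[ℝ] (1 : Grass κ) = 1
  rw [CInf.pderiv_coord, if_pos rfl]
  rfl

theorem SMap.line_jac_up_none (c : SMap κ U) (hW : ∀ z : W, (fun a => z.1 (some a)) ∈ U)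
    (I : ι ⊕ κ) : (c.line W hW).jac (up I) (Sum.inl none) = 0 := by
  cases I with
  | inl a =>
    show CInf.pderiv W (some a) (CInf.coord W none) ⊗ₜ[ℝ] (1 : Grass κ) = 0
    rw [CInf.pderiv_coord, if_neg (by simp), TensorProduct.zero_tmul]
  | inr B =>
    show CInf.coord W none ⊗ₜ[ℝ] (CliffordAlgebra.contractLeft (LinearMap.proj B) (1 : Grass κ)) = 0
    rw [CliffordAlgebra.contractLeft_one, TensorProduct.tmul_zero]

theorem SMap.subst_one {c : SMap κ U} (hc : c.MapsTo V) : c.subst hc 1 = 1 := by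
  have h : ∀ k, c.taylorTerm hc (k + 1) 1 = 0 := by
    intro k
    simp only [SMap.taylorTerm, LinearMap.sum_apply, LinearMap.comp_apply,
      LinearMap.mulLeft_apply]
    refine Finset.sum_eq_zero fun a _ => ?_
    have : CInf.pderiv V a 1 = 0 := by
      have := CInf.pderiv_mul a (1 : CInf V) 1
      rw [mul_one, mul_one, one_mul] at this
      exact left_eq_add.1 this
    rw [this, map_zero, mul_zero]
  have h0 : c.taylorTerm hc 0 1 = 1 := by
    show SFun.ofCInf (CInf.pull _ hc 1) = 1
    rw [map_one, map_one]
  show LinearMap.mul' ℝ (SFun κ U) (c.taylor hc 1 ⊗ₜ[ℝ] c.odd 1) = 1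
  rw [LinearMap.mul'_apply, map_one c.odd, mul_one, SMap.taylor, LinearMap.sum_apply,
    Finset.sum_range_succ']
  simp [h, h0]

end Lemmas

/-- The product `ℝ^{1|0} × M` of the real line with a supermanifold: the space `ℝ × |M|`, with the
charts `id × φ` and the coordinate changes `id × τ`. -/
def Supermanifold.line (M : Supermanifold.{u, v} ι κ) : Supermanifold.{u, v} (Option ι) κ where
  carrier := ℝ × M.carrier
  Index := M.Index
  chart i := lineChart (M.chart i)
  cover := fun ⟨t, x⟩ => by
    obtain ⟨i, hi⟩ := M.cover x
    exact ⟨i, Set.mk_mem_prod (Set.mem_univ t) hi⟩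
  trans i j := (M.trans i j).line _ fun z => (mem_overlap_lineChart _ _ z.1).1 z.2
  trans_body i j z o := by
    cases o with
    | none =>
      show (SFun.body (SFun.ofCInf (CInf.coord _ none) : SFun κ _)).1 z = z.1 none
      rw [SFun.body_ofCInf]
      rfl
    | some a =>
      show (SFun.body (SFun.pr _ ((M.trans i j).even a))).1 z = _
      rw [SFun.body_pr]
      exact M.trans_body i j ⟨fun a => z.1 (some a), (mem_overlap_lineChart _ _ z.1).1 z.2⟩ a
  trans_self i := by
    rw [M.trans_self]
    ext1
    · funext o
      cases o <;> rfl
    · exact AlgHom.ext fun w => rfl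
  cocycle i j k W hij hik hjk K := by
    have hW : ∀ z : W, (fun a => z.1 (some a)) ∈
        overlap (M.chart i) (M.chart j) ⊓ overlap (M.chart i) (M.chart k) := fun z =>
      ⟨(mem_overlap_lineChart _ _ z.1).1 (hij z.2), (mem_overlap_lineChart _ _ z.1).1 (hik z.2)⟩
    have hc : ((M.trans i j).restrict
        (inf_le_left : overlap (M.chart i) (M.chart j) ⊓ overlap (M.chart i) (M.chart k) ≤ _)).MapsTo
        (overlap (M.chart j) (M.chart k)) := by
      intro x
      have e : (fun a => (SFun.body (((M.trans i j).restrict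
          (inf_le_left : overlap (M.chart i) (M.chart j) ⊓ overlap (M.chart i) (M.chart k) ≤ _)).even
            a)).1 x) = M.chart j ((M.chart i).symm x.1) := by
        funext a
        rw [← M.trans_body i j ⟨x.1, x.2.1⟩ a]
        show (SFun.body (SFun.pull _ _ _)).1 x = _
        rw [SFun.body_pull]
        rfl
      rw [e]
      have h1 := (Supermanifold.mem_overlap _ _ x.1).1 x.2.1
      have h2 := (Supermanifold.mem_overlap _ _ x.1).1 x.2.2
      refine (Supermanifold.mem_overlap _ _ _).2 ⟨(M.chart j).map_source h1.2, ?_⟩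
      rw [(M.chart j).left_inv h1.2]
      exact h2.2
    have hr : ∀ (j' : M.Index) (h1 : W ≤ overlap (lineChart (M.chart i)) (lineChart (M.chart j')))
        (h2 : ∀ z : overlap (lineChart (M.chart i)) (lineChart (M.chart j')),
          (fun a => z.1 (some a)) ∈ overlap (M.chart i) (M.chart j'))
        (h3 : overlap (M.chart i) (M.chart j) ⊓ overlap (M.chart i) (M.chart k) ≤
          overlap (M.chart i) (M.chart j')) (x : SFun κ (overlap (M.chart i) (M.chart j'))),
        SFun.res h1 (SFun.pr h2 x) = SFun.pr hW (SFun.res h3 x) := by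
      intro j' h1 h2 h3 x
      have h4 : ∀ z : W, (fun a => (CInf.coord W (some a)).1 z) ∈
          overlap (M.chart i) (M.chart j') := fun z => h3 (hW z)
      exact (SFun.pull_pull _ _ _ _ (fun a => CInf.coord W (some a)) h4 (fun _ => rfl) x).trans
        (SFun.pull_pull _ _ _ _ (fun a => CInf.coord W (some a)) h4 (fun _ => rfl) x).symm
    have hl : ((M.trans i j).line (overlap (lineChart (M.chart i)) (lineChart (M.chart j)))
          fun z => (mem_overlap_lineChart _ _ z.1).1 z.2).restrict hij =
        ((M.trans i j).restrict inf_le_left).line W hW := by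
      ext1
      · funext o
        cases o with
        | none => rfl
        | some a => exact hr j hij _ inf_le_left _
      · exact AlgHom.ext fun w => hr j hij _ inf_le_left _
    have key : ∀ (c' : SMap κ W), c' = ((M.trans i j).restrict inf_le_left).line W hW →
        ∀ (hjk : c'.MapsTo (overlap (lineChart (M.chart j)) (lineChart (M.chart k)))),
        c'.subst hjk (((M.trans j k).line _
          fun z => (mem_overlap_lineChart _ _ z.1).1 z.2).coord K) =
        SFun.res hik (((M.trans i k).line _
          fun z => (mem_overlap_lineChart _ _ z.1).1 z.2).coord K) := by
      rintro c' rfl hjk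
      rcases index_cases K with rfl | ⟨K', rfl⟩
      · have h := SMap.subst_line hW hc
          (W' := overlap (lineChart (M.chart j)) (lineChart (M.chart k)))
          (fun z => (mem_overlap_lineChart _ _ z.1).1 z.2) hjk _root_.id contDiff_id 1
        rw [SMap.subst_one, map_one, map_one, mul_one, mul_one] at h
        exact h
      · rw [SMap.line_coord_up, SMap.line_coord_up, SMap.subst_line_pr hW hc, hr k hik _ inf_le_right]
        congr 1
        exact M.cocycle i j k _ _ _ _ K'
    exact key _ hl hjk

/-- Sections over the `i`-th chart of `ℝ × M` project to sections over that of `M`. -/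
theorem Supermanifold.line_dom (M : Supermanifold.{u, v} ι κ) (i : M.Index) (z : M.line.dom i) :
    (fun a => z.1 (some a)) ∈ M.dom i := (mem_lineChart_target _ z.1).1 z.2

theorem Supermanifold.line_ovl (M : Supermanifold.{u, v} ι κ) (i j : M.Index) (z : M.line.ovl i j) :
    (fun a => z.1 (some a)) ∈ M.ovl i j := (mem_overlap_lineChart _ _ z.1).1 z.2

theorem Supermanifold.line_trans (M : Supermanifold.{u, v} ι κ) (i j : M.Index) :
    M.line.trans i j = (M.trans i j).line (M.line.ovl i j) (M.line_ovl i j) := rfl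

/-- The vector field `∂_t` on `ℝ^{1|0} × M`. -/
def dt (M : Supermanifold.{u, v} ι κ) : VectorField M.line where
  comp i := Vect.frame (U := M.line.dom i) (Sum.inl none)
  comp_trans i j K := by
    rw [Finset.sum_eq_single (Sum.inl none)]
    · rcases index_cases K with rfl | ⟨K', rfl⟩
      · simp only [Vect.frame, Pi.single_eq_same, SMap.subst_one, map_one, one_mul]
        exact (SMap.line_jac_none_none _ _).symm
      · have h1 : (Vect.frame (Sum.inl none) : Vect κ (M.line.dom j)) (up K') = 0 := by
          cases K' <;> simp [Vect.frame, up]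
        rw [h1, map_zero]
        refine Eq.trans ?_ (congrArg _ (SMap.line_jac_none_up _ _ _).symm)
        rw [mul_zero]
    · intro I _ hI
      simp only [Vect.frame, Pi.single_eq_of_ne hI, map_zero, zero_mul]
    · simp

/-- The components of `-dt ⊗ dt + h(t)² g`. -/
def warpComp {W : Opens (Option ι → ℝ)} {V : Opens (ι → ℝ)}
    (hW : ∀ z : W, (fun a => z.1 (some a)) ∈ V) (h : ℝ → ℝ) (hs : ContDiff ℝ ∞ h)
    (g : ι ⊕ κ → ι ⊕ κ → SFun κ V) : Option ι ⊕ κ → Option ι ⊕ κ → SFun κ W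
  | Sum.inl none, Sum.inl none => -1
  | Sum.inl none, Sum.inl (some _) => 0
  | Sum.inl none, Sum.inr _ => 0
  | Sum.inl (some _), Sum.inl none => 0
  | Sum.inr _, Sum.inl none => 0
  | Sum.inl (some a), Sum.inl (some b) => warp (Sum.inl a) (Sum.inl b)
  | Sum.inl (some a), Sum.inr B => warp (Sum.inl a) (Sum.inr B)
  | Sum.inr A, Sum.inl (some b) => warp (Sum.inr A) (Sum.inl b)
  | Sum.inr A, Sum.inr B => warp (Sum.inr A) (Sum.inr B)
where
  warp (I J : ι ⊕ κ) : SFun κ W :=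
    SFun.ofCInf (timeFn W (fun t => h t ^ 2) (hs.pow 2)) * SFun.pr hW (g I J)

section WarpLemmas

variable {W : Opens (Option ι → ℝ)} {V : Opens (ι → ℝ)}
    (hW : ∀ z : W, (fun a => z.1 (some a)) ∈ V) (h : ℝ → ℝ) (hs : ContDiff ℝ ∞ h)
    (g : ι ⊕ κ → ι ⊕ κ → SFun κ V)

theorem warpComp_none_none : warpComp hW h hs g (Sum.inl none) (Sum.inl none) = -1 := rfl

theorem warpComp_none_up (J : ι ⊕ κ) : warpComp hW h hs g (Sum.inl none) (up J) = 0 := by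
  cases J <;> rfl

theorem warpComp_up_none (J : ι ⊕ κ) : warpComp hW h hs g (up J) (Sum.inl none) = 0 := by
  cases J <;> rfl

theorem warpComp_up_up (I J : ι ⊕ κ) : warpComp hW h hs g (up I) (up J) =
    SFun.ofCInf (timeFn W (fun t => h t ^ 2) (hs.pow 2)) * SFun.pr hW (g I J) := by
  cases I <;> cases J <;> rfl

theorem warpComp_mul (k : ℝ → ℝ) (ks : ContDiff ℝ ∞ k) (g' : ι ⊕ κ → ι ⊕ κ → SFun κ V)
    (hk : ∀ t, h t * k t = 1) (hg : Matrix.of g * Matrix.of g' = 1) :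
    Matrix.of (warpComp hW h hs g) * Matrix.of (warpComp hW k ks g') = 1 := by
  have e : timeFn W (fun t => h t ^ 2) (hs.pow 2) * timeFn W (fun t => k t ^ 2) (ks.pow 2) = 1 := by
    apply Subtype.ext
    funext z
    show h (z.1 none) ^ 2 * k (z.1 none) ^ 2 = 1
    rw [← mul_pow, hk, one_pow]
  ext I J
  rw [Matrix.mul_apply, sum_index]
  simp only [Matrix.of_apply]
  rcases index_cases I with rfl | ⟨I, rfl⟩ <;> rcases index_cases J with rfl | ⟨J, rfl⟩
  · simp only [warpComp_none_none, warpComp_none_up, zero_mul, Finset.sum_const_zero]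
    simp
  · simp only [warpComp_none_up, zero_mul, mul_zero, Finset.sum_const_zero, add_zero]
    rw [Matrix.one_apply_ne]
    cases J <;> simp [up]
  · simp only [warpComp_up_none, zero_mul, mul_zero, Finset.sum_const_zero, add_zero]
    rw [Matrix.one_apply_ne]
    cases I <;> simp [up]
  · simp only [warpComp_up_none, warpComp_up_up, zero_mul, zero_add]
    have hIJ : ∑ K, g I K * g' K J = (1 : Matrix (ι ⊕ κ) (ι ⊕ κ) (SFun κ V)) I J := by
      rw [← hg, Matrix.mul_apply]
      rfl
    have : ∀ K, SFun.ofCInf (timeFn W (fun t => h t ^ 2) (hs.pow 2)) * SFun.pr hW (g I K) *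
        (SFun.ofCInf (timeFn W (fun t => k t ^ 2) (ks.pow 2)) * SFun.pr hW (g' K J)) =
        SFun.pr hW (g I K * g' K J) := by
      intro K
      rw [mul_assoc, ← mul_assoc (SFun.pr hW (g I K)), ← SFun.ofCInf_comm, mul_assoc,
        ← mul_assoc, ← map_mul, e, map_one, one_mul, map_mul]
    simp only [this]
    rw [← map_sum, hIJ]
    have hinj : Function.Injective (up : ι ⊕ κ → Option ι ⊕ κ) :=
      Function.Injective.sumMap (Option.some_injective _) Function.injective_id
    by_cases hc : I = J
    · subst hc
      simp
    · rw [Matrix.one_apply_ne hc, Matrix.one_apply_ne (fun h' => hc (hinj h')), map_zero]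

end WarpLemmas

theorem sgn_zero_left (a : ZMod 2) : sgn 0 a = 1 := by simp [sgn]

theorem sgn_zero_right (a : ZMod 2) : sgn a 0 = 1 := by simp [sgn]

/-- The warped product metric `-dt ⊗ dt + h(t)² g` on `ℝ^{1|0} × M`. -/
def EvenMetric.warp {M : Supermanifold.{u, v} ι κ} (g : EvenMetric M) (h : ℝ → ℝ)
    (hs : ContDiff ℝ ∞ h) (h0 : ∀ t, h t ≠ 0) : EvenMetric M.line where
  comp i := warpComp (M.line_dom i) h hs (g.comp i)
  comp_homog i I J := by
    rcases index_cases I with rfl | ⟨I, rfl⟩ <;> rcases index_cases J with rfl | ⟨J, rfl⟩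
    · rw [warpComp_none_none]
      refine Submodule.neg_mem _ ?_
      have := SFun.ofCInf_mem_homog (κ := κ) (1 : CInf (M.line.dom i))
      rwa [map_one] at this
    · rw [warpComp_none_up]
      exact Submodule.zero_mem _
    · rw [warpComp_up_none]
      exact Submodule.zero_mem _
    · rw [warpComp_up_up, deg_up, deg_up]
      exact SFun.ofCInf_mul_mem_homog _ (SFun.pull_mem_homog _ _ (g.comp_homog i I J))
  comp_symm i I J := by
    rcases index_cases I with rfl | ⟨I, rfl⟩ <;> rcases index_cases J with rfl | ⟨J, rfl⟩
    · show _ = sgn 0 0 • _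
      rw [sgn_zero_left, one_smul]
    · rw [warpComp_none_up, warpComp_up_none, smul_zero]
    · rw [warpComp_none_up, warpComp_up_none, smul_zero]
    · rw [warpComp_up_up, warpComp_up_up, deg_up, deg_up, g.comp_symm i I J, map_smul,
        mul_smul_comm]
  nondeg i := by
    obtain ⟨⟨A, B, hAB, hBA⟩, rfl : A = _⟩ := g.nondeg i
    exact ⟨⟨_, Matrix.of (warpComp (M.line_dom i) (fun t => (h t)⁻¹) (hs.inv h0) B),
      warpComp_mul _ h hs _ _ (hs.inv h0) _ (fun t => mul_inv_cancel₀ (h0 t)) hAB,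
      warpComp_mul _ _ (hs.inv h0) _ h hs _ (fun t => inv_mul_cancel₀ (h0 t)) hBA⟩, rfl⟩
  comp_trans i j I J := by
    have key : ∀ hm : ((M.trans i j).line (M.line.ovl i j) (M.line_ovl i j)).MapsTo (M.line.dom j),
        SFun.res (M.line.ovl_le i j) (warpComp (M.line_dom i) h hs (g.comp i) I J) =
        ∑ K, ∑ L, sgn (deg K) (deg J + deg L) •
          (((M.trans i j).line (M.line.ovl i j) (M.line_ovl i j)).jac I K *
            ((M.trans i j).line (M.line.ovl i j) (M.line_ovl i j)).jac J L *
            ((M.trans i j).line (M.line.ovl i j) (M.line_ovl i j)).subst hm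
              (warpComp (M.line_dom j) h hs (g.comp j) K L)) := by
      intro hm
      simp only [sum_index]
      rcases index_cases I with rfl | ⟨I, rfl⟩ <;> rcases index_cases J with rfl | ⟨J, rfl⟩
      · simp only [SMap.line_jac_none_none, SMap.line_jac_none_up, warpComp_none_none,
          warpComp_none_up, map_zero, mul_zero, zero_mul, smul_zero, Finset.sum_const_zero,
          add_zero, map_neg, map_one, SMap.subst_one, mul_one]
        show _ = sgn 0 _ • _
        rw [sgn_zero_left, one_smul, one_mul]
      · simp only [SMap.line_jac_none_none, SMap.line_jac_none_up, SMap.line_jac_up_none,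
          warpComp_none_up, map_zero, mul_zero, zero_mul, smul_zero, Finset.sum_const_zero,
          add_zero]
      · simp only [SMap.line_jac_none_none, SMap.line_jac_none_up, SMap.line_jac_up_none,
          warpComp_up_none, map_zero, mul_zero, zero_mul, smul_zero, Finset.sum_const_zero,
          add_zero]
      · simp only [SMap.line_jac_up_none, SMap.line_jac_up_up, warpComp_up_up, mul_zero, zero_mul,
          smul_zero, Finset.sum_const_zero, zero_add, deg_up,
          SMap.subst_line (M.line_ovl i j) (M.trans_mapsTo i j) (M.line_dom j) hm]
        have hr : SFun.res (M.line.ovl_le i j) (SFun.pr (M.line_dom i) (g.comp i I J)) =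
            SFun.pr (M.line_ovl i j) (SFun.res (M.ovl_le i j) (g.comp i I J)) := by
          have h4 : ∀ z : M.line.ovl i j, (fun a => (CInf.coord (M.line.ovl i j) (some a)).1 z) ∈
              M.dom i := fun z => M.ovl_le i j (M.line_ovl i j z)
          exact (SFun.pull_pull _ _ _ _ (fun a => CInf.coord _ (some a)) h4 (fun _ => rfl) _).trans
            (SFun.pull_pull _ _ _ _ (fun a => CInf.coord _ (some a)) h4 (fun _ => rfl) _).symm
        rw [map_mul, hr, g.comp_trans i j I J]
        simp only [map_sum, map_smul, map_mul, Finset.mul_sum, mul_smul_comm]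
        refine Finset.sum_congr rfl fun K _ => Finset.sum_congr rfl fun L _ => ?_
        congr 1
        rw [← mul_assoc (_ * _) (SFun.ofCInf _), ← SFun.ofCInf_comm]
        simp only [mul_assoc]
        rfl
    exact key _

end Product

end SuperGeom

end

noncomputable section

namespace SuperGeom

/-! ### Signs -/

section Signs

/-! Let `m = q - n` be the superdimension of the fibre and `ψ = h'/h`. On a chart of the warped
product the Levi-Civita connection is explicit: `∇_{∂_t} ∂_t = 0`, `∇_{∂_t} ∂_J = ∇_{∂_J} ∂_t = ψ
∂_J`, and `∇_{∂_I} ∂_J` is the lift of the fibre's covariant derivative plus `h h' g_IJ ∂_t`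
(`warpConnection_isLeviCivita`). Since `g_μ(Y, ∂_t) = -Y^t`, passing to the semi-symmetric
connection only subtracts `∂_I` from `∇_{∂_I} ∂_t`. A parameter `s` therefore treats both
connections at once, `s = 0` being Levi-Civita and `s = 1` semi-symmetric
(`semiSymm_warpConnection`).

The Ricci tensor is a tensor (`ricci_eq_sum`), so coordinate fields suffice. For `s = 1` its `tt`
component is `m (1 - h''/h)`, the mixed components vanish, and the fibre components are `Ric_N + (h
h'' + (m - 1) h'² - m h h') g_IJ`. The numbers `m` and `m - 1` are supertraces
(`warp_ricciTrace_none_none`, `warp_ricciTrace_up_up`). The Einstein equation thus becomes `m (1 -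
h''/h) = λ₀` together with `Ric_N = -(h h'' + (m - 1) h'² - m h h' + λ₀ h²) g_IJ`. In the second
equation only the bracket depends on `t`. Some `g_IJ` has a body that is nonzero at a chosen point
(`exists_body_ne_zero`), so the bracket is a constant `λ_N` and the fibre is Einstein.

It remains to solve two ordinary differential equations. With `λ₀ = m (1 - k)` the first is `h'' = k
h`. Differentiating the second gives `2 h h' - h'² - k h² = 0`, and differentiating once more gives
`(1 - k) h' = 0`. If `k = 1` the relation is `(h' - h)² = 0`, so `h` is a multiple of the
exponential and both constants vanish. Otherwise `h` is constant, `k = 0`, `λ₀ = m` and `λ_N = m h²`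
(`warping_solutions`, with converse `warping_equations`).

Being Einstein includes the existence of a Levi-Civita connection, so connections must be
transported in both directions. A fibre connection is warped by the formulas above; a connection on
the product induces one on the slice `t = 0` (`sliceConnection_isLeviCivita`). Uniqueness
(`cov_unique`) identifies any given Levi-Civita connection of the product with the explicit one. -/

theorem zmod_two_cases (a : ZMod 2) : a = 0 ∨ a = 1 := by
  revert a; decide

theorem sgn_one_one : sgn 1 1 = -1 := by
  simp [sgn, ZMod.val_one]

theorem sgn_comm (a b : ZMod 2) : sgn a b = sgn b a := by
  simp [sgn, mul_comm]

theorem sgn_add_right (a b c : ZMod 2) : sgn a (b + c) = sgn a b * sgn a c := by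
  have h : (1 : ZMod 2) + 1 = 0 := rfl
  rcases zmod_two_cases a with rfl | rfl <;> rcases zmod_two_cases b with rfl | rfl <;>
    rcases zmod_two_cases c with rfl | rfl <;>
    simp [sgn_zero_left, sgn_zero_right, sgn_one_one, h]

theorem sgn_add_left (a b c : ZMod 2) : sgn (a + b) c = sgn a c * sgn b c := by
  rw [sgn_comm, sgn_add_right, sgn_comm c a, sgn_comm c b]

theorem sgn_mul_self (a b : ZMod 2) : sgn a b * sgn a b = 1 := by
  rcases zmod_two_cases a with rfl | rfl <;> rcases zmod_two_cases b with rfl | rfl <;>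
    simp [sgn_zero_left, sgn_zero_right, sgn_one_one]

theorem add_self_zmod_two (a : ZMod 2) : a + a = 0 := by
  revert a; decide

end Signs

/-! ### The exterior algebra -/

section Grass

variable {κ : Type} [Fintype κ] [DecidableEq κ]

/-- Generators anticommute, so moving one to the front costs a sign for each generator passed; the
grade involution records these signs. -/
theorem Grass.mul_ι (w : Grass κ) (m : κ → ℝ) :
    w * ExteriorAlgebra.ι ℝ m =
      ExteriorAlgebra.ι ℝ m *
        CliffordAlgebra.involute (Q := (0 : QuadraticForm ℝ (κ → ℝ))) w := by
  induction w using CliffordAlgebra.induction with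
  | algebraMap r => rw [AlgHom.commutes]; exact Algebra.commutes r _
  | ι x =>
    rw [CliffordAlgebra.involute_ι, mul_neg, eq_neg_iff_add_eq_zero]
    exact ExteriorAlgebra.ι_add_mul_swap x m
  | mul a b ha hb => rw [mul_assoc, hb, ← mul_assoc, ha, map_mul, mul_assoc]
  | add a b ha hb => rw [add_mul, ha, hb, map_add, mul_add]

/-- `v + s v` and `v - s v` are twice the even and the odd part of `v`, so this is supercommutation
with no homogeneity assumed. The two halves are proved together because multiplying `v` by a
generator exchanges them. -/
theorem Grass.mul_comm_aux (v : Grass κ) :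
    let s := CliffordAlgebra.involute (Q := (0 : QuadraticForm ℝ (κ → ℝ)))
    ∀ w : Grass κ, w * (v + s v) = (v + s v) * w ∧ w * (v - s v) = (v - s v) * s w := by
  intro s
  induction v using CliffordAlgebra.left_induction with
  | algebraMap r =>
    intro w
    rw [AlgHom.commutes]
    refine ⟨?_, by simp⟩
    rw [mul_add, add_mul, Algebra.commutes]
  | add x y hx hy =>
    intro w
    have h1 : x + y + s (x + y) = (x + s x) + (y + s y) := by rw [map_add]; abel
    have h2 : x + y - s (x + y) = (x - s x) + (y - s y) := by rw [map_add]; abel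
    rw [h1, h2]
    exact ⟨by rw [mul_add, add_mul, (hx w).1, (hy w).1],
      by rw [mul_add, add_mul, (hx w).2, (hy w).2]⟩
  | ι_mul x m hx =>
    intro w
    have hm : s (ExteriorAlgebra.ι ℝ m * x) = -(ExteriorAlgebra.ι ℝ m * s x) := by
      rw [map_mul]
      have : s (ExteriorAlgebra.ι ℝ m) = - ExteriorAlgebra.ι ℝ m :=
        CliffordAlgebra.involute_ι m
      rw [this, neg_mul]
    have h1 : ExteriorAlgebra.ι ℝ m * x + s (ExteriorAlgebra.ι ℝ m * x) =
        ExteriorAlgebra.ι ℝ m * (x - s x) := by rw [hm, mul_sub, sub_eq_add_neg]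
    have h2 : ExteriorAlgebra.ι ℝ m * x - s (ExteriorAlgebra.ι ℝ m * x) =
        ExteriorAlgebra.ι ℝ m * (x + s x) := by rw [hm, mul_add, sub_neg_eq_add]
    have h3 : s (s w) = w := CliffordAlgebra.involute_involute w
    constructor
    · refine (congrArg (w * ·) h1).trans (Eq.trans ?_ (congrArg (· * w) h1).symm)
      show w * (ExteriorAlgebra.ι ℝ m * (x - s x)) = ExteriorAlgebra.ι ℝ m * (x - s x) * w
      rw [← mul_assoc, Grass.mul_ι, mul_assoc, (hx _).2, h3, mul_assoc]
    · refine (congrArg (w * ·) h2).trans (Eq.trans ?_ (congrArg (· * s w) h2).symm)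
      show w * (ExteriorAlgebra.ι ℝ m * (x + s x)) = ExteriorAlgebra.ι ℝ m * (x + s x) * s w
      rw [← mul_assoc, Grass.mul_ι, mul_assoc, (hx _).1, mul_assoc]

theorem Grass.involute_of_mem {p : ZMod 2} {w : Grass κ}
    (hw : w ∈ CliffordAlgebra.evenOdd (0 : QuadraticForm ℝ (κ → ℝ)) p) :
    CliffordAlgebra.involute w = sgn 1 p • w := by
  rcases zmod_two_cases p with rfl | rfl
  · rw [sgn_zero_right, one_smul, CliffordAlgebra.involute_eq_of_mem_even hw]
  · rw [sgn_one_one, neg_smul, one_smul, CliffordAlgebra.involute_eq_of_mem_odd hw]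

/-- Homogeneous elements of the exterior algebra supercommute. -/
theorem Grass.mul_comm_of_mem {p r : ZMod 2} {w v : Grass κ}
    (hw : w ∈ CliffordAlgebra.evenOdd (0 : QuadraticForm ℝ (κ → ℝ)) p)
    (hv : v ∈ CliffordAlgebra.evenOdd (0 : QuadraticForm ℝ (κ → ℝ)) r) :
    w * v = sgn p r • (v * w) := by
  have hv' := Grass.involute_of_mem hv
  have hw' := Grass.involute_of_mem hw
  have h := Grass.mul_comm_aux v w
  have h2 : (2 : ℝ) ≠ 0 := two_ne_zero
  rcases zmod_two_cases r with rfl | rfl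
  · rw [sgn_zero_right, one_smul] at hv' ⊢
    have h1 := h.1
    rw [hv', ← two_smul ℝ v, mul_smul_comm, smul_mul_assoc] at h1
    exact smul_right_injective _ h2 h1
  · rw [sgn_one_one, neg_smul, one_smul] at hv'
    have h1 := h.2
    rw [hv', hw', sub_neg_eq_add, ← two_smul ℝ v, mul_smul_comm, smul_mul_assoc] at h1
    have := smul_right_injective _ h2 h1
    rw [this, mul_smul_comm, sgn_comm]

/-- Iterating the rule for a single generator on the left makes contraction an antiderivation. This
is the odd half of the super Leibniz rule. -/
theorem Grass.contractLeft_mul (d : Module.Dual ℝ (κ → ℝ)) (x y : Grass κ) :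
    CliffordAlgebra.contractLeft (Q := (0 : QuadraticForm ℝ (κ → ℝ))) d (x * y) =
      CliffordAlgebra.contractLeft (Q := (0 : QuadraticForm ℝ (κ → ℝ))) d x * y +
      CliffordAlgebra.involute (Q := (0 : QuadraticForm ℝ (κ → ℝ))) x *
        CliffordAlgebra.contractLeft (Q := (0 : QuadraticForm ℝ (κ → ℝ))) d y := by
  induction x using CliffordAlgebra.left_induction with
  | algebraMap r =>
    rw [CliffordAlgebra.contractLeft_algebraMap_mul, CliffordAlgebra.contractLeft_algebraMap,
      AlgHom.commutes, zero_mul, zero_add]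
  | add a b ha hb => simp only [add_mul, map_add, ha, hb]; abel
  | ι_mul x m hx =>
    rw [mul_assoc, CliffordAlgebra.contractLeft_ι_mul, hx, CliffordAlgebra.contractLeft_ι_mul,
      map_mul, CliffordAlgebra.involute_ι]
    simp only [mul_add, sub_mul, neg_mul, smul_mul_assoc, mul_assoc]
    abel

/-- Contraction changes parity, hence anticommutes with the parity operator. -/
theorem Grass.involute_contractLeft (d : Module.Dual ℝ (κ → ℝ)) (x : Grass κ) :
    CliffordAlgebra.involute (Q := (0 : QuadraticForm ℝ (κ → ℝ)))
      (CliffordAlgebra.contractLeft (Q := (0 : QuadraticForm ℝ (κ → ℝ))) d x) =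
      -CliffordAlgebra.contractLeft (Q := (0 : QuadraticForm ℝ (κ → ℝ))) d
        (CliffordAlgebra.involute (Q := (0 : QuadraticForm ℝ (κ → ℝ))) x) := by
  induction x using CliffordAlgebra.left_induction with
  | algebraMap r =>
    rw [AlgHom.commutes, CliffordAlgebra.contractLeft_algebraMap, map_zero, neg_zero]
  | add a b ha hb => simp only [map_add, ha, hb]; abel
  | ι_mul x m hx =>
    rw [CliffordAlgebra.contractLeft_ι_mul, map_mul, CliffordAlgebra.involute_ι, neg_mul, map_neg,
      CliffordAlgebra.contractLeft_ι_mul, map_sub, map_smul, map_mul, hx,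
      CliffordAlgebra.involute_ι]
    simp only [mul_neg, neg_mul]
    abel

theorem Grass.exists_add (w : Grass κ) :
    ∃ a ∈ CliffordAlgebra.evenOdd (0 : QuadraticForm ℝ (κ → ℝ)) 0,
    ∃ b ∈ CliffordAlgebra.evenOdd (0 : QuadraticForm ℝ (κ → ℝ)) 1, w = a + b := by
  have h := (CliffordAlgebra.evenOdd_isCompl (0 : QuadraticForm ℝ (κ → ℝ))).sup_eq_top
  have hw : w ∈ (⊤ : Submodule ℝ (CliffordAlgebra (0 : QuadraticForm ℝ (κ → ℝ)))) := trivial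
  rw [← h] at hw
  obtain ⟨a, ha, b, hb, e⟩ := Submodule.mem_sup.1 hw
  exact ⟨a, ha, b, hb, e.symm⟩

end Grass

/-! ### The algebra of superfunctions -/

section SuperAlgebra

variable {ι : Type} [Fintype ι] [DecidableEq ι] {κ : Type} [Fintype κ] [DecidableEq κ]
  {U : Opens (ι → ℝ)}

theorem SFun.twist_zero (x : SFun κ U) : SFun.twist 0 x = x := by
  rw [SFun.twist, if_pos rfl]
  rfl

theorem SFun.twist_one_tmul (f : CInf U) (w : Grass κ) :
    SFun.twist 1 (f ⊗ₜ[ℝ] w : SFun κ U) =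
      f ⊗ₜ[ℝ] CliffordAlgebra.involute (Q := (0 : QuadraticForm ℝ (κ → ℝ))) w := by
  rw [SFun.twist, if_neg one_ne_zero]
  rfl

theorem SFun.twist_tmul_one (p : ZMod 2) (f : CInf U) :
    SFun.twist p (f ⊗ₜ[ℝ] (1 : Grass κ) : SFun κ U) = f ⊗ₜ[ℝ] 1 := by
  rcases zmod_two_cases p with rfl | rfl
  · rw [SFun.twist_zero]
  · rw [SFun.twist_one_tmul, map_one]

theorem SFun.twist_ofCInf (p : ZMod 2) (f : CInf U) :
    SFun.twist p (SFun.ofCInf f : SFun κ U) = SFun.ofCInf f := SFun.twist_tmul_one p f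

theorem SFun.twist_one (p : ZMod 2) : SFun.twist p (1 : SFun κ U) = 1 :=
  SFun.twist_tmul_one p 1

theorem SFun.twist_mul (p : ZMod 2) (x y : SFun κ U) :
    SFun.twist p (x * y) = SFun.twist p x * SFun.twist p y := by
  rcases zmod_two_cases p with rfl | rfl
  · simp only [SFun.twist_zero]
  · induction x using TensorProduct.induction_on with
    | zero => simp
    | add a b ha hb => simp only [add_mul, map_add, ha, hb]
    | tmul f w =>
      induction y using TensorProduct.induction_on with
      | zero => simp
      | add a b ha hb => simp only [mul_add, map_add, ha, hb]
      | tmul g v =>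
        rw [Algebra.TensorProduct.tmul_mul_tmul, SFun.twist_one_tmul, SFun.twist_one_tmul,
          SFun.twist_one_tmul, Algebra.TensorProduct.tmul_mul_tmul, map_mul]

theorem SFun.twist_of_mem {p r : ZMod 2} {x : SFun κ U} (hx : x ∈ SFun.homog κ U r) :
    SFun.twist p x = sgn p r • x := by
  rcases zmod_two_cases p with rfl | rfl
  · rw [SFun.twist_zero, sgn_zero_left, one_smul]
  · refine SFun.homog_induction (P := fun x => SFun.twist 1 x = sgn 1 r • x) ?_ ?_ ?_ hx
    · simp
    · intro f w hw
      rw [SFun.twist_one_tmul, Grass.involute_of_mem hw, TensorProduct.tmul_smul]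
    · intro x y h1 h2
      rw [map_add, h1, h2, smul_add]

/-- Every superfunction is the sum of an even and an odd one. -/
theorem SFun.exists_add (x : SFun κ U) :
    ∃ a ∈ SFun.homog κ U 0, ∃ b ∈ SFun.homog κ U 1, x = a + b := by
  induction x using TensorProduct.induction_on with
  | zero => exact ⟨0, Submodule.zero_mem _, 0, Submodule.zero_mem _, (add_zero _).symm⟩
  | tmul f w =>
    obtain ⟨a, ha, b, hb, rfl⟩ := Grass.exists_add w
    exact ⟨_, SFun.tmul_mem_homog f a ha, _, SFun.tmul_mem_homog f b hb,
      TensorProduct.tmul_add _ _ _⟩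
  | add x y hx hy =>
    obtain ⟨a, ha, b, hb, rfl⟩ := hx
    obtain ⟨c, hc, d, hd, rfl⟩ := hy
    exact ⟨_, Submodule.add_mem _ ha hc, _, Submodule.add_mem _ hb hd, by abel⟩

theorem SFun.induction_homog {P : SFun κ U → Prop}
    (hh : ∀ r, ∀ x ∈ SFun.homog κ U r, P x) (ha : ∀ x y, P x → P y → P (x + y))
    (x : SFun κ U) : P x := by
  obtain ⟨a, ha', b, hb, rfl⟩ := SFun.exists_add x
  exact ha _ _ (hh _ _ ha') (hh _ _ hb)

/-- Homogeneous superfunctions are the eigenvectors of the parity operator. With this criterion the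
degree of a product or of a derivative follows from the behaviour of `SFun.twist`, without returning
to tensors. -/
theorem SFun.mem_homog_iff {r : ZMod 2} {x : SFun κ U} :
    x ∈ SFun.homog κ U r ↔ SFun.twist 1 x = sgn 1 r • x := by
  refine ⟨SFun.twist_of_mem, fun h => ?_⟩
  obtain ⟨a, ha, b, hb, rfl⟩ := SFun.exists_add x
  rw [map_add, SFun.twist_of_mem ha, SFun.twist_of_mem hb, sgn_zero_right, sgn_one_one, one_smul,
    neg_smul, one_smul] at h
  -- The component of the wrong parity equals its own negative, hence vanishes over `ℝ`.
  rcases zmod_two_cases r with rfl | rfl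
  · rw [sgn_zero_right, one_smul] at h
    have h1 : (2 : ℝ) • b = 0 := by
      rw [two_smul]
      have := add_left_cancel h
      rw [← sub_eq_zero] at this
      have e : b + b = -(-b - b) := by abel
      rw [e, this, neg_zero]
    have h2 : b = 0 := (smul_eq_zero.1 h1).resolve_left two_ne_zero
    rw [h2, add_zero]
    exact ha
  · rw [sgn_one_one, neg_smul, one_smul, neg_add] at h
    have h1 : (2 : ℝ) • a = 0 := by
      rw [two_smul]
      have := add_right_cancel h
      nth_rewrite 1 [this]
      exact neg_add_cancel a
    have h2 : a = 0 := (smul_eq_zero.1 h1).resolve_left two_ne_zero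
    rw [h2, zero_add]
    exact hb

theorem SFun.one_mem_homog : (1 : SFun κ U) ∈ SFun.homog κ U 0 := SFun.ofCInf_mem_homog 1

theorem SFun.mul_mem_homog {p r : ZMod 2} {x y : SFun κ U} (hx : x ∈ SFun.homog κ U p)
    (hy : y ∈ SFun.homog κ U r) : x * y ∈ SFun.homog κ U (p + r) := by
  rw [SFun.mem_homog_iff, SFun.twist_mul, SFun.twist_of_mem hx, SFun.twist_of_mem hy,
    smul_mul_smul_comm, sgn_add_right]

theorem SFun.twist_mem_homog {p r : ZMod 2} {x : SFun κ U} (hx : x ∈ SFun.homog κ U r) :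
    SFun.twist p x ∈ SFun.homog κ U r := by
  rw [SFun.twist_of_mem hx]
  exact Submodule.smul_mem _ _ hx

/-- Homogeneous superfunctions supercommute. -/
theorem SFun.mul_comm_of_mem {p r : ZMod 2} {x y : SFun κ U} (hx : x ∈ SFun.homog κ U p)
    (hy : y ∈ SFun.homog κ U r) : x * y = sgn p r • (y * x) := by
  refine SFun.homog_induction (P := fun x => x * y = sgn p r • (y * x)) ?_ ?_ ?_ hx
  · simp
  · intro f w hw
    refine SFun.homog_induction
      (P := fun y => (f ⊗ₜ[ℝ] w : SFun κ U) * y = sgn p r • (y * f ⊗ₜ[ℝ] w)) ?_ ?_ ?_ hy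
    · simp
    · intro g v hv
      rw [Algebra.TensorProduct.tmul_mul_tmul, Algebra.TensorProduct.tmul_mul_tmul,
        Grass.mul_comm_of_mem hw hv, TensorProduct.tmul_smul, mul_comm f g]
    · intro a b ha hb
      rw [mul_add, ha, hb, add_mul, smul_add]
  · intro a b ha hb
    rw [add_mul, ha, hb, mul_add, smul_add]

/-- Supercommutation in a form where only one factor has to be homogeneous; the operator
`SFun.twist` carries the sign for the other. -/
theorem SFun.mul_comm_twist {p : ZMod 2} {x : SFun κ U} (hx : x ∈ SFun.homog κ U p)
    (y : SFun κ U) : x * y = SFun.twist p y * x := by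
  induction y using SFun.induction_homog with
  | hh r y hy => rw [SFun.mul_comm_of_mem hx hy, SFun.twist_of_mem hy, smul_mul_assoc]
  | ha a b ha hb => rw [mul_add, map_add, add_mul, ha, hb]

theorem SFun.twist_twist (p r : ZMod 2) (x : SFun κ U) :
    SFun.twist p (SFun.twist r x) = SFun.twist (p + r) x := by
  induction x using SFun.induction_homog with
  | hh s y hy =>
    rw [SFun.twist_of_mem hy, map_smul, SFun.twist_of_mem hy, SFun.twist_of_mem hy, smul_smul,
      sgn_add_left, mul_comm]
  | ha a b ha hb => simp only [map_add, ha, hb]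

/-! ### The coordinate derivations -/

theorem SFun.d_inl_tmul (a : ι) (f : CInf U) (w : Grass κ) :
    SFun.d (Sum.inl a) (f ⊗ₜ[ℝ] w : SFun κ U) = CInf.pderiv U a f ⊗ₜ[ℝ] w := rfl

theorem SFun.d_inr_tmul (B : κ) (f : CInf U) (w : Grass κ) :
    SFun.d (Sum.inr B) (f ⊗ₜ[ℝ] w : SFun κ U) = f ⊗ₜ[ℝ]
      CliffordAlgebra.contractLeft (Q := (0 : QuadraticForm ℝ (κ → ℝ))) (LinearMap.proj B) w :=
  rfl

/-- The super Leibniz rule. -/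
theorem SFun.d_mul (I : ι ⊕ κ) (x y : SFun κ U) :
    SFun.d I (x * y) = SFun.d I x * y + SFun.twist (deg I) x * SFun.d I y := by
  induction x using TensorProduct.induction_on with
  | zero => simp
  | add a b ha hb => simp only [add_mul, map_add, ha, hb]; abel
  | tmul f w =>
    induction y using TensorProduct.induction_on with
    | zero => simp
    | add a b ha hb => simp only [mul_add, map_add, ha, hb]; abel
    | tmul g v =>
      cases I with
      | inl a =>
        rw [show deg (Sum.inl a : ι ⊕ κ) = 0 from rfl, SFun.twist_zero,
          Algebra.TensorProduct.tmul_mul_tmul, SFun.d_inl_tmul, CInf.pderiv_mul,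
          TensorProduct.add_tmul, SFun.d_inl_tmul, SFun.d_inl_tmul,
          Algebra.TensorProduct.tmul_mul_tmul, Algebra.TensorProduct.tmul_mul_tmul, add_comm]
      | inr B =>
        rw [show deg (Sum.inr B : ι ⊕ κ) = 1 from rfl, SFun.twist_one_tmul,
          Algebra.TensorProduct.tmul_mul_tmul, SFun.d_inr_tmul, Grass.contractLeft_mul,
          TensorProduct.tmul_add, SFun.d_inr_tmul, SFun.d_inr_tmul,
          Algebra.TensorProduct.tmul_mul_tmul, Algebra.TensorProduct.tmul_mul_tmul]

theorem SFun.twist_d (I : ι ⊕ κ) (x : SFun κ U) :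
    SFun.twist 1 (SFun.d I x) = sgn 1 (deg I) • SFun.d I (SFun.twist 1 x) := by
  induction x using TensorProduct.induction_on with
  | zero => simp
  | add a b ha hb => simp only [map_add, ha, hb, smul_add]
  | tmul f w =>
    cases I with
    | inl a =>
      show _ = sgn 1 0 • _
      rw [sgn_zero_right, one_smul]
      simp only [SFun.d_inl_tmul, SFun.twist_one_tmul]
    | inr B =>
      show _ = sgn 1 1 • _
      rw [sgn_one_one, neg_smul, one_smul]
      simp only [SFun.d_inr_tmul, SFun.twist_one_tmul, Grass.involute_contractLeft,
        TensorProduct.tmul_neg]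

theorem SFun.d_mem_homog (I : ι ⊕ κ) {r : ZMod 2} {x : SFun κ U} (hx : x ∈ SFun.homog κ U r) :
    SFun.d I x ∈ SFun.homog κ U (deg I + r) := by
  rw [SFun.mem_homog_iff, SFun.twist_d, SFun.twist_of_mem hx, map_smul, smul_smul, sgn_add_right]

theorem CInf.pderiv_comm (a b : ι) (f : CInf U) :
    CInf.pderiv U a (CInf.pderiv U b f) = CInf.pderiv U b (CInf.pderiv U a f) := by
  have key : ∀ (a b : ι) (x : U), (CInf.pderiv U a (CInf.pderiv U b f)).1 x =
      fderiv ℝ (fderiv ℝ (ext0 f.1)) x (Pi.single a 1) (Pi.single b 1) := by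
    intro a b x
    rw [CInf.pderiv_apply, CInf.fderiv_eq (CInf.pderiv U b f).1
      (fun x => fderiv ℝ (ext0 f.1) x (Pi.single b 1)) (fun x => CInf.pderiv_apply b f x) x]
    have hd : DifferentiableAt ℝ (fderiv ℝ (ext0 f.1)) x :=
      (((CInf.contDiffOn f).fderiv_of_isOpen U.isOpen (m := ∞) (by simp)).differentiableOn
        (by simp)).differentiableAt (U.isOpen.mem_nhds x.2)
    rw [fderiv_clm_apply hd (differentiableAt_const _)]
    simp
  apply Subtype.ext
  funext x
  rw [key, key]
  have hc : ContDiffAt ℝ ∞ (ext0 f.1) x := (CInf.contDiffOn f).contDiffAt (U.isOpen.mem_nhds x.2)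
  exact (hc.isSymmSndFDerivAt (by simpa using ENat.LEInfty.out)).eq _ _

theorem SFun.d_comm (I J : ι ⊕ κ) (x : SFun κ U) :
    SFun.d I (SFun.d J x) = sgn (deg I) (deg J) • SFun.d J (SFun.d I x) := by
  induction x using TensorProduct.induction_on with
  | zero => simp
  | add a b ha hb => simp only [map_add, ha, hb, smul_add]
  | tmul f w =>
    cases I with
    | inl a =>
      show _ = sgn 0 _ • _
      rw [sgn_zero_left, one_smul]
      cases J with
      | inl b => simp only [SFun.d_inl_tmul, CInf.pderiv_comm a b]
      | inr B => rfl
    | inr A =>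
      cases J with
      | inl b =>
        show _ = sgn _ 0 • _
        rw [sgn_zero_right, one_smul]
        rfl
      | inr B =>
        show _ = sgn 1 1 • _
        rw [sgn_one_one, neg_smul, one_smul]
        simp only [SFun.d_inr_tmul, CliffordAlgebra.contractLeft_comm (LinearMap.proj A) _ w,
          TensorProduct.tmul_neg]

theorem SFun.d_one (I : ι ⊕ κ) : SFun.d I (1 : SFun κ U) = 0 := by
  have h := SFun.d_mul I (1 : SFun κ U) 1
  rw [mul_one, mul_one, SFun.twist_one, one_mul] at h
  exact left_eq_add.1 h

end SuperAlgebra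

/-! ### Vector fields, their action on superfunctions, and the pairing of a metric. -/

section Connections

variable {ι : Type} [Fintype ι] [DecidableEq ι] {κ : Type} [Fintype κ] [DecidableEq κ]
  {U : Opens (ι → ℝ)}

theorem SFun.twist_d_comm (p : ZMod 2) (I : ι ⊕ κ) (x : SFun κ U) :
    SFun.twist p (SFun.d I x) = sgn p (deg I) • SFun.d I (SFun.twist p x) := by
  rcases zmod_two_cases p with rfl | rfl
  · rw [SFun.twist_zero, SFun.twist_zero, sgn_zero_left, one_smul]
  · exact SFun.twist_d I x

instance : Module (SFun κ U) (Vect κ U) := Pi.module _ _ _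

instance : DistribMulAction (SFun κ U) (Vect κ U) := Module.toDistribMulAction

/-- The sign rule for exchanging two vector components. -/
theorem SFun.mul_twist_comm {a b p r : ZMod 2} {x y : SFun κ U}
    (hx : x ∈ SFun.homog κ U (a + p)) (hy : y ∈ SFun.homog κ U (b + r)) :
    x * SFun.twist p y = (sgn a b * sgn p r) • (y * SFun.twist r x) := by
  rw [SFun.twist_of_mem hy, SFun.twist_of_mem hx, mul_smul_comm, mul_smul_comm,
    SFun.mul_comm_of_mem hx hy, smul_smul, smul_smul]
  congr 1
  simp only [sgn_add_left, sgn_add_right, sgn_comm r a, sgn_comm r p]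
  linear_combination (sgn a r * sgn a b * sgn p r ^ 2) * sgn_mul_self p b

namespace Vect

theorem IsHomog.add {a : ZMod 2} {X Y : Vect κ U} (hX : X.IsHomog a) (hY : Y.IsHomog a) :
    (X + Y).IsHomog a := fun I => Submodule.add_mem _ (hX I) (hY I)

theorem IsHomog.smul {a r : ZMod 2} {X : Vect κ U} {f : SFun κ U} (hf : f ∈ SFun.homog κ U r)
    (hX : X.IsHomog a) : (f • X).IsHomog (r + a) := fun I => by
  rw [add_assoc]
  exact SFun.mul_mem_homog hf (hX I)

theorem IsHomog.real_smul {a : ZMod 2} {X : Vect κ U} (c : ℝ) (hX : X.IsHomog a) :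
    (c • X).IsHomog a := fun I => Submodule.smul_mem _ c (hX I)

theorem isHomog_sum {a : ZMod 2} {α : Type} (s : Finset α) (X : α → Vect κ U)
    (h : ∀ i ∈ s, (X i).IsHomog a) : (∑ i ∈ s, X i).IsHomog a := fun I => by
  rw [Finset.sum_apply]
  exact Submodule.sum_mem _ fun i hi => h i hi I

theorem frame_same (I : ι ⊕ κ) : (frame I : Vect κ U) I = 1 := by simp [frame]

theorem frame_ne {I J : ι ⊕ κ} (h : J ≠ I) : (frame I : Vect κ U) J = 0 := by
  simp [frame, h]

theorem frame_isHomog (I : ι ⊕ κ) : (frame I : Vect κ U).IsHomog (deg I) := fun J => by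
  by_cases h : J = I
  · subst h
    rw [frame_same, add_self_zmod_two]
    exact SFun.one_mem_homog
  · rw [frame_ne h]
    exact Submodule.zero_mem _

theorem eq_sum_frame (X : Vect κ U) : X = ∑ I, X I • frame I := by
  funext K
  rw [Finset.sum_apply, Finset.sum_eq_single K]
  · rw [Pi.smul_apply, frame_same, smul_eq_mul, mul_one]
  · intro I _ hI
    rw [Pi.smul_apply, frame_ne (Ne.symm hI), smul_zero]
  · simp

/-- Additive statements about homogeneous fields reduce to fields `f ∂_I` with `f` of the matching
degree. This is how identities are extended from coordinate fields. -/
theorem homog_induction {a : ZMod 2} {P : Vect κ U → Prop} (h0 : P 0)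
    (hadd : ∀ X Y, P X → P Y → P (X + Y))
    (hs : ∀ I, ∀ f ∈ SFun.homog κ U (a + deg I), P (f • frame I))
    {X : Vect κ U} (hX : X.IsHomog a) : P X := by
  rw [eq_sum_frame X]
  exact Finset.sum_induction _ P hadd h0 fun I _ => hs I _ (hX I)

theorem induction {P : Vect κ U → Prop} (h0 : P 0)
    (hadd : ∀ X Y, P X → P Y → P (X + Y))
    (hs : ∀ I r, ∀ f ∈ SFun.homog κ U r, P (f • frame I)) (X : Vect κ U) : P X := by
  rw [eq_sum_frame X]
  refine Finset.sum_induction _ P hadd h0 fun I _ => ?_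
  induction X I using SFun.induction_homog with
  | hh r f hf => exact hs I r f hf
  | ha f g hf hg => rw [add_smul]; exact hadd _ _ hf hg

theorem act_frame (I : ι ⊕ κ) (f : SFun κ U) : (frame I : Vect κ U).act f = SFun.d I f := by
  rw [act, Finset.sum_eq_single I]
  · rw [frame_same, one_mul]
  · intro J _ hJ
    rw [frame_ne hJ, zero_mul]
  · simp

theorem act_add_left (X Y : Vect κ U) (f : SFun κ U) : (X + Y).act f = X.act f + Y.act f := by
  simp only [act, Pi.add_apply, add_mul, Finset.sum_add_distrib]

theorem act_smul_left (g : SFun κ U) (X : Vect κ U) (f : SFun κ U) :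
    (g • X).act f = g * X.act f := by
  simp only [act, Pi.smul_apply, smul_eq_mul, mul_assoc, Finset.mul_sum]

theorem act_add_right (X : Vect κ U) (f g : SFun κ U) : X.act (f + g) = X.act f + X.act g := by
  simp only [act, map_add, mul_add, Finset.sum_add_distrib]

theorem zero_act (f : SFun κ U) : (0 : Vect κ U).act f = 0 := by
  simp [act]

theorem act_zero (X : Vect κ U) : X.act 0 = 0 := by
  simp [act]

theorem act_one (X : Vect κ U) : X.act 1 = 0 := by
  simp [act, SFun.d_one]

theorem act_frame_apply (X : Vect κ U) (I K : ι ⊕ κ) : X.act ((frame I : Vect κ U) K) = 0 := by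
  by_cases h : K = I
  · rw [h, frame_same, act_one]
  · rw [frame_ne h, act_zero]

theorem act_mem_homog {a r : ZMod 2} {X : Vect κ U} {f : SFun κ U} (hX : X.IsHomog a)
    (hf : f ∈ SFun.homog κ U r) : X.act f ∈ SFun.homog κ U (a + r) := by
  refine Submodule.sum_mem _ fun I _ => ?_
  have h := SFun.mul_mem_homog (hX I) (SFun.d_mem_homog I hf)
  rwa [add_assoc, ← add_assoc (deg I), add_self_zmod_two, zero_add] at h

/-- The component `X^I` has degree `a + deg I`. Moving `f` across it meets `deg I` twice, and only
the sign for the degree `a` of the field survives, uniformly in `I`. -/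
theorem mul_twist_of_isHomog {a : ZMod 2} {X : Vect κ U} (hX : X.IsHomog a) (I : ι ⊕ κ)
    (f : SFun κ U) : X I * SFun.twist (deg I) f = SFun.twist a f * X I := by
  rw [SFun.mul_comm_twist (hX I), SFun.twist_twist, add_assoc, add_self_zmod_two, add_zero]

theorem act_mul {a : ZMod 2} {X : Vect κ U} (hX : X.IsHomog a) (f g : SFun κ U) :
    X.act (f * g) = X.act f * g + SFun.twist a f * X.act g := by
  simp only [act, Finset.sum_mul, Finset.mul_sum, ← Finset.sum_add_distrib]
  refine Finset.sum_congr rfl fun I _ => ?_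
  rw [SFun.d_mul, mul_add, ← mul_assoc, ← mul_assoc, mul_twist_of_isHomog hX, mul_assoc, mul_assoc]

section Pair

variable (g : ι ⊕ κ → ι ⊕ κ → SFun κ U)

theorem pair_add_left (X Y Z : Vect κ U) : pair g (X + Y) Z = pair g X Z + pair g Y Z := by
  simp only [pair, Pi.add_apply, add_mul, Finset.sum_add_distrib]

theorem pair_add_right (X Y Z : Vect κ U) : pair g X (Y + Z) = pair g X Y + pair g X Z := by
  simp only [pair, Pi.add_apply, map_add, add_mul, mul_add, Finset.sum_add_distrib]

theorem pair_smul_left (f : SFun κ U) (X Y : Vect κ U) :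
    pair g (f • X) Y = f * pair g X Y := by
  simp only [pair, Pi.smul_apply, smul_eq_mul, mul_assoc, Finset.mul_sum]

theorem pair_real_smul_left (c : ℝ) (X Y : Vect κ U) :
    pair g (c • X) Y = c • pair g X Y := by
  simp only [pair, Pi.smul_apply, smul_mul_assoc, Finset.smul_sum]

theorem pair_real_smul_right (c : ℝ) (X Y : Vect κ U) :
    pair g X (c • Y) = c • pair g X Y := by
  simp only [pair, Pi.smul_apply, map_smul, mul_smul_comm, smul_mul_assoc, Finset.smul_sum]

theorem pair_smul_right {a : ZMod 2} {X : Vect κ U} (hX : X.IsHomog a) (f : SFun κ U)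
    (Y : Vect κ U) : pair g X (f • Y) = SFun.twist a f * pair g X Y := by
  simp only [pair, Pi.smul_apply, smul_eq_mul, Finset.mul_sum]
  refine Finset.sum_congr rfl fun I _ => Finset.sum_congr rfl fun J _ => ?_
  rw [SFun.twist_mul, ← mul_assoc, mul_twist_of_isHomog hX]
  simp only [mul_assoc]

theorem pair_zero_left (X : Vect κ U) : pair g 0 X = 0 := by
  simp [pair]

theorem pair_zero_right (X : Vect κ U) : pair g X 0 = 0 := by
  simp [pair]

theorem pair_frame_right (X : Vect κ U) (K : ι ⊕ κ) :
    pair g X (frame K) = ∑ I, X I * g I K := by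
  refine Finset.sum_congr rfl fun I _ => ?_
  rw [Finset.sum_eq_single K]
  · rw [frame_same, SFun.twist_one, mul_one]
  · intro J _ hJ
    rw [frame_ne hJ, map_zero, mul_zero, zero_mul]
  · simp

theorem pair_frame_left (X : Vect κ U) (K : ι ⊕ κ) :
    pair g (frame K) X = ∑ J, SFun.twist (deg K) (X J) * g K J := by
  rw [pair, Finset.sum_eq_single K]
  · simp only [frame_same, one_mul]
  · intro J _ hJ
    simp only [frame_ne hJ, zero_mul, Finset.sum_const_zero]
  · simp

theorem pair_frame_frame (I J : ι ⊕ κ) : pair g (frame I) (frame J) = g I J := by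
  rw [pair_frame_right, Finset.sum_eq_single I]
  · rw [frame_same, one_mul]
  · intro K _ hK
    rw [frame_ne hK, zero_mul]
  · simp

/-- Exchanging components produces `sgn a b` times the sign of the two indices, and the latter is
cancelled by the supersymmetry of the matrix `g`. -/
theorem pair_symm {a b : ZMod 2} (hg : ∀ I J, g I J = sgn (deg I) (deg J) • g J I)
    {X Y : Vect κ U} (hX : X.IsHomog a) (hY : Y.IsHomog b) :
    pair g X Y = sgn a b • pair g Y X := by
  rw [pair, pair, Finset.sum_comm, Finset.smul_sum]
  refine Finset.sum_congr rfl fun J _ => ?_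
  rw [Finset.smul_sum]
  refine Finset.sum_congr rfl fun I _ => ?_
  rw [SFun.mul_twist_comm (hX I) (hY J), hg I J, smul_mul_smul_comm]
  congr 1
  rw [mul_assoc, sgn_mul_self, mul_one]

/-- A non-degenerate metric detects vector fields. -/
theorem eq_zero_of_pair_frame (hg : IsUnit (Matrix.of g)) {X : Vect κ U}
    (h : ∀ K, pair g X (frame K) = 0) : X = 0 := by
  obtain ⟨A, hA⟩ := hg
  have hAB := A.mul_inv
  rw [hA] at hAB
  have h1 : Matrix.vecMul X (Matrix.of g) = 0 := by
    funext K
    rw [Pi.zero_apply, ← h K, pair_frame_right]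
    rfl
  have h2 : Matrix.vecMul (Matrix.vecMul X (Matrix.of g))
      (A⁻¹ : (Matrix (ι ⊕ κ) (ι ⊕ κ) (SFun κ U))ˣ).1 = X := by
    rw [Matrix.vecMul_vecMul, hAB, Matrix.vecMul_one]
  rw [← h2, h1, Matrix.zero_vecMul]

end Pair

end Vect

open Vect

/-! ### Connections from Christoffel symbols -/

/-- The connection with `∇_{∂_I} ∂_J = Γ I J`. -/
def christoffel (Γ : ι ⊕ κ → ι ⊕ κ → Vect κ U) (X Y : Vect κ U) : Vect κ U :=
  (fun K => X.act (Y K)) + ∑ I, ∑ J, (X I * SFun.twist (deg I) (Y J)) • Γ I J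

theorem christoffel_frame (Γ : ι ⊕ κ → ι ⊕ κ → Vect κ U) (I : ι ⊕ κ) (Y : Vect κ U) :
    christoffel Γ (frame I) Y =
      (fun K => SFun.d I (Y K)) + ∑ J, SFun.twist (deg I) (Y J) • Γ I J := by
  rw [christoffel, Finset.sum_eq_single I]
  · simp only [frame_same, one_mul, act_frame]
  · intro J _ hJ
    simp only [frame_ne hJ, zero_mul, zero_smul, Finset.sum_const_zero]
  · simp

theorem christoffel_frame_frame (Γ : ι ⊕ κ → ι ⊕ κ → Vect κ U) (I J : ι ⊕ κ) :
    christoffel Γ (frame I) (frame J) = Γ I J := by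
  rw [christoffel_frame, Finset.sum_eq_single J]
  · rw [frame_same, SFun.twist_one, one_smul]
    have : (fun K => SFun.d I ((frame J : Vect κ U) K)) = 0 := by
      funext K
      rw [← act_frame, act_frame_apply]
      rfl
    rw [this, zero_add]
  · intro K _ hK
    rw [frame_ne hK, map_zero, zero_smul]
  · simp

/-- The affine connection with `∇_{∂_I} ∂_J = Γ I J`. -/
def AffineConnection.ofChristoffel (Γ : ι ⊕ κ → ι ⊕ κ → Vect κ U)
    (hΓ : ∀ I J, (Γ I J).IsHomog (deg I + deg J)) : AffineConnection κ U where
  cov := christoffel Γ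
  cov_homog a b X Y hX hY := by
    refine IsHomog.add (fun K => ?_) (isHomog_sum _ _ fun I _ => isHomog_sum _ _ fun J _ => ?_)
    · rw [add_assoc]
      exact act_mem_homog hX (hY K)
    · have h := IsHomog.smul (SFun.mul_mem_homog (hX I)
        (SFun.twist_mem_homog (p := deg I) (hY J))) (hΓ I J)
      have e : a + deg I + (b + deg J) + (deg I + deg J) = a + b := by
        have h1 := add_self_zmod_two (deg I)
        have h2 := add_self_zmod_two (deg J)
        linear_combination h1 + h2
      rwa [e] at h
  cov_add_left X Y Z := by
    simp only [christoffel, Pi.add_apply, add_mul, add_smul, Finset.sum_add_distrib, act_add_left]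
    rw [show (fun K => X.act (Z K) + Y.act (Z K)) =
      (fun K => X.act (Z K)) + fun K => Y.act (Z K) from rfl]
    abel
  cov_add_right X Y Z := by
    simp only [christoffel, Pi.add_apply, map_add, mul_add, add_smul, Finset.sum_add_distrib,
      act_add_right]
    rw [show (fun K => X.act (Y K) + X.act (Z K)) =
      (fun K => X.act (Y K)) + fun K => X.act (Z K) from rfl]
    abel
  cov_smul_left f X Y := by
    simp only [christoffel, Pi.smul_apply, smul_eq_mul, act_smul_left, smul_add, Finset.smul_sum,
      mul_assoc, smul_smul]
    rfl
  leibniz a r X Y f hX hf := by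
    simp only [christoffel, Pi.smul_apply, smul_eq_mul, act_mul hX, SFun.twist_mul, smul_add,
      Finset.smul_sum, ← mul_assoc, mul_twist_of_isHomog hX]
    simp only [SFun.twist_of_mem hf, smul_mul_assoc, smul_smul, smul_assoc]
    rw [← add_assoc]
    congr 1
    refine Finset.sum_congr rfl fun I _ => Finset.sum_congr rfl fun J _ => ?_
    rw [mul_assoc, mul_twist_of_isHomog hX]

namespace AffineConnection

variable (D : AffineConnection κ U)

theorem cov_zero_left (Y : Vect κ U) : D.cov 0 Y = 0 := by
  have h := D.cov_add_left 0 0 Y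
  rw [add_zero] at h
  exact left_eq_add.1 h

theorem cov_zero_right (X : Vect κ U) : D.cov X 0 = 0 := by
  have h := D.cov_add_right X 0 0
  rw [add_zero] at h
  exact left_eq_add.1 h

theorem cov_sum_left {α : Type} (s : Finset α) (X : α → Vect κ U) (Y : Vect κ U) :
    D.cov (∑ i ∈ s, X i) Y = ∑ i ∈ s, D.cov (X i) Y :=
  map_sum (AddMonoidHom.mk' (fun X => D.cov X Y) fun X Z => D.cov_add_left X Z Y) X s

theorem cov_sum_right {α : Type} (s : Finset α) (X : Vect κ U) (Y : α → Vect κ U) :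
    D.cov X (∑ i ∈ s, Y i) = ∑ i ∈ s, D.cov X (Y i) :=
  map_sum (AddMonoidHom.mk' (fun Y => D.cov X Y) fun Y Z => D.cov_add_right X Y Z) Y s

theorem cov_smul_right {a : ZMod 2} {X : Vect κ U} (hX : X.IsHomog a) (f : SFun κ U)
    (Y : Vect κ U) : D.cov X (f • Y) = X.act f • Y + SFun.twist a f • D.cov X Y := by
  induction f using SFun.induction_homog with
  | hh r f hf => rw [D.leibniz a r X Y f hX hf, SFun.twist_of_mem hf, smul_assoc]
  | ha f g hf hg =>
    rw [add_smul, D.cov_add_right, hf, hg, act_add_right, map_add, add_smul, add_smul]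
    abel

theorem cov_frame_smul (I : ι ⊕ κ) (f : SFun κ U) (Y : Vect κ U) :
    D.cov (frame I) (f • Y) = SFun.d I f • Y + SFun.twist (deg I) f • D.cov (frame I) Y := by
  rw [D.cov_smul_right (frame_isHomog I), act_frame]

/-- An affine connection is determined by its Christoffel symbols. -/
theorem cov_eq_christoffel :
    D.cov = christoffel fun I J => D.cov (frame I) (frame J) := by
  funext X Y
  have h : ∀ I, D.cov (frame I) Y = (fun K => SFun.d I (Y K)) +
      ∑ J, SFun.twist (deg I) (Y J) • D.cov (frame I) (frame J) := by
    intro I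
    nth_rewrite 1 [eq_sum_frame Y]
    rw [cov_sum_right]
    simp only [cov_frame_smul]
    rw [Finset.sum_add_distrib]
    congr 1
    exact (eq_sum_frame fun K => SFun.d I (Y K)).symm
  nth_rewrite 1 [eq_sum_frame X]
  rw [cov_sum_left]
  simp only [D.cov_smul_left, h, smul_add, Finset.smul_sum, smul_smul]
  rw [Finset.sum_add_distrib, christoffel]
  congr 1
  funext K
  simp only [Finset.sum_apply, Pi.smul_apply, smul_eq_mul, act]

end AffineConnection

end Connections

/-! ### The Levi-Civita conditions on coordinate fields, and uniqueness. -/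

section LeviCivita

variable {ι : Type} [Fintype ι] [DecidableEq ι] {κ : Type} [Fintype κ] [DecidableEq κ]
  {U : Opens (ι → ℝ)}

open Vect

theorem bracket_frame_left (a : ZMod 2) (I : ι ⊕ κ) (X : Vect κ U) :
    bracket (deg I) a (frame I) X = fun K => SFun.d I (X K) := by
  funext K
  rw [bracket, act_frame, act_frame_apply, smul_zero, sub_zero]

theorem bracket_frame_frame (a : ZMod 2) (I J : ι ⊕ κ) :
    bracket (deg I) a (frame I : Vect κ U) (frame J) = 0 := by
  rw [bracket_frame_left]
  funext K
  rw [← act_frame, act_frame_apply]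
  rfl

namespace AffineConnection

variable (D : AffineConnection κ U)

/-- The derivative terms of `∇_X Y` and `∇_Y X` are exactly the bracket. What remains is a double
sum over Christoffel symbols, which matches term by term after swapping the indices. -/
theorem torsion_of_frames
    (h : ∀ I J, D.cov (frame I) (frame J) = sgn (deg I) (deg J) • D.cov (frame J) (frame I))
    {a b : ZMod 2} {X Y : Vect κ U} (hX : X.IsHomog a) (hY : Y.IsHomog b) :
    D.cov X Y - sgn a b • D.cov Y X - bracket a b X Y = 0 := by
  have e : ∑ I, ∑ J, (X I * SFun.twist (deg I) (Y J)) • D.cov (frame I) (frame J) =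
      sgn a b • ∑ J, ∑ I, (Y J * SFun.twist (deg J) (X I)) • D.cov (frame J) (frame I) := by
    rw [Finset.sum_comm, Finset.smul_sum]
    refine Finset.sum_congr rfl fun J _ => ?_
    rw [Finset.smul_sum]
    refine Finset.sum_congr rfl fun I _ => ?_
    rw [SFun.mul_twist_comm (hX I) (hY J), h I J, smul_assoc, smul_comm (Y J * _), smul_smul,
      mul_assoc, sgn_mul_self, mul_one]
  rw [D.cov_eq_christoffel, christoffel, christoffel, e, smul_add]
  have e2 : bracket a b X Y = (fun K => X.act (Y K)) - sgn a b • fun K => Y.act (X K) := rfl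
  rw [e2]
  abel

/-- The defect of metric compatibility is tensorial in each slot, because the derivatives of
coefficients cancel by the two Leibniz rules. It is extended from frames to arbitrary fields one
slot at a time, first `Z`, then `Y`, then `X`. -/
theorem metric_of_frames {g : ι ⊕ κ → ι ⊕ κ → SFun κ U}
    (h : ∀ I J K, SFun.d I (g J K) = pair g (D.cov (frame I) (frame J)) (frame K) +
      sgn (deg I) (deg J) • pair g (frame J) (D.cov (frame I) (frame K)))
    {a b : ZMod 2} {X Y : Vect κ U} (hX : X.IsHomog a) (hY : Y.IsHomog b) (Z : Vect κ U) :
    X.act (pair g Y Z) = pair g (D.cov X Y) Z + sgn a b • pair g Y (D.cov X Z) := by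
  have h1 : ∀ I J Z, SFun.d I (pair g (frame J) Z) = pair g (D.cov (frame I) (frame J)) Z +
      sgn (deg I) (deg J) • pair g (frame J) (D.cov (frame I) Z) := by
    intro I J Z
    induction Z using Vect.induction with
    | h0 => simp only [pair_zero_right, D.cov_zero_right, map_zero, smul_zero, add_zero]
    | hadd X Y hX hY =>
      simp only [pair_add_right, D.cov_add_right, map_add, smul_add, hX, hY]
      abel
    | hs K r f hf =>
      rw [pair_smul_right g (frame_isHomog J), pair_frame_frame, SFun.d_mul, h I J K,
        D.cov_frame_smul, pair_add_right, pair_smul_right g (frame_isHomog J),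
        pair_smul_right g (frame_isHomog J), pair_frame_frame,
        pair_smul_right g (D.cov_homog _ _ _ _ (frame_isHomog I) (frame_isHomog J)),
        SFun.twist_twist, SFun.twist_twist, SFun.twist_d_comm, mul_add, smul_add, smul_mul_assoc,
        smul_smul, sgn_comm (deg J) (deg I), sgn_mul_self, one_smul, add_comm (deg J) (deg I),
        mul_smul_comm]
      abel
  have h2 : ∀ (I : ι ⊕ κ) (b : ZMod 2) (Y : Vect κ U), Y.IsHomog b → ∀ Z,
      SFun.d I (pair g Y Z) = pair g (D.cov (frame I) Y) Z +
        sgn (deg I) b • pair g Y (D.cov (frame I) Z) := by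
    intro I b Y hY Z
    refine Vect.homog_induction (P := fun Y => SFun.d I (pair g Y Z) =
      pair g (D.cov (frame I) Y) Z + sgn (deg I) b • pair g Y (D.cov (frame I) Z)) ?_ ?_ ?_ hY
    · simp only [pair_zero_left, D.cov_zero_right, map_zero, smul_zero, add_zero]
    · intro X Y hX hY
      simp only [pair_add_left, D.cov_add_right, map_add, smul_add, hX, hY]
      abel
    · intro J f hf
      rw [pair_smul_left, SFun.d_mul, h1, D.cov_frame_smul, pair_add_left, pair_smul_left,
        pair_smul_left, pair_smul_left, SFun.twist_of_mem hf, mul_add, mul_smul_comm,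
        smul_mul_assoc, smul_mul_assoc, smul_smul, sgn_add_right, ← mul_assoc,
        mul_comm (sgn _ (deg J)), mul_assoc, sgn_mul_self, mul_one]
      abel
  refine Vect.homog_induction (P := fun X => X.act (pair g Y Z) =
      pair g (D.cov X Y) Z + sgn a b • pair g Y (D.cov X Z)) ?_ ?_ ?_ hX
  · simp only [zero_act, pair_zero_left, pair_zero_right, D.cov_zero_left, smul_zero, add_zero]
  · intro X X' hX hX'
    simp only [act_add_left, pair_add_left, pair_add_right, D.cov_add_left, smul_add, hX, hX']
    abel
  · intro I f hf
    rw [act_smul_left, act_frame, h2 I b Y hY, D.cov_smul_left, D.cov_smul_left, pair_smul_left,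
      pair_smul_right g hY, SFun.twist_of_mem hf, mul_add, smul_mul_assoc, smul_smul,
      mul_smul_comm, sgn_add_right, sgn_comm b a, ← mul_assoc, sgn_mul_self, one_mul,
      sgn_comm b]

/-- Torsion freeness and metric compatibility may be tested on the coordinate fields. -/
theorem isLeviCivita_of_frames {g : ι ⊕ κ → ι ⊕ κ → SFun κ U}
    (ht : ∀ I J, D.cov (frame I) (frame J) = sgn (deg I) (deg J) • D.cov (frame J) (frame I))
    (hm : ∀ I J K, SFun.d I (g J K) = pair g (D.cov (frame I) (frame J)) (frame K) +
      sgn (deg I) (deg J) • pair g (frame J) (D.cov (frame I) (frame K))) :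
    D.IsLeviCivita g :=
  ⟨fun _ _ _ _ hX hY => D.torsion_of_frames ht hX hY,
    fun _ _ _ _ Z hX hY => D.metric_of_frames hm hX hY Z⟩

variable {D}

theorem IsLeviCivita.symm_frames {g : ι ⊕ κ → ι ⊕ κ → SFun κ U} (h : D.IsLeviCivita g)
    (I J : ι ⊕ κ) :
    D.cov (frame I) (frame J) = sgn (deg I) (deg J) • D.cov (frame J) (frame I) := by
  have := h.1 _ _ _ _ (frame_isHomog I) (frame_isHomog J)
  rwa [bracket_frame_frame, sub_zero, sub_eq_zero] at this

theorem IsLeviCivita.metric_frames {g : ι ⊕ κ → ι ⊕ κ → SFun κ U} (h : D.IsLeviCivita g)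
    (I J K : ι ⊕ κ) :
    SFun.d I (g J K) = pair g (D.cov (frame I) (frame J)) (frame K) +
      sgn (deg I) (deg J) • pair g (frame J) (D.cov (frame I) (frame K)) := by
  have := h.2 _ _ _ _ (frame K) (frame_isHomog I) (frame_isHomog J)
  rwa [act_frame, pair_frame_frame] at this

/-- Uniqueness of the Levi-Civita connection. -/
theorem IsLeviCivita.cov_unique {g : ι ⊕ κ → ι ⊕ κ → SFun κ U} {D' : AffineConnection κ U}
    (hs : ∀ I J, g I J = sgn (deg I) (deg J) • g J I) (hn : IsUnit (Matrix.of g))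
    (h : D.IsLeviCivita g) (h' : D'.IsLeviCivita g) : D.cov = D'.cov := by
  set S : ι ⊕ κ → ι ⊕ κ → Vect κ U := fun I J =>
    D.cov (frame I) (frame J) + (-1 : ℝ) • D'.cov (frame I) (frame J) with hS
  have hSh : ∀ I J, (S I J).IsHomog (deg I + deg J) := fun I J =>
    (D.cov_homog _ _ _ _ (frame_isHomog I) (frame_isHomog J)).add
      ((D'.cov_homog _ _ _ _ (frame_isHomog I) (frame_isHomog J)).real_smul _)
  have hSs : ∀ I J, S I J = sgn (deg I) (deg J) • S J I := by
    intro I J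
    simp only [hS]
    rw [h.symm_frames I J, h'.symm_frames I J, smul_add, smul_comm (-1 : ℝ)]
  -- The difference of two connections, with its index lowered. Vanishing torsion makes it
  -- supersymmetric in the first two indices; metric compatibility makes it super-skew in the last
  -- two.
  set T : ι ⊕ κ → ι ⊕ κ → ι ⊕ κ → SFun κ U := fun I J K => pair g (S I J) (frame K) with hT
  have hT1 : ∀ I J K, T I J K = sgn (deg I) (deg J) • T J I K := by
    intro I J K
    simp only [hT]
    rw [hSs I J, pair_real_smul_left]
  have hT2 : ∀ I J K, T I J K = (-sgn (deg J) (deg K)) • T I K J := by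
    intro I J K
    have e : T I J K + sgn (deg I) (deg J) • pair g (frame J) (S I K) = 0 := by
      simp only [hT, hS]
      have e1 := h.metric_frames I J K
      have e2 := h'.metric_frames I J K
      rw [e1] at e2
      rw [pair_add_left, pair_add_right, pair_real_smul_left, pair_real_smul_right, smul_add,
        smul_comm _ (-1 : ℝ), neg_one_smul, neg_one_smul]
      have e3 := sub_eq_zero.2 e2
      rw [← e3]
      abel
    rw [pair_symm g hs (frame_isHomog J) (hSh I K), smul_smul, sgn_add_right,
      sgn_comm (deg J) (deg I), ← mul_assoc, sgn_mul_self, one_mul] at e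
    rw [neg_smul]
    exact eq_neg_of_add_eq_zero_left e
  have hT0 : ∀ I J K, T I J K = 0 := by
    intro I J K
    -- Three symmetric and three skew transpositions, taken alternately, return to the original
    -- order. Each parity sign occurs twice, so only `(-1)³` is left.
    have e : T I J K = (-1 : ℝ) • T I J K := by
      conv_lhs => rw [hT1 I J K, hT2 J I K, hT1 J K I, hT2 K J I, hT1 K I J, hT2 I K J]
      simp only [smul_smul]
      congr 1
      rw [sgn_comm (deg K) (deg J), sgn_comm (deg K) (deg I), sgn_comm (deg J) (deg I)]
      linear_combination (-(sgn (deg I) (deg J))^2 * (sgn (deg I) (deg K))^2) *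
        sgn_mul_self (deg J) (deg K) - (sgn (deg I) (deg J))^2 * sgn_mul_self (deg I) (deg K) -
        sgn_mul_self (deg I) (deg J)
    have e2 : (2 : ℝ) • T I J K = 0 := by
      rw [two_smul]
      nth_rewrite 1 [e]
      rw [neg_one_smul, neg_add_cancel]
    exact (smul_eq_zero.1 e2).resolve_left two_ne_zero
  rw [D.cov_eq_christoffel, D'.cov_eq_christoffel]
  congr 1
  funext I J
  have hz := eq_zero_of_pair_frame g hn (hT0 I J)
  simp only [hS] at hz
  rw [neg_one_smul, ← sub_eq_add_neg, sub_eq_zero] at hz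
  exact hz

end AffineConnection

end LeviCivita

/-! ### Tensoriality of the curvature and of the Ricci tensor -/

section Ricci

variable {ι : Type} [Fintype ι] [DecidableEq ι] {κ : Type} [Fintype κ] [DecidableEq κ]
  {U : Opens (ι → ℝ)}

open Vect

namespace AffineConnection

variable (D : AffineConnection κ U)

theorem curvature_frame (a : ZMod 2) (I : ι ⊕ κ) (X Y : Vect κ U) :
    curvature D.cov (deg I) a (frame I) X Y = D.cov (frame I) (D.cov X Y) -
      sgn (deg I) a • D.cov X (D.cov (frame I) Y) - D.cov (fun K => SFun.d I (X K)) Y := by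
  rw [curvature, bracket_frame_left]

theorem curvature_frame_frame (I J : ι ⊕ κ) (Y : Vect κ U) :
    curvature D.cov (deg I) (deg J) (frame I) (frame J) Y =
      D.cov (frame I) (D.cov (frame J) Y) -
        sgn (deg I) (deg J) • D.cov (frame J) (D.cov (frame I) Y) := by
  rw [curvature, bracket_frame_frame, D.cov_zero_left, sub_zero]

/-- For `X = f ∂_J` the derivative of `f` in the first covariant derivative is cancelled by the
bracket term, since `[∂_I, f ∂_J] = (∂_I f) ∂_J`. -/
theorem curvature_left {a : ZMod 2} (I : ι ⊕ κ) {X : Vect κ U} (hX : X.IsHomog a)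
    (Y : Vect κ U) : curvature D.cov (deg I) a (frame I) X Y =
      ∑ J, SFun.twist (deg I) (X J) •
        curvature D.cov (deg I) (deg J) (frame I) (frame J) Y := by
  refine Vect.homog_induction (P := fun X => curvature D.cov (deg I) a (frame I) X Y =
      ∑ J, SFun.twist (deg I) (X J) •
        curvature D.cov (deg I) (deg J) (frame I) (frame J) Y) ?_ ?_ ?_ hX
  · have e : (fun K => SFun.d I ((0 : Vect κ U) K)) = (0 : Vect κ U) := by
      funext K
      exact map_zero _
    rw [D.curvature_frame, e]
    simp only [D.cov_zero_left, D.cov_zero_right, Pi.zero_apply, map_zero, zero_smul, smul_zero,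
      Finset.sum_const_zero, sub_zero]
  · intro X X' h h'
    have e : (fun K => SFun.d I ((X + X') K)) =
        (fun K => SFun.d I (X K)) + fun K => SFun.d I (X' K) := by
      funext K
      exact map_add _ _ _
    simp only [Pi.add_apply, map_add, add_smul, Finset.sum_add_distrib]
    rw [← h, ← h']
    simp only [D.curvature_frame]
    rw [e, D.cov_add_left, D.cov_add_left, D.cov_add_left, D.cov_add_right, smul_add]
    abel
  · intro J f hf
    rw [Finset.sum_eq_single J]
    · have e : (fun K => SFun.d I ((f • frame J : Vect κ U) K)) =
          (SFun.d I f • frame J : Vect κ U) := by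
        funext K
        rw [Pi.smul_apply, Pi.smul_apply, smul_eq_mul, SFun.d_mul, ← act_frame I (frame J K),
          act_frame_apply, mul_zero, add_zero]
        rfl
      rw [D.curvature_frame, D.curvature_frame_frame, e, D.cov_smul_left, D.cov_smul_left,
        D.cov_smul_left, D.cov_frame_smul, Pi.smul_apply, frame_same, smul_eq_mul, mul_one,
        SFun.twist_of_mem hf, smul_sub]
      have e2 : sgn (deg I) a • f • D.cov (frame J) (D.cov (frame I) Y) =
          (sgn (deg I) (a + deg J) • f) • sgn (deg I) (deg J) •
            D.cov (frame J) (D.cov (frame I) Y) := by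
        rw [smul_assoc, smul_comm f, smul_smul, sgn_add_right, mul_assoc, sgn_mul_self, mul_one]
      rw [e2]
      abel
    · intro K _ hK
      rw [Pi.smul_apply, frame_ne hK, smul_zero, map_zero, zero_smul]
    · exact fun h => absurd (Finset.mem_univ _) h

/-- For `f Z` the second derivatives of `f` cancel because coordinate derivations supercommute, and
the mixed first-order terms cancel in pairs. The coefficient then passes `∂_I` and `∂_J`, which
explains the twist. -/
theorem curvature_right (I J : ι ⊕ κ) (Y : Vect κ U) :
    curvature D.cov (deg I) (deg J) (frame I) (frame J) Y =
      ∑ K, SFun.twist (deg I + deg J) (Y K) •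
        curvature D.cov (deg I) (deg J) (frame I) (frame J) (frame K) := by
  have hsm : ∀ (f : SFun κ U) (Z : Vect κ U),
      curvature D.cov (deg I) (deg J) (frame I) (frame J) (f • Z) =
        SFun.twist (deg I + deg J) f •
          curvature D.cov (deg I) (deg J) (frame I) (frame J) Z := by
    intro f Z
    simp only [D.curvature_frame_frame, D.cov_frame_smul, D.cov_add_right]
    rw [SFun.d_comm I J f, SFun.twist_d_comm (deg I) J, SFun.twist_d_comm (deg J) I,
      SFun.twist_twist, SFun.twist_twist, add_comm (deg J) (deg I), sgn_comm (deg J) (deg I)]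
    simp only [smul_add, smul_sub, smul_assoc, smul_smul, sgn_mul_self, one_smul]
    rw [smul_comm (SFun.twist (deg I + deg J) f) (sgn (deg I) (deg J))]
    abel
  nth_rewrite 1 [eq_sum_frame Y]
  have hadd : ∀ Z Z' : Vect κ U,
      curvature D.cov (deg I) (deg J) (frame I) (frame J) (Z + Z') =
        curvature D.cov (deg I) (deg J) (frame I) (frame J) Z +
        curvature D.cov (deg I) (deg J) (frame I) (frame J) Z' := by
    intro Z Z'
    simp only [D.curvature_frame_frame, D.cov_add_right, smul_add]
    abel
  refine (map_sum (AddMonoidHom.mk' _ hadd) _ _).trans ?_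
  exact Finset.sum_congr rfl fun K _ => hsm _ _

/-- The Ricci tensor is determined by its values on the coordinate fields. -/
theorem ricci_eq_sum {a b : ZMod 2} {X Y : Vect κ U} (hX : X.IsHomog a) (hY : Y.IsHomog b) :
    ricci D.cov a b X Y = pair (fun J K => ricci D.cov (deg J) (deg K) (frame J) (frame K)) X Y := by
  -- The product of the two components, of total degree `a + b + deg J + deg K`, is carried to the
  -- left past `∂_I`.
  have hc : ∀ {a b : ZMod 2} {X Y : Vect κ U}, X.IsHomog a → Y.IsHomog b → ∀ I,
      curvature D.cov (deg I) a (frame I) X Y I = ∑ J, ∑ K,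
        (sgn (deg I) (a + b + deg J + deg K)) • (X J * SFun.twist (deg J) (Y K) *
          curvature D.cov (deg I) (deg J) (frame I) (frame J) (frame K) I) := by
    intro a b X Y hX hY I
    rw [D.curvature_left I hX, Finset.sum_apply]
    refine Finset.sum_congr rfl fun J _ => ?_
    rw [D.curvature_right, Pi.smul_apply, Finset.sum_apply, smul_eq_mul, Finset.mul_sum]
    refine Finset.sum_congr rfl fun K _ => ?_
    have hm := SFun.mul_mem_homog (hX J) (SFun.twist_mem_homog (p := deg J) (hY K))
    rw [Pi.smul_apply, smul_eq_mul, ← SFun.twist_twist, ← mul_assoc, ← SFun.twist_mul,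
      SFun.twist_of_mem hm, smul_mul_assoc]
    congr 2
    ring
  simp only [ricci, pair]
  simp only [hc hX hY, hc hY hX]
  simp only [Finset.mul_sum]
  -- The symmetrizing half is reindexed so that both halves have the coefficient of `X^J Y^K`. The
  -- signs involving `a` and `b` occur twice and disappear, leaving the signs of the coordinate
  -- fields.
  have hI : ∀ I, (sgn (deg I) (deg I + a + b) * (1 / 2)) • (
      (∑ J, ∑ K, (sgn (deg I) (a + b + deg J + deg K)) • (X J * SFun.twist (deg J) (Y K) *
          curvature D.cov (deg I) (deg J) (frame I) (frame J) (frame K) I)) +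
      sgn a b • ∑ K, ∑ J, (sgn (deg I) (b + a + deg K + deg J)) •
        (Y K * SFun.twist (deg K) (X J) *
          curvature D.cov (deg I) (deg K) (frame I) (frame K) (frame J) I)) =
      ∑ J, ∑ K, X J * SFun.twist (deg J) (Y K) * (
        (sgn (deg I) (deg I + deg J + deg K) * (1 / 2)) • (
          curvature D.cov (deg I) (deg J) (frame I) (frame J) (frame K) I +
          sgn (deg J) (deg K) •
            curvature D.cov (deg I) (deg K) (frame I) (frame K) (frame J) I)) := by
    intro I
    rw [Finset.sum_comm (γ := ι ⊕ κ) (s := Finset.univ) (t := Finset.univ) (f := fun K J =>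
      (sgn (deg I) (b + a + deg K + deg J)) • (Y K * SFun.twist (deg K) (X J) *
          curvature D.cov (deg I) (deg K) (frame I) (frame K) (frame J) I)),
      Finset.smul_sum, ← Finset.sum_add_distrib, Finset.smul_sum]
    refine Finset.sum_congr rfl fun J _ => ?_
    rw [Finset.smul_sum, ← Finset.sum_add_distrib, Finset.smul_sum]
    refine Finset.sum_congr rfl fun K _ => ?_
    have e1 : sgn (deg I) (b + a + deg K + deg J) = sgn (deg I) (a + b + deg J + deg K) := by
      congr 1; ring
    have e2 : sgn (deg I) (deg I + a + b) * (1 / 2) * sgn (deg I) (a + b + deg J + deg K) =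
        sgn (deg I) (deg I + deg J + deg K) * (1 / 2) := by
      simp only [sgn_add_right]
      linear_combination (1 / 2 * sgn (deg I) (deg I) * sgn (deg I) (deg J) * sgn (deg I) (deg K))
        * (sgn (deg I) b ^ 2 * sgn_mul_self (deg I) a + sgn_mul_self (deg I) b)
    rw [SFun.mul_twist_comm (hY K) (hX J), e1, smul_mul_assoc, smul_comm (sgn a b), ← smul_add,
      smul_smul, e2, smul_smul, sgn_comm b a, ← mul_assoc, sgn_mul_self, one_mul,
      sgn_comm (deg K) (deg J), mul_smul_comm, mul_add, mul_smul_comm]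
  simp only [hI]
  rw [Finset.sum_comm]
  refine Finset.sum_congr rfl fun J _ => ?_
  rw [Finset.sum_comm]

theorem ricci_eq_of_frames {g : ι ⊕ κ → ι ⊕ κ → SFun κ U} {c : ℝ}
    (h : ∀ I J, ricci D.cov (deg I) (deg J) (frame I) (frame J) = c • g I J)
    {a b : ZMod 2} {X Y : Vect κ U} (hX : X.IsHomog a) (hY : Y.IsHomog b) :
    ricci D.cov a b X Y = c • pair g X Y := by
  rw [D.ricci_eq_sum hX hY]
  simp only [h, pair, mul_smul_comm, Finset.smul_sum]

end AffineConnection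

end Ricci

/-! ### Functions of the time coordinate -/

/-- The algebra of smooth real functions of one real variable. -/
def SmoothFn : Subalgebra ℝ (ℝ → ℝ) where
  carrier := {H | ContDiff ℝ ∞ H}
  mul_mem' {f g} hf hg := by
    have hf' : ContDiff ℝ ∞ f := hf
    have hg' : ContDiff ℝ ∞ g := hg
    exact hf'.mul hg'
  add_mem' {f g} hf hg := by
    have hf' : ContDiff ℝ ∞ f := hf
    have hg' : ContDiff ℝ ∞ g := hg
    exact hf'.add hg'
  algebraMap_mem' r := show ContDiff ℝ ∞ fun _ => r from contDiff_const

theorem SmoothFn.contDiff (H : SmoothFn) : ContDiff ℝ ∞ H.1 := H.2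

/-- The derivative of a smooth function. -/
def SmoothFn.deriv (H : SmoothFn) : SmoothFn :=
  ⟨_root_.deriv H.1, (contDiff_infty_iff_deriv.1 (SmoothFn.contDiff H)).2⟩

section Line

variable {ι : Type} [Fintype ι] [DecidableEq ι] {κ : Type} [Fintype κ] [DecidableEq κ]
  {W : Opens (Option ι → ℝ)} {V : Opens (ι → ℝ)}

/-- Functions of the time coordinate as superfunctions. -/
def timeHom (κ : Type) (W : Opens (Option ι → ℝ)) : SmoothFn →ₐ[ℝ] SFun κ W :=
  SFun.ofCInf.comp
    { toFun := fun H => timeFn W H.1 (SmoothFn.contDiff H)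
      map_one' := rfl
      map_mul' := fun _ _ => rfl
      map_zero' := rfl
      map_add' := fun _ _ => rfl
      commutes' := fun _ => rfl }

theorem timeHom_comm (H : SmoothFn) (x : SFun κ W) : x * timeHom κ W H = timeHom κ W H * x :=
  (SFun.ofCInf_comm _ x).symm

theorem twist_timeHom (p : ZMod 2) (H : SmoothFn) :
    SFun.twist p (timeHom κ W H) = timeHom κ W H := SFun.twist_ofCInf p _

theorem timeHom_mem_homog (H : SmoothFn) : timeHom κ W H ∈ SFun.homog κ W 0 :=
  SFun.ofCInf_mem_homog _

theorem CInf.pderiv_none_timeFn (H : SmoothFn) :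
    CInf.pderiv W none (timeFn W H.1 (SmoothFn.contDiff H)) =
      timeFn W (SmoothFn.deriv H).1 (SmoothFn.contDiff (SmoothFn.deriv H)) := by
  apply Subtype.ext
  funext z
  rw [CInf.pderiv_apply, CInf.fderiv_eq (timeFn W H.1 (SmoothFn.contDiff H)).1 (fun z => H.1 (z none))
    (fun _ => rfl) z]
  have h1 : HasFDerivAt (fun z : Option ι → ℝ => z none)
      (ContinuousLinearMap.proj (R := ℝ) (φ := fun _ : Option ι => ℝ) none) z.1 :=
    hasFDerivAt_apply none z.1
  have h2 := (((SmoothFn.contDiff H).differentiable (by simp)) (z.1 none)).hasFDerivAt.comp z.1 h1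
  have h3 := h2.fderiv
  simp only [Function.comp_def] at h3
  rw [h3]
  show (fderiv ℝ H.1 _) ((Pi.single none 1 : Option ι → ℝ) none) = _root_.deriv H.1 (z.1 none)
  rw [Pi.single_eq_same]
  rfl

theorem d_none_timeHom (H : SmoothFn) :
    SFun.d (Sum.inl none) (timeHom κ W H) = timeHom κ W (SmoothFn.deriv H) := by
  show CInf.pderiv W none (timeFn W H.1 (SmoothFn.contDiff H)) ⊗ₜ[ℝ] (1 : Grass κ) = _
  rw [CInf.pderiv_none_timeFn]
  rfl

theorem d_up_timeHom (I : ι ⊕ κ) (H : SmoothFn) : SFun.d (up I) (timeHom κ W H) = 0 := by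
  cases I with
  | inl a =>
    show CInf.pderiv W (some a) (timeFn W H.1 (SmoothFn.contDiff H)) ⊗ₜ[ℝ] (1 : Grass κ) = _
    rw [CInf.pderiv_some_timeFn, TensorProduct.zero_tmul]
  | inr B =>
    show timeFn W H.1 (SmoothFn.contDiff H) ⊗ₜ[ℝ]
      (CliffordAlgebra.contractLeft (LinearMap.proj B) (1 : Grass κ)) = 0
    rw [CliffordAlgebra.contractLeft_one, TensorProduct.tmul_zero]

theorem SFun.twist_pull {ι' : Type} [Fintype ι'] [DecidableEq ι'] {U : Opens (ι' → ℝ)}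
    (u : ι → CInf U) (h : ∀ x : U, (fun a => (u a).1 x) ∈ V) (p : ZMod 2) (x : SFun κ V) :
    SFun.twist p (SFun.pull u h x) = SFun.pull u h (SFun.twist p x) := by
  induction x using SFun.induction_homog with
  | hh r x hx =>
    rw [SFun.twist_of_mem hx, SFun.twist_of_mem (SFun.pull_mem_homog u h hx), map_smul]
  | ha x y hx hy => simp only [map_add, hx, hy]

theorem SFun.twist_pr (hW : ∀ z : W, (fun a => z.1 (some a)) ∈ V) (p : ZMod 2) (x : SFun κ V) :
    SFun.twist p (SFun.pr hW x) = SFun.pr hW (SFun.twist p x) := SFun.twist_pull _ _ p x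

/-- The metric coefficients on the fibre directions are products of a function of `t` and a
superfunction pulled back from the fibre. On such products `∂_t` sees only the first factor and the
fibre derivations only the second. -/
theorem d_none_timeHom_mul_pr (hW : ∀ z : W, (fun a => z.1 (some a)) ∈ V) (H : SmoothFn)
    (x : SFun κ V) : SFun.d (Sum.inl none) (timeHom κ W H * SFun.pr hW x) =
      timeHom κ W (SmoothFn.deriv H) * SFun.pr hW x := by
  rw [SFun.d_mul, d_none_timeHom, SFun.d_pr_none, mul_zero, add_zero]

theorem d_up_timeHom_mul_pr (hW : ∀ z : W, (fun a => z.1 (some a)) ∈ V) (I : ι ⊕ κ) (H : SmoothFn)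
    (x : SFun κ V) : SFun.d (up I) (timeHom κ W H * SFun.pr hW x) =
      timeHom κ W H * SFun.pr hW (SFun.d I x) := by
  rw [SFun.d_mul, d_up_timeHom, SFun.d_pr_up, zero_mul, zero_add, twist_timeHom]

/-! ### The slice `t = 0` -/

/-- Restriction of superfunctions to the slice `t = 0`. -/
def slice (h0 : ∀ x : V, (fun o : Option ι => (o.elim (0 : CInf V) (CInf.coord V)).1 x) ∈ W) :
    SFun κ W →ₐ[ℝ] SFun κ V :=
  SFun.pull (fun o => o.elim 0 (CInf.coord V)) h0

section Slice

variable (h0 : ∀ x : V, (fun o : Option ι => (o.elim (0 : CInf V) (CInf.coord V)).1 x) ∈ W)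

theorem slice_pr (hW : ∀ z : W, (fun a => z.1 (some a)) ∈ V) (x : SFun κ V) :
    slice h0 (SFun.pr hW x) = x := by
  have h := SFun.pull_pull (κ := κ) _ h0 (fun a => CInf.coord W (some a)) hW (CInf.coord V)
    (fun x => x.2) (fun _ => rfl) x
  refine h.trans ?_
  induction x using TensorProduct.induction_on with
  | zero => simp
  | tmul f w => rfl
  | add a b ha hb =>
    -- The composition identity `h` mentions `x`, so each induction hypothesis takes its own
    -- instance of it as a premise.
    rw [map_add, ha ?_, hb ?_]
    · exact SFun.pull_pull _ _ _ _ _ _ (fun _ => rfl) b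
    · exact SFun.pull_pull _ _ _ _ _ _ (fun _ => rfl) a

theorem slice_timeHom (H : SmoothFn) : slice h0 (timeHom κ W H) = H.1 0 • (1 : SFun κ V) := by
  show CInf.pull _ h0 (timeFn W H.1 (SmoothFn.contDiff H)) ⊗ₜ[ℝ] (1 : Grass κ) = _
  have e : CInf.pull _ h0 (timeFn W H.1 (SmoothFn.contDiff H)) = H.1 0 • (1 : CInf V) := by
    apply Subtype.ext
    funext x
    exact (mul_one _).symm
  rw [e, ← TensorProduct.smul_tmul']
  rfl

end Slice

/-! ### Lifting vector fields to the product with the line -/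

/-- Definition by cases on the coordinates of the product with the line. -/
def lineCases {α : Type} (a : α) (f : ι ⊕ κ → α) : Option ι ⊕ κ → α :=
  Sum.elim (fun o => o.elim a fun i => f (Sum.inl i)) fun B => f (Sum.inr B)

theorem lineCases_none {α : Type} (a : α) (f : ι ⊕ κ → α) :
    lineCases a f (Sum.inl none) = a := rfl

theorem lineCases_up {α : Type} (a : α) (f : ι ⊕ κ → α) (I : ι ⊕ κ) :
    lineCases a f (up I) = f I := by cases I <;> rfl

theorem up_injective : Function.Injective (up : ι ⊕ κ → Option ι ⊕ κ) :=
  Function.Injective.sumMap (Option.some_injective _) Function.injective_id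

theorem up_ne_none (I : ι ⊕ κ) : up I ≠ Sum.inl none := by cases I <;> simp [up]

theorem deg_none : deg (Sum.inl none : Option ι ⊕ κ) = 0 := rfl

namespace Vect

/-- The lift of a vector field along the projection `ℝ × V → V`. -/
def lift (hW : ∀ z : W, (fun a => z.1 (some a)) ∈ V) (X : Vect κ V) : Vect κ W :=
  lineCases 0 fun I => SFun.pr hW (X I)

variable (hW : ∀ z : W, (fun a => z.1 (some a)) ∈ V)

theorem lift_none (X : Vect κ V) : lift hW X (Sum.inl none) = 0 := rfl

theorem lift_up (X : Vect κ V) (I : ι ⊕ κ) : lift hW X (up I) = SFun.pr hW (X I) :=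
  lineCases_up _ _ I

theorem ext_line {X Y : Vect κ W} (h0 : X (Sum.inl none) = Y (Sum.inl none))
    (h : ∀ I, X (up I) = Y (up I)) : X = Y := by
  funext I
  rcases index_cases I with rfl | ⟨I, rfl⟩
  · exact h0
  · exact h I

theorem lift_add (X Y : Vect κ V) : lift hW (X + Y) = lift hW X + lift hW Y := by
  refine ext_line ?_ fun I => ?_
  · rw [Pi.add_apply, lift_none, lift_none, lift_none, add_zero]
  · rw [Pi.add_apply, lift_up, lift_up, lift_up, Pi.add_apply, map_add]

theorem lift_smul (f : SFun κ V) (X : Vect κ V) :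
    lift hW (f • X) = SFun.pr hW f • lift hW X := by
  refine ext_line ?_ fun I => ?_
  · rw [Pi.smul_apply, lift_none, lift_none, smul_zero]
  · rw [Pi.smul_apply, lift_up, lift_up, Pi.smul_apply, smul_eq_mul, smul_eq_mul, map_mul]

theorem lift_real_smul (c : ℝ) (X : Vect κ V) :
    lift hW (c • X) = c • lift hW X := by
  refine ext_line ?_ fun I => ?_
  · rw [Pi.smul_apply, lift_none, lift_none, smul_zero]
  · rw [Pi.smul_apply, lift_up, lift_up, Pi.smul_apply, map_smul]

theorem frame_up_up (I J : ι ⊕ κ) :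
    (frame (up I) : Vect κ W) (up J) = SFun.pr hW ((frame I : Vect κ V) J) := by
  by_cases h : J = I
  · rw [h, frame_same, frame_same, map_one]
  · rw [frame_ne h, frame_ne fun h' => h (up_injective h'), map_zero]

theorem frame_up_none (I : ι ⊕ κ) : (frame (up I) : Vect κ W) (Sum.inl none) = 0 :=
  frame_ne (Ne.symm (up_ne_none I))

theorem frame_none_up (I : ι ⊕ κ) : (frame (Sum.inl none) : Vect κ W) (up I) = 0 :=
  frame_ne (up_ne_none I)

theorem lift_frame (I : ι ⊕ κ) : lift hW (frame I) = frame (up I) := by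
  refine ext_line ?_ fun J => ?_
  · rw [lift_none, frame_up_none]
  · rw [lift_up, frame_up_up hW]

theorem IsHomog.lift {a : ZMod 2} {X : Vect κ V} (hX : X.IsHomog a) :
    (lift hW X).IsHomog a := fun I => by
  rcases index_cases I with rfl | ⟨I, rfl⟩
  · exact Submodule.zero_mem _
  · rw [lift_up, deg_up]
    exact SFun.pull_mem_homog _ _ (hX I)

theorem act_lift_timeHom_mul_pr (X : Vect κ V) (H : SmoothFn) (f : SFun κ V) :
    (lift hW X).act (timeHom κ W H * SFun.pr hW f) = timeHom κ W H * SFun.pr hW (X.act f) := by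
  rw [act, sum_index, lift_none, zero_mul, zero_add, act, map_sum, Finset.mul_sum]
  refine Finset.sum_congr rfl fun I _ => ?_
  rw [lift_up, d_up_timeHom_mul_pr, map_mul, ← mul_assoc, timeHom_comm, mul_assoc]

theorem act_lift_pr (X : Vect κ V) (f : SFun κ V) :
    (lift hW X).act (SFun.pr hW f) = SFun.pr hW (X.act f) := by
  have h := act_lift_timeHom_mul_pr hW X 1 f
  rwa [map_one, one_mul, one_mul] at h

theorem bracket_lift_up (a b : ZMod 2) (X Y : Vect κ V) (K : ι ⊕ κ) :
    bracket a b (lift hW X) (lift hW Y) (up K) = SFun.pr hW (bracket a b X Y K) := by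
  simp only [bracket, lift_up, act_lift_pr, map_sub, map_smul]

end Vect

end Line

/-! ### Rules for differentiating functions of time. -/

theorem SmoothFn.deriv_mul (H K : SmoothFn) :
    SmoothFn.deriv (H * K) = SmoothFn.deriv H * K + H * SmoothFn.deriv K := by
  apply Subtype.ext
  funext t
  exact _root_.deriv_mul ((SmoothFn.contDiff H).differentiable (by simp) t)
    ((SmoothFn.contDiff K).differentiable (by simp) t)

theorem SmoothFn.deriv_algebraMap (c : ℝ) :
    SmoothFn.deriv (algebraMap ℝ SmoothFn c) = 0 := by
  apply Subtype.ext
  funext t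
  exact deriv_const t c

theorem SmoothFn.deriv_sub_algebraMap (H : SmoothFn) (c : ℝ) :
    SmoothFn.deriv (H - algebraMap ℝ SmoothFn c) = SmoothFn.deriv H := by
  apply Subtype.ext
  funext t
  exact deriv_sub_const (f := H.1) c

section Warp

variable {ι : Type} [Fintype ι] [DecidableEq ι] {κ : Type} [Fintype κ] [DecidableEq κ]
  {W : Opens (Option ι → ℝ)} {V : Opens (ι → ℝ)}
  (hW : ∀ z : W, (fun a => z.1 (some a)) ∈ V)

open Vect

/-! ### The warped metric -/

section Metric

variable (H : SmoothFn) (g : ι ⊕ κ → ι ⊕ κ → SFun κ V)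

theorem warpComp_up_up_timeHom (I J : ι ⊕ κ) :
    warpComp hW H.1 (SmoothFn.contDiff H) g (up I) (up J) =
      timeHom κ W (H ^ 2) * SFun.pr hW (g I J) :=
  warpComp_up_up hW H.1 (SmoothFn.contDiff H) g I J

theorem pair_warp_none_right (X : Vect κ W) :
    pair (warpComp hW H.1 (SmoothFn.contDiff H) g) X (frame (Sum.inl none)) =
      -X (Sum.inl none) := by
  simp only [pair_frame_right, sum_index, warpComp_none_none, warpComp_up_none, mul_zero,
    Finset.sum_const_zero, add_zero, mul_neg, mul_one]

theorem pair_warp_none_left (X : Vect κ W) :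
    pair (warpComp hW H.1 (SmoothFn.contDiff H) g) (frame (Sum.inl none)) X =
      -X (Sum.inl none) := by
  simp only [pair_frame_left, sum_index, warpComp_none_none, warpComp_none_up, mul_zero,
    Finset.sum_const_zero, add_zero, mul_neg, mul_one, deg_none, SFun.twist_zero]

theorem pair_warp_lift_right (X : Vect κ W) (Y : Vect κ V) :
    pair (warpComp hW H.1 (SmoothFn.contDiff H) g) X (lift hW Y) =
      timeHom κ W (H ^ 2) *
        ∑ I, ∑ J, X (up I) * SFun.pr hW (SFun.twist (deg I) (Y J)) * SFun.pr hW (g I J) := by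
  simp only [pair, sum_index, lift_none, map_zero, mul_zero, zero_mul, warpComp_none_up, zero_add,
    Finset.sum_const_zero, lift_up, Finset.mul_sum, warpComp_up_up_timeHom, deg_up, SFun.twist_pr]
  refine Finset.sum_congr rfl fun I _ => Finset.sum_congr rfl fun J _ => ?_
  rw [← mul_assoc, timeHom_comm, mul_assoc (timeHom κ W (H ^ 2))]

theorem pair_warp_lift_lift (X Y : Vect κ V) :
    pair (warpComp hW H.1 (SmoothFn.contDiff H) g) (lift hW X) (lift hW Y) =
      timeHom κ W (H ^ 2) * SFun.pr hW (pair g X Y) := by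
  rw [pair_warp_lift_right]
  simp only [pair, lift_up, map_sum, map_mul]

theorem pair_warp_lift_left (X : Vect κ W) (Y : Vect κ V) :
    pair (warpComp hW H.1 (SmoothFn.contDiff H) g) (lift hW Y) X =
      timeHom κ W (H ^ 2) *
        ∑ I, ∑ J, SFun.pr hW (Y I) * SFun.twist (deg I) (X (up J)) * SFun.pr hW (g I J) := by
  simp only [pair, sum_index, lift_none, mul_zero, zero_mul, warpComp_up_none, zero_add,
    Finset.sum_const_zero, lift_up, Finset.mul_sum, warpComp_up_up_timeHom, deg_up]
  refine Finset.sum_congr rfl fun I _ => Finset.sum_congr rfl fun J _ => ?_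
  rw [← mul_assoc, timeHom_comm, mul_assoc (timeHom κ W (H ^ 2))]

end Metric

/-! ### The connection induced on the slice -/

section SliceConnection

variable (h0 : ∀ x : V, (fun o : Option ι => (o.elim (0 : CInf V) (CInf.coord V)).1 x) ∈ W)

/-- The connection induced on the slice `t = 0` by a connection on the product with the line. -/
def sliceConnection (D : AffineConnection κ W) : AffineConnection κ V where
  cov X Y := fun I => slice h0 (D.cov (lift hW X) (lift hW Y) (up I))
  cov_homog a b X Y hX hY := fun I => by
    have h := D.cov_homog a b _ _ (hX.lift hW) (hY.lift hW) (up I)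
    rw [deg_up] at h
    exact SFun.pull_mem_homog _ _ h
  cov_add_left X Y Z := by
    funext I
    rw [lift_add, D.cov_add_left, Pi.add_apply, Pi.add_apply, map_add]
  cov_add_right X Y Z := by
    funext I
    rw [lift_add, D.cov_add_right, Pi.add_apply, Pi.add_apply, map_add]
  cov_smul_left f X Y := by
    funext I
    rw [lift_smul, D.cov_smul_left, Pi.smul_apply, Pi.smul_apply, smul_eq_mul, smul_eq_mul,
      map_mul, slice_pr]
  leibniz a r X Y f hX hf := by
    funext I
    have hf' : SFun.pr hW f ∈ SFun.homog κ W r := SFun.pull_mem_homog _ _ hf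
    rw [lift_smul, D.leibniz a r _ _ _ (hX.lift hW) hf', act_lift_pr]
    simp only [Pi.add_apply, Pi.smul_apply, lift_up, smul_eq_mul, map_add, map_smul, map_mul,
      slice_pr]

/-- At `t = 0` the metric on lifted fields is `h(0)² g`, and the `∂_t` component discarded by the
slice is orthogonal to every lift. The two Levi-Civita identities therefore restrict, and the
nonzero constant `h(0)²` cancels. This yields a Levi-Civita connection of the fibre without an
existence theorem. -/
theorem sliceConnection_isLeviCivita {H : SmoothFn} (hH : H.1 0 ≠ 0)
    {g : ι ⊕ κ → ι ⊕ κ → SFun κ V} (D : AffineConnection κ W)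
    (hD : D.IsLeviCivita (warpComp hW H.1 (SmoothFn.contDiff H) g)) :
    (sliceConnection hW h0 D).IsLeviCivita g := by
  have hp : ∀ (X : Vect κ W) (Y : Vect κ V),
      slice h0 (pair (warpComp hW H.1 (SmoothFn.contDiff H) g) X (lift hW Y)) =
        (H.1 0) ^ 2 • pair g (fun I => slice h0 (X (up I))) Y := by
    intro X Y
    rw [pair_warp_lift_right, map_mul, slice_timeHom, smul_mul_assoc, one_mul]
    simp only [map_sum, map_mul, slice_pr, pair]
    rfl
  have hp' : ∀ (X : Vect κ W) (Y : Vect κ V),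
      slice h0 (pair (warpComp hW H.1 (SmoothFn.contDiff H) g) (lift hW Y) X) =
        (H.1 0) ^ 2 • pair g Y (fun I => slice h0 (X (up I))) := by
    intro X Y
    have ht : ∀ p (x : SFun κ W), slice h0 (SFun.twist p x) = SFun.twist p (slice h0 x) :=
      fun p x => (SFun.twist_pull _ _ p x).symm
    rw [pair_warp_lift_left, map_mul, slice_timeHom, smul_mul_assoc, one_mul]
    simp only [map_sum, map_mul, slice_pr, pair, ht]
    rfl
  refine ⟨fun a b X Y hX hY => ?_, fun a b X Y Z hX hY => ?_⟩
  · funext K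
    have h := congrArg (slice h0)
      (congrFun (hD.1 a b _ _ (hX.lift hW) (hY.lift hW)) (up K))
    rw [Pi.sub_apply, Pi.sub_apply, Pi.smul_apply, bracket_lift_up, map_sub, map_sub, map_smul,
      slice_pr, Pi.zero_apply, map_zero] at h
    exact h
  · have h := congrArg (slice h0) (hD.2 a b _ _ (lift hW Z) (hX.lift hW) (hY.lift hW))
    rw [map_add, map_smul, hp, hp', pair_warp_lift_lift, act_lift_timeHom_mul_pr, map_mul,
      slice_timeHom, slice_pr, smul_mul_assoc, one_mul, smul_comm (sgn a b), ← smul_add] at h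
    exact smul_right_injective _ (pow_ne_zero 2 hH) h

end SliceConnection

/-! ### The connection of the warped product -/

section WarpConnection

variable (H ψ : SmoothFn) (s : ℝ) (g : ι ⊕ κ → ι ⊕ κ → SFun κ V)
  (Γ : ι ⊕ κ → ι ⊕ κ → Vect κ V)

/-- The Christoffel symbols of the warped product with warping function `H`, `ψ` being the
logarithmic derivative of `H`, modified by the term `s g(Y, ∂_t) X`. -/
def warpChristoffel : Option ι ⊕ κ → Option ι ⊕ κ → Vect κ W :=
  lineCases
    (lineCases (timeHom κ W (-algebraMap ℝ SmoothFn s) • frame (Sum.inl none))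
      fun J => timeHom κ W ψ • frame (up J))
    fun I => lineCases (timeHom κ W (ψ - algebraMap ℝ SmoothFn s) • frame (up I))
      fun J => lift hW (Γ I J) +
        (timeHom κ W (H * SmoothFn.deriv H) * SFun.pr hW (g I J)) • frame (Sum.inl none)

theorem warpChristoffel_none_none :
    warpChristoffel hW H ψ s g Γ (Sum.inl none) (Sum.inl none) =
      timeHom κ W (-algebraMap ℝ SmoothFn s) • frame (Sum.inl none) := rfl

theorem warpChristoffel_none_up (J : ι ⊕ κ) :
    warpChristoffel hW H ψ s g Γ (Sum.inl none) (up J) = timeHom κ W ψ • frame (up J) := by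
  rw [warpChristoffel, lineCases_none, lineCases_up]

theorem warpChristoffel_up_none (I : ι ⊕ κ) :
    warpChristoffel hW H ψ s g Γ (up I) (Sum.inl none) =
      timeHom κ W (ψ - algebraMap ℝ SmoothFn s) • frame (up I) := by
  rw [warpChristoffel, lineCases_up, lineCases_none]

theorem warpChristoffel_up_up (I J : ι ⊕ κ) :
    warpChristoffel hW H ψ s g Γ (up I) (up J) = lift hW (Γ I J) +
      (timeHom κ W (H * SmoothFn.deriv H) * SFun.pr hW (g I J)) • frame (Sum.inl none) := by
  rw [warpChristoffel, lineCases_up, lineCases_up]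

variable {g Γ}

theorem warpChristoffel_isHomog (hg : ∀ I J, g I J ∈ SFun.homog κ V (deg I + deg J))
    (hΓ : ∀ I J, (Γ I J).IsHomog (deg I + deg J)) (I J : Option ι ⊕ κ) :
    (warpChristoffel hW H ψ s g Γ I J).IsHomog (deg I + deg J) := by
  have ht : ∀ (K : SmoothFn) (I : Option ι ⊕ κ),
      (timeHom κ W K • frame I : Vect κ W).IsHomog (deg I) := by
    intro K I
    have h := IsHomog.smul (timeHom_mem_homog (κ := κ) (W := W) K) (frame_isHomog I)
    rwa [zero_add] at h
  rcases index_cases I with rfl | ⟨I, rfl⟩ <;> rcases index_cases J with rfl | ⟨J, rfl⟩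
  · rw [warpChristoffel_none_none, deg_none, add_zero]
    exact ht _ (Sum.inl none)
  · rw [warpChristoffel_none_up, deg_none, zero_add]
    exact ht _ (up J)
  · rw [warpChristoffel_up_none, deg_none, add_zero]
    exact ht _ (up I)
  · rw [warpChristoffel_up_up, deg_up, deg_up]
    refine ((hΓ I J).lift hW).add ?_
    have hp : SFun.pr hW (g I J) ∈ SFun.homog κ W (deg I + deg J) :=
      SFun.pull_mem_homog _ _ (hg I J)
    have h := IsHomog.smul (SFun.mul_mem_homog (timeHom_mem_homog (κ := κ) (W := W)
      (H * SmoothFn.deriv H)) hp) (frame_isHomog (U := W) (Sum.inl none : Option ι ⊕ κ))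
    rwa [deg_none, zero_add, add_zero] at h

/-- The affine connection of the warped product. -/
def warpConnection (hg : ∀ I J, g I J ∈ SFun.homog κ V (deg I + deg J))
    (hΓ : ∀ I J, (Γ I J).IsHomog (deg I + deg J)) : AffineConnection κ W :=
  AffineConnection.ofChristoffel (warpChristoffel hW H ψ s g Γ)
    (warpChristoffel_isHomog hW H ψ s hg hΓ)

theorem warpConnection_frame (hg : ∀ I J, g I J ∈ SFun.homog κ V (deg I + deg J))
    (hΓ : ∀ I J, (Γ I J).IsHomog (deg I + deg J)) (I J : Option ι ⊕ κ) :
    (warpConnection hW H ψ s hg hΓ).cov (frame I) (frame J) =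
      warpChristoffel hW H ψ s g Γ I J := christoffel_frame_frame _ I J

theorem warpChristoffel_symm (hs : ∀ I J, g I J = sgn (deg I) (deg J) • g J I)
    (hΓ : ∀ I J, Γ I J = sgn (deg I) (deg J) • Γ J I) (I J : ι ⊕ κ) :
    warpChristoffel hW H ψ s g Γ (up I) (up J) =
      sgn (deg I) (deg J) • warpChristoffel hW H ψ s g Γ (up J) (up I) := by
  rw [warpChristoffel_up_up, warpChristoffel_up_up, smul_add, ← lift_real_smul, ← hΓ I J,
    hs I J, map_smul, mul_smul_comm, smul_assoc]

variable {H ψ}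

set_option maxHeartbeats 1000000 in
theorem warpConnection_isLeviCivita (hψ : ψ * H = SmoothFn.deriv H)
    (hg : ∀ I J, g I J ∈ SFun.homog κ V (deg I + deg J))
    (hs : ∀ I J, g I J = sgn (deg I) (deg J) • g J I)
    (D : AffineConnection κ V) (hD : D.IsLeviCivita g)
    (hΓ : ∀ I J, (D.cov (frame I) (frame J)).IsHomog (deg I + deg J)) :
    (warpConnection hW H ψ 0 hg hΓ).IsLeviCivita
      (warpComp hW H.1 (SmoothFn.contDiff H) g) := by
  -- Both facts put `h h'` and `(h²)'` in terms of `ψ h²`: in `∂_t g_IJ` each of the two slots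
  -- contributes one `ψ h²`.
  have hφ : ψ * H ^ 2 = H * SmoothFn.deriv H := by rw [← hψ]; ring
  have hd : SmoothFn.deriv (H ^ 2) = ψ * H ^ 2 + ψ * H ^ 2 := by
    rw [pow_two, SmoothFn.deriv_mul, ← hψ]; ring
  refine AffineConnection.isLeviCivita_of_frames _ (fun I J => ?_) fun I J K => ?_
  · simp only [warpConnection_frame]
    rcases index_cases I with rfl | ⟨I, rfl⟩ <;> rcases index_cases J with rfl | ⟨J, rfl⟩
    · rw [deg_none, sgn_zero_left, one_smul]
    · rw [deg_none, sgn_zero_left, one_smul, warpChristoffel_none_up, warpChristoffel_up_none,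
        map_zero, sub_zero]
    · rw [deg_none, sgn_zero_right, one_smul, warpChristoffel_none_up, warpChristoffel_up_none,
        map_zero, sub_zero]
    · rw [deg_up, deg_up]
      exact warpChristoffel_symm hW H ψ 0 hs hD.symm_frames I J
  · simp only [warpConnection_frame]
    have hz : timeHom κ W (-algebraMap ℝ SmoothFn 0) = 0 := by
      rw [map_zero, neg_zero, map_zero]
    -- Four of the eight cases have content. Differentiating a fibre component along `∂_t` is the
    -- formula for `(h²)'`. Differentiating either zero mixed component along the fibre needs `ψ h²`
    -- to cancel `h h'`. With three fibre indices it is compatibility on the fibre times `h²`.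
    rcases index_cases I with rfl | ⟨I, rfl⟩ <;> rcases index_cases J with rfl | ⟨J, rfl⟩ <;>
      rcases index_cases K with rfl | ⟨K, rfl⟩
    · rw [warpComp_none_none, map_neg, SFun.d_one, warpChristoffel_none_none, hz, zero_smul,
        pair_zero_left, pair_zero_right, smul_zero, add_zero, neg_zero]
    · rw [warpComp_none_up, map_zero, warpChristoffel_none_none, hz, zero_smul, pair_zero_left,
        warpChristoffel_none_up, pair_warp_none_left, Pi.smul_apply, frame_up_none, smul_zero,
        neg_zero, smul_zero, add_zero]
    · rw [warpComp_up_none, map_zero, warpChristoffel_none_none, hz, zero_smul, pair_zero_right,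
        warpChristoffel_none_up, pair_warp_none_right, Pi.smul_apply, frame_up_none, smul_zero,
        neg_zero, smul_zero, add_zero]
    · rw [warpChristoffel_none_up, warpChristoffel_none_up, pair_smul_left,
        pair_smul_right _ (frame_isHomog _), pair_frame_frame, warpComp_up_up_timeHom,
        d_none_timeHom_mul_pr, twist_timeHom, deg_none, sgn_zero_left, one_smul, hd, map_add,
        add_mul, map_mul, mul_assoc]
    · rw [warpComp_none_none, map_neg, SFun.d_one, warpChristoffel_up_none, pair_warp_none_left,
        pair_warp_none_right, Pi.smul_apply, frame_up_none, smul_zero, neg_zero, smul_zero,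
        add_zero]
    · rw [warpComp_none_up, map_zero, warpChristoffel_up_none, warpChristoffel_up_up,
        pair_warp_none_left, pair_smul_left, pair_frame_frame, warpComp_up_up_timeHom,
        Pi.add_apply, lift_none, Pi.smul_apply, frame_same, smul_eq_mul, mul_one, zero_add,
        deg_none, sgn_zero_right, one_smul, map_zero, sub_zero, ← hφ, map_mul, ← mul_assoc,
        add_neg_cancel]
    · rw [warpComp_up_none, map_zero, warpChristoffel_up_none, warpChristoffel_up_up,
        pair_warp_none_right, pair_smul_right _ (frame_isHomog _), pair_frame_frame,
        warpComp_up_up_timeHom, Pi.add_apply, lift_none, Pi.smul_apply, frame_same, smul_eq_mul,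
        mul_one, zero_add, twist_timeHom, deg_up, deg_up, ← mul_smul_comm, ← mul_smul_comm,
        ← map_smul, ← hs I J, map_zero, sub_zero, ← hφ, map_mul, ← mul_assoc, neg_add_cancel]
    · have h := congrArg (fun x => timeHom κ W (H ^ 2) * SFun.pr hW x) (hD.metric_frames I J K)
      simp only [map_add, map_smul, mul_add, mul_smul_comm] at h
      rw [warpComp_up_up_timeHom, d_up_timeHom_mul_pr, h, warpChristoffel_up_up,
        warpChristoffel_up_up, pair_add_left, pair_add_right, pair_smul_left,
        pair_smul_right _ (frame_isHomog _), pair_frame_frame, pair_frame_frame,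
        warpComp_none_up, warpComp_up_none, mul_zero, mul_zero, add_zero, add_zero,
        ← lift_frame hW, ← lift_frame hW, pair_warp_lift_lift, pair_warp_lift_lift, deg_up, deg_up]

end WarpConnection

end Warp

/-! ### The unsymmetrized Ricci trace on coordinate fields. -/

section RicciTrace

variable {ι : Type} [Fintype ι] [DecidableEq ι] {κ : Type} [Fintype κ] [DecidableEq κ]
  {U : Opens (ι → ℝ)}

open Vect

/-- The supertrace of the curvature on coordinate fields, before symmetrization. -/
def ricciTrace (cov : Vect κ U → Vect κ U → Vect κ U) (I J : ι ⊕ κ) : SFun κ U :=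
  ∑ K, sgn (deg K) (deg K + deg I + deg J) •
    curvature cov (deg K) (deg I) (frame K) (frame I) (frame J) K

theorem ricci_frame_frame (cov : Vect κ U → Vect κ U → Vect κ U) (I J : ι ⊕ κ) :
    ricci cov (deg I) (deg J) (frame I) (frame J) =
      (1 / 2 : ℝ) • (ricciTrace cov I J + sgn (deg I) (deg J) • ricciTrace cov J I) := by
  simp only [ricci, ricciTrace, Finset.smul_sum]
  rw [← Finset.sum_add_distrib, Finset.smul_sum]
  refine Finset.sum_congr rfl fun K _ => ?_
  rw [add_right_comm (deg K) (deg J) (deg I), mul_comm, mul_smul, smul_comm (sgn (deg I) (deg J)),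
    smul_add]

/-- The supertrace of the identity is the superdimension: this is where `q - n` enters the Einstein
equation. -/
theorem sum_sgn_deg : ∑ K : ι ⊕ κ, sgn (deg K) (deg K) = (Fintype.card ι : ℝ) - Fintype.card κ := by
  rw [Fintype.sum_sum_type]
  have h1 : ∀ a : ι, sgn (deg (Sum.inl a : ι ⊕ κ)) (deg (Sum.inl a : ι ⊕ κ)) = 1 :=
    fun _ => sgn_zero_left 0
  have h2 : ∀ B : κ, sgn (deg (Sum.inr B : ι ⊕ κ)) (deg (Sum.inr B : ι ⊕ κ)) = -1 :=
    fun _ => sgn_one_one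
  simp only [h1, h2, Finset.sum_const, Finset.card_univ, nsmul_eq_mul]
  ring

theorem AffineConnection.curvature_frame_swap (D : AffineConnection κ U) (I J : ι ⊕ κ)
    (Y : Vect κ U) : curvature D.cov (deg I) (deg J) (frame I) (frame J) Y =
      -(sgn (deg I) (deg J) • curvature D.cov (deg J) (deg I) (frame J) (frame I) Y) := by
  rw [D.curvature_frame_frame, D.curvature_frame_frame, smul_sub, smul_smul,
    sgn_comm (deg J) (deg I), sgn_mul_self, one_smul, neg_sub]

end RicciTrace

/-! ### Curvature and Ricci trace of the warped product, with the parameter `s`. -/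

section WarpRicci

variable {ι : Type} [Fintype ι] [DecidableEq ι] {κ : Type} [Fintype κ] [DecidableEq κ]
  {W : Opens (Option ι → ℝ)} {V : Opens (ι → ℝ)}
  (hW : ∀ z : W, (fun a => z.1 (some a)) ∈ V)

open Vect

/-- On the product with the line, `s = 1` gives the semi-symmetric non-metric connection. -/
theorem semiSymm_warpConnection (H ψ : SmoothFn) {g : ι ⊕ κ → ι ⊕ κ → SFun κ V}
    {Γ : ι ⊕ κ → ι ⊕ κ → Vect κ V} (hg : ∀ I J, g I J ∈ SFun.homog κ V (deg I + deg J))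
    (hΓ : ∀ I J, (Γ I J).IsHomog (deg I + deg J)) :
    semiSymm (warpConnection hW H ψ 0 hg hΓ).cov (warpComp hW H.1 (SmoothFn.contDiff H) g)
      (frame (Sum.inl none)) = (warpConnection hW H ψ 1 hg hΓ).cov := by
  funext X Y
  -- Because `g(∂_J, ∂_t)` is `-1` for `J = t` and `0` otherwise, the added term changes only the
  -- symbols whose second index is `t`, by `-∂_I`.
  have h1 : ∀ I J : Option ι ⊕ κ, warpChristoffel hW H ψ 1 g Γ I J =
      warpChristoffel hW H ψ 0 g Γ I J +
        (if J = Sum.inl none then (-1 : ℝ) • (frame I : Vect κ W) else 0) := by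
    have e1 : timeHom κ W (-algebraMap ℝ SmoothFn 1) = -1 := by rw [map_one, map_neg, map_one]
    have e2 : timeHom κ W (ψ - algebraMap ℝ SmoothFn 1) = timeHom κ W ψ - 1 := by
      rw [map_one, map_sub, map_one]
    have e3 : timeHom κ W (-algebraMap ℝ SmoothFn 0) = 0 := by rw [map_zero, neg_zero, map_zero]
    have e4 : timeHom κ W (ψ - algebraMap ℝ SmoothFn 0) = timeHom κ W ψ := by
      rw [map_zero, sub_zero]
    intro I J
    rcases index_cases I with rfl | ⟨I, rfl⟩ <;> rcases index_cases J with rfl | ⟨J, rfl⟩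
    · rw [if_pos rfl, warpChristoffel_none_none, warpChristoffel_none_none, e1, e3, zero_smul,
        zero_add, neg_smul, one_smul, neg_smul, one_smul]
    · rw [if_neg (up_ne_none J), add_zero, warpChristoffel_none_up, warpChristoffel_none_up]
    · rw [if_pos rfl, warpChristoffel_up_none, warpChristoffel_up_none, e2, e4, sub_smul,
        one_smul, neg_smul, one_smul, sub_eq_add_neg]
    · rw [if_neg (up_ne_none J), add_zero, warpChristoffel_up_up, warpChristoffel_up_up]
  have h2 : X.rmul (-Y (Sum.inl none)) = ∑ I, ∑ J, (X I * SFun.twist (deg I) (Y J)) •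
      (if J = Sum.inl none then (-1 : ℝ) • (frame I : Vect κ W) else 0) := by
    rw [eq_sum_frame (X.rmul _)]
    refine Finset.sum_congr rfl fun I _ => ?_
    rw [Finset.sum_eq_single (Sum.inl none)]
    · rw [if_pos rfl, rmul, map_neg, mul_neg, neg_smul, neg_one_smul, smul_neg]
    · intro J _ hJ
      rw [if_neg hJ, smul_zero]
    · exact fun h => absurd (Finset.mem_univ _) h
  show christoffel _ X Y + X.rmul _ = christoffel _ X Y
  rw [pair_warp_none_right, h2, christoffel, christoffel, add_assoc]
  congr 1
  simp only [h1, smul_add, Finset.sum_add_distrib]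

variable (H ψ : SmoothFn) (s : ℝ) {g : ι ⊕ κ → ι ⊕ κ → SFun κ V} (D : AffineConnection κ V)
  (hg : ∀ I J, g I J ∈ SFun.homog κ V (deg I + deg J))
  (hΓ : ∀ I J, (D.cov (frame I) (frame J)).IsHomog (deg I + deg J))

/-- Lifted components do not depend on `t`, so no derivative term appears and only the symbol `ψ`
acts. -/
theorem warp_cov_none_lift (X : Vect κ V) :
    (warpConnection hW H ψ s hg hΓ).cov (frame (Sum.inl none)) (lift hW X) =
      timeHom κ W ψ • lift hW X := by
  have h0 : lift hW (0 : Vect κ V) = 0 := by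
    have h := lift_add hW (0 : Vect κ V) 0
    rw [add_zero] at h
    exact left_eq_add.1 h
  induction X using Vect.induction with
  | h0 => rw [h0, AffineConnection.cov_zero_right, smul_zero]
  | hadd X Y hX hY => rw [lift_add, AffineConnection.cov_add_right, hX, hY, smul_add]
  | hs I r f hf =>
    rw [lift_smul, lift_frame, AffineConnection.cov_frame_smul, SFun.d_pr_none, zero_smul,
      zero_add, deg_none, SFun.twist_zero, warpConnection_frame, warpChristoffel_none_up,
      smul_smul, smul_smul, timeHom_comm]

theorem warp_cov_up_lift_up (K L : ι ⊕ κ) (X : Vect κ V) :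
    (warpConnection hW H ψ s hg hΓ).cov (frame (up K)) (lift hW X) (up L) =
      SFun.pr hW (D.cov (frame K) X L) := by
  have h0 : lift hW (0 : Vect κ V) = 0 := by
    have h := lift_add hW (0 : Vect κ V) 0
    rw [add_zero] at h
    exact left_eq_add.1 h
  induction X using Vect.induction with
  | h0 => rw [h0, AffineConnection.cov_zero_right, AffineConnection.cov_zero_right, Pi.zero_apply,
      Pi.zero_apply, map_zero]
  | hadd X Y hX hY =>
    rw [lift_add, AffineConnection.cov_add_right, Pi.add_apply, hX, hY,
      AffineConnection.cov_add_right, Pi.add_apply, map_add]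
  | hs J r f hf =>
    rw [lift_smul, lift_frame, AffineConnection.cov_frame_smul, AffineConnection.cov_frame_smul,
      warpConnection_frame, warpChristoffel_up_up, SFun.d_pr_up, deg_up, SFun.twist_pr]
    simp only [Pi.add_apply, Pi.smul_apply, smul_eq_mul, lift_up, frame_none_up, mul_zero,
      add_zero, frame_up_up hW, map_add, map_mul]

/-- The two orders of differentiation give `-s (ψ - s)` and `ψ' + (ψ - s) ψ` as coefficients of
`∂_K`; the terms `s ψ` cancel in the difference. -/
theorem warp_curvature_up_none_none (K : ι ⊕ κ) :
    curvature (warpConnection hW H ψ s hg hΓ).cov (deg (up K)) (deg (Sum.inl none : Option ι ⊕ κ))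
      (frame (up K)) (frame (Sum.inl none)) (frame (Sum.inl none)) =
      timeHom κ W (algebraMap ℝ SmoothFn s ^ 2 - ψ ^ 2 - SmoothFn.deriv ψ) • frame (up K) := by
  rw [AffineConnection.curvature_frame_frame, deg_none, sgn_zero_right, one_smul,
    warpConnection_frame, warpConnection_frame, warpChristoffel_none_none, warpChristoffel_up_none,
    AffineConnection.cov_frame_smul, AffineConnection.cov_frame_smul, warpConnection_frame,
    warpConnection_frame, warpChristoffel_none_up, warpChristoffel_up_none, d_up_timeHom,
    zero_smul, zero_add, twist_timeHom, twist_timeHom, d_none_timeHom,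
    SmoothFn.deriv_sub_algebraMap, smul_smul, smul_smul, ← map_mul, ← map_mul, ← add_smul,
    ← sub_smul, ← map_add, ← map_sub]
  congr 2
  ring

/-- In the fibre directions both orders give `ψ` times the fibre symbol. The `∂_t` component is left
aside because the trace over fibre indices never reads it. -/
theorem warp_curvature_up_none_up (K J L : ι ⊕ κ) :
    curvature (warpConnection hW H ψ s hg hΓ).cov (deg (up K)) (deg (Sum.inl none : Option ι ⊕ κ))
      (frame (up K)) (frame (Sum.inl none)) (frame (up J)) (up L) = 0 := by
  rw [AffineConnection.curvature_frame_frame, deg_none, sgn_zero_right, one_smul,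
    warpConnection_frame, warpConnection_frame, warpChristoffel_none_up, warpChristoffel_up_up,
    AffineConnection.cov_frame_smul, AffineConnection.cov_add_right, warp_cov_none_lift,
    AffineConnection.cov_frame_smul, warpConnection_frame, warpConnection_frame,
    warpChristoffel_up_up, warpChristoffel_none_none, twist_timeHom, d_up_timeHom]
  simp only [Pi.sub_apply, Pi.add_apply, Pi.smul_apply, smul_eq_mul, frame_none_up, mul_zero,
    add_zero, zero_mul, zero_add, sub_self]

/-- Differentiating `∂_t` along the fibre multiplies by `ψ - s`, a function of `t` alone, so the
curvature is that multiple of the torsion on fibre fields. -/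
theorem warp_curvature_up_up_none (hs : ∀ I J, g I J = sgn (deg I) (deg J) • g J I)
    (hD : ∀ I J, D.cov (frame I) (frame J) = sgn (deg I) (deg J) • D.cov (frame J) (frame I))
    (K J : ι ⊕ κ) :
    curvature (warpConnection hW H ψ s hg hΓ).cov (deg (up K)) (deg (up J))
      (frame (up K)) (frame (up J)) (frame (Sum.inl none)) = 0 := by
  rw [AffineConnection.curvature_frame_frame, warpConnection_frame, warpConnection_frame,
    warpChristoffel_up_none, warpChristoffel_up_none, AffineConnection.cov_frame_smul,
    AffineConnection.cov_frame_smul, warpConnection_frame, warpConnection_frame, twist_timeHom,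
    twist_timeHom, d_up_timeHom, d_up_timeHom, zero_smul, zero_smul, zero_add, zero_add,
    warpChristoffel_symm hW H ψ s hs hD K J, deg_up, deg_up, smul_comm (timeHom κ W _)
    (sgn (deg K) (deg J)), sub_self]

theorem warp_curvature_none_up_up (I J : ι ⊕ κ) :
    curvature (warpConnection hW H ψ s hg hΓ).cov (deg (Sum.inl none : Option ι ⊕ κ)) (deg (up I))
      (frame (Sum.inl none)) (frame (up I)) (frame (up J)) (Sum.inl none) =
      timeHom κ W (SmoothFn.deriv (H * SmoothFn.deriv H) -
        (algebraMap ℝ SmoothFn s + ψ) * (H * SmoothFn.deriv H)) * SFun.pr hW (g I J) := by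
  rw [AffineConnection.curvature_frame_frame, deg_none, sgn_zero_left, one_smul,
    warpConnection_frame, warpConnection_frame, warpChristoffel_none_up, warpChristoffel_up_up,
    AffineConnection.cov_frame_smul, AffineConnection.cov_add_right, warp_cov_none_lift,
    AffineConnection.cov_frame_smul, warpConnection_frame, warpConnection_frame,
    warpChristoffel_up_up, warpChristoffel_none_none, twist_timeHom, d_up_timeHom, deg_none,
    SFun.twist_zero, d_none_timeHom_mul_pr]
  simp only [Pi.sub_apply, Pi.add_apply, Pi.smul_apply, smul_eq_mul, frame_same, lift_none,
    mul_zero, mul_one, zero_mul, zero_add]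
  rw [mul_assoc, timeHom_comm, ← mul_assoc, ← map_mul, ← mul_assoc, ← map_mul, ← add_mul,
    ← sub_mul, ← map_add, ← map_sub]
  congr 2
  ring

/-- A Gauss equation. The correction to the fibre curvature comes from leaving the fibre through the
second fundamental form `h h' g_IJ ∂_t` and coming back through `∇_{∂_K} ∂_t = (ψ - s) ∂_K`. -/
theorem warp_curvature_up_up_up (K I J L : ι ⊕ κ) :
    curvature (warpConnection hW H ψ s hg hΓ).cov (deg (up K)) (deg (up I))
      (frame (up K)) (frame (up I)) (frame (up J)) (up L) =
      SFun.pr hW (curvature D.cov (deg K) (deg I) (frame K) (frame I) (frame J) L) +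
      timeHom κ W ((ψ - algebraMap ℝ SmoothFn s) * (H * SmoothFn.deriv H)) * SFun.pr hW (
        sgn (deg K) (deg I + deg J) • (g I J * (frame K : Vect κ V) L) -
        (sgn (deg K) (deg I) * sgn (deg I) (deg K + deg J)) •
          (g K J * (frame I : Vect κ V) L)) := by
  have hc : ∀ K I J : ι ⊕ κ, (warpConnection hW H ψ s hg hΓ).cov (frame (up K))
      ((warpConnection hW H ψ s hg hΓ).cov (frame (up I)) (frame (up J))) (up L) =
      SFun.pr hW (D.cov (frame K) (D.cov (frame I) (frame J)) L) +
      timeHom κ W ((ψ - algebraMap ℝ SmoothFn s) * (H * SmoothFn.deriv H)) * SFun.pr hW (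
        sgn (deg K) (deg I + deg J) • (g I J * (frame K : Vect κ V) L)) := by
    intro K I J
    have hp : SFun.pr hW (g I J) ∈ SFun.homog κ W (deg I + deg J) :=
      SFun.pull_mem_homog _ _ (hg I J)
    rw [warpConnection_frame, warpChristoffel_up_up, AffineConnection.cov_add_right,
      AffineConnection.cov_frame_smul, warpConnection_frame, warpChristoffel_up_none,
      Pi.add_apply, warp_cov_up_lift_up, SFun.twist_mul, twist_timeHom, SFun.twist_of_mem hp,
      deg_up]
    simp only [Pi.add_apply, Pi.smul_apply, smul_eq_mul, frame_none_up, mul_zero, zero_add,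
      frame_up_up hW, map_smul, map_mul, mul_smul_comm, smul_mul_assoc]
    congr 2
    rw [← mul_assoc, timeHom_comm (ψ - algebraMap ℝ SmoothFn s)]
    simp only [mul_assoc]
  rw [AffineConnection.curvature_frame_frame, AffineConnection.curvature_frame_frame,
    Pi.sub_apply, Pi.smul_apply, hc, hc, Pi.sub_apply, Pi.smul_apply, deg_up, deg_up]
  simp only [map_sub, map_smul, mul_sub, smul_add, mul_smul_comm, smul_smul]
  abel

theorem warp_ricciTrace_none_none :
    ricciTrace (warpConnection hW H ψ s hg hΓ).cov (Sum.inl none) (Sum.inl none) =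
      ((Fintype.card ι : ℝ) - Fintype.card κ) •
        timeHom κ W (algebraMap ℝ SmoothFn s ^ 2 - ψ ^ 2 - SmoothFn.deriv ψ) := by
  rw [ricciTrace, sum_index, AffineConnection.curvature_frame_frame, deg_none, sgn_zero_left,
    one_smul, sgn_zero_left, one_smul, sub_self, Pi.zero_apply, zero_add, ← sum_sgn_deg (ι := ι) (κ := κ),
    Finset.sum_smul]
  refine Finset.sum_congr rfl fun K _ => ?_
  have h := congrFun (warp_curvature_up_none_none hW H ψ s D hg hΓ K) (up K)
  rw [deg_none] at h
  rw [h, Pi.smul_apply, frame_same, smul_eq_mul, mul_one, add_zero, add_zero, deg_up]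

theorem warp_ricciTrace_none_up (J : ι ⊕ κ) :
    ricciTrace (warpConnection hW H ψ s hg hΓ).cov (Sum.inl none) (up J) = 0 := by
  rw [ricciTrace, sum_index, AffineConnection.curvature_frame_frame, deg_none, sgn_zero_left,
    one_smul, sgn_zero_left, one_smul, sub_self, Pi.zero_apply, zero_add]
  refine Finset.sum_eq_zero fun K _ => ?_
  have h := warp_curvature_up_none_up hW H ψ s D hg hΓ K J K
  rw [deg_none] at h
  rw [h, smul_zero]

/-- The `t` term of the trace is a multiple of `∂_J` and has no `∂_t` component; the fibre terms
vanish by torsion-freeness. -/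
theorem warp_ricciTrace_up_none (hs : ∀ I J, g I J = sgn (deg I) (deg J) • g J I)
    (hD : ∀ I J, D.cov (frame I) (frame J) = sgn (deg I) (deg J) • D.cov (frame J) (frame I))
    (J : ι ⊕ κ) :
    ricciTrace (warpConnection hW H ψ s hg hΓ).cov (up J) (Sum.inl none) = 0 := by
  rw [ricciTrace, sum_index, AffineConnection.curvature_frame_swap, warp_curvature_up_none_none,
    Pi.neg_apply, Pi.smul_apply, Pi.smul_apply, frame_up_none, smul_zero, smul_zero, neg_zero,
    smul_zero, zero_add]
  refine Finset.sum_eq_zero fun K _ => ?_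
  rw [warp_curvature_up_up_none hW H ψ s D hg hΓ hs hD, Pi.zero_apply, smul_zero]

/-- The warping term in the Ricci tensor of the warped product. -/
def warpRicciFn (m : ℝ) : SmoothFn :=
  SmoothFn.deriv (H * SmoothFn.deriv H) - (algebraMap ℝ SmoothFn s + ψ) * (H * SmoothFn.deriv H) +
    algebraMap ℝ SmoothFn (m - 1) * ((ψ - algebraMap ℝ SmoothFn s) * (H * SmoothFn.deriv H))

/-- The supertrace of the Gauss correction: its first term is traced with the identity and counts
`m` times, its second survives only for `K = I` and counts once. Hence the factor `m - 1`, to which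
the `t` term of the trace is added. -/
theorem warp_ricciTrace_up_up (I J : ι ⊕ κ) :
    ricciTrace (warpConnection hW H ψ s hg hΓ).cov (up I) (up J) =
      SFun.pr hW (ricciTrace D.cov I J) +
        timeHom κ W (warpRicciFn H ψ s ((Fintype.card ι : ℝ) - Fintype.card κ)) *
          SFun.pr hW (g I J) := by
  -- All parity signs are squares except `sgn (deg K) (deg K)` in the first term, which is the
  -- weight of the supertrace.
  have h1 : ∀ K, sgn (deg K) (deg K + deg I + deg J) • (
        sgn (deg K) (deg I + deg J) • (g I J * (frame K : Vect κ V) K) -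
        (sgn (deg K) (deg I) * sgn (deg I) (deg K + deg J)) • (g K J * (frame I : Vect κ V) K)) =
      sgn (deg K) (deg K) • g I J - (if K = I then g I J else 0) := by
    intro K
    rw [frame_same, mul_one, smul_sub, smul_smul]
    congr 2
    · simp only [sgn_add_right]
      linear_combination sgn (deg K) (deg K) * ((sgn (deg K) (deg I)) ^ 2 *
        sgn_mul_self (deg K) (deg J) + sgn_mul_self (deg K) (deg I))
    · by_cases hK : K = I
      · subst hK
        rw [if_pos rfl, frame_same, mul_one, smul_smul]
        have : sgn (deg K) (deg K + deg K + deg J) *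
            (sgn (deg K) (deg K) * sgn (deg K) (deg K + deg J)) = 1 := by
          simp only [sgn_add_right]
          linear_combination (sgn (deg K) (deg K) ^ 2 * sgn (deg K) (deg J) ^ 2 +
            sgn (deg K) (deg J) ^ 2) * sgn_mul_self (deg K) (deg K) +
            sgn_mul_self (deg K) (deg J)
        rw [this, one_smul]
      · rw [if_neg hK, frame_ne hK, mul_zero, smul_zero, smul_zero]
  have h2 : ∑ K, (sgn (deg K) (deg K) • g I J - (if K = I then g I J else 0)) =
      ((Fintype.card ι : ℝ) - Fintype.card κ - 1) • g I J := by
    rw [Finset.sum_sub_distrib, ← Finset.sum_smul, sum_sgn_deg, Finset.sum_ite_eq',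
      if_pos (Finset.mem_univ _), sub_smul _ (1 : ℝ), one_smul]
  have h3 : ∀ (x : SFun κ W) (K : ι ⊕ κ), sgn (deg K) (deg K + deg I + deg J) • (x *
      SFun.pr hW (sgn (deg K) (deg I + deg J) • (g I J * (frame K : Vect κ V) K) -
        (sgn (deg K) (deg I) * sgn (deg I) (deg K + deg J)) •
          (g K J * (frame I : Vect κ V) K))) =
      x * SFun.pr hW (sgn (deg K) (deg K) • g I J - (if K = I then g I J else 0)) := by
    intro x K
    rw [← mul_smul_comm, ← map_smul, h1]
  have h4 : ∀ (c : ℝ) (F G : SmoothFn) (x : SFun κ W),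
      timeHom κ W (F + algebraMap ℝ SmoothFn c * G) * x =
        timeHom κ W F * x + timeHom κ W G * (c • x) := by
    intro c F G x
    rw [← Algebra.smul_def, map_add, map_smul, add_mul, smul_mul_assoc, mul_smul_comm]
  rw [ricciTrace, sum_index, warp_curvature_none_up_up, deg_none, sgn_zero_left, one_smul]
  simp only [warp_curvature_up_up_up]
  simp only [deg_up, smul_add]
  simp only [h3, ← map_smul]
  rw [Finset.sum_add_distrib, ← map_sum, ← Finset.mul_sum, ← map_sum, h2, add_left_comm, warpRicciFn,
    h4, map_smul, ricciTrace]

end WarpRicci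

/-! ### The warping equations -/

section Equations

/-- The logarithmic derivative of a nowhere vanishing smooth function. -/
def SmoothFn.logDeriv (H : SmoothFn) (h0 : ∀ t, H.1 t ≠ 0) : SmoothFn :=
  ⟨fun t => (SmoothFn.deriv H).1 t / H.1 t,
    (SmoothFn.contDiff (SmoothFn.deriv H)).div (SmoothFn.contDiff H) h0⟩

variable (H : SmoothFn) (h0 : ∀ t, H.1 t ≠ 0)

theorem SmoothFn.logDeriv_mul : SmoothFn.logDeriv H h0 * H = SmoothFn.deriv H :=
  Subtype.ext (funext fun t => div_mul_cancel₀ _ (h0 t))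

theorem SmoothFn.hasDerivAt (t : ℝ) : HasDerivAt H.1 ((SmoothFn.deriv H).1 t) t :=
  ((SmoothFn.contDiff H).differentiable (by simp) t).hasDerivAt

/-- The Riccati identity `ψ' + ψ² = h''/h`, taken at `s = 1`. -/
theorem SmoothFn.one_sub_logDeriv_apply (t : ℝ) :
    (algebraMap ℝ SmoothFn 1 ^ 2 - SmoothFn.logDeriv H h0 ^ 2 -
      SmoothFn.deriv (SmoothFn.logDeriv H h0)).1 t =
      1 - (SmoothFn.deriv (SmoothFn.deriv H)).1 t / H.1 t := by
  have h1 : (SmoothFn.deriv (SmoothFn.logDeriv H h0)).1 t =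
      ((SmoothFn.deriv (SmoothFn.deriv H)).1 t * H.1 t -
        (SmoothFn.deriv H).1 t * (SmoothFn.deriv H).1 t) / H.1 t ^ 2 :=
    ((SmoothFn.hasDerivAt (SmoothFn.deriv H) t).div (SmoothFn.hasDerivAt H t) (h0 t)).deriv
  show (1 : ℝ) ^ 2 - ((SmoothFn.deriv H).1 t / H.1 t) ^ 2 -
    (SmoothFn.deriv (SmoothFn.logDeriv H h0)).1 t = _
  rw [h1]
  have := h0 t
  field_simp
  ring

/-- At `s = 1`, the identity `ψ h h' = h'²` makes one `h'²` cancel and collects the terms in `h h'`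
with coefficient `-m`. -/
theorem warpRicciFn_apply (m t : ℝ) :
    (warpRicciFn H (SmoothFn.logDeriv H h0) 1 m).1 t =
      H.1 t * (SmoothFn.deriv (SmoothFn.deriv H)).1 t + (m - 1) * (SmoothFn.deriv H).1 t ^ 2 -
        m * (H.1 t * (SmoothFn.deriv H).1 t) := by
  have h1 : (SmoothFn.deriv (H * SmoothFn.deriv H)).1 t =
      (SmoothFn.deriv H).1 t * (SmoothFn.deriv H).1 t +
        H.1 t * (SmoothFn.deriv (SmoothFn.deriv H)).1 t := by
    rw [SmoothFn.deriv_mul]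
    rfl
  show (SmoothFn.deriv (H * SmoothFn.deriv H)).1 t -
      (1 + (SmoothFn.deriv H).1 t / H.1 t) * (H.1 t * (SmoothFn.deriv H).1 t) +
      (m - 1) * (((SmoothFn.deriv H).1 t / H.1 t - 1) * (H.1 t * (SmoothFn.deriv H).1 t)) = _
  rw [h1]
  have := h0 t
  field_simp
  ring

end Equations

/-! ### Classification of the solutions of the warping equations. -/

section Solutions

variable {H : SmoothFn}

/-- The solutions of the warping equations. -/
theorem warping_solutions (h0 : ∀ t, H.1 t ≠ 0) {m lam0 lamN : ℝ} (hm : m ≠ 0)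
    (h1 : ∀ t, m * (1 - (SmoothFn.deriv (SmoothFn.deriv H)).1 t / H.1 t) = lam0)
    (h2 : ∀ t, H.1 t * (SmoothFn.deriv (SmoothFn.deriv H)).1 t +
      (m - 1) * (SmoothFn.deriv H).1 t ^ 2 - m * (H.1 t * (SmoothFn.deriv H).1 t) +
      lam0 * H.1 t ^ 2 = lamN) :
    (lam0 = 0 ∧ lamN = 0 ∧ ∃ c₁ : ℝ, ∀ t, H.1 t = c₁ * Real.exp t) ∨
      (lam0 = m ∧ ∃ c₁ : ℝ, (c₁ = √(lamN / m) ∨ c₁ = -√(lamN / m)) ∧ ∀ t, H.1 t = c₁) := by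
  set h := H.1 with hh
  set h' := (SmoothFn.deriv H).1 with hh'
  set h'' := (SmoothFn.deriv (SmoothFn.deriv H)).1 with hh''
  have d0 : ∀ t, HasDerivAt h (h' t) t := SmoothFn.hasDerivAt H
  have d1 : ∀ t, HasDerivAt h' (h'' t) t := SmoothFn.hasDerivAt (SmoothFn.deriv H)
  -- The constant `k` is chosen so that the first equation becomes linear, `h'' = k h`.
  obtain ⟨k, hk⟩ : ∃ k, lam0 = m * (1 - k) := ⟨1 - lam0 / m, by field_simp; ring⟩
  have e1 : ∀ t, h'' t = k * h t := by
    intro t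
    have h3 := h1 t
    rw [hk] at h3
    have h4 := mul_left_cancel₀ hm h3
    have h5 : h'' t / h t = k := by linarith
    rw [← h5, div_mul_cancel₀ _ (h0 t)]
  -- After substituting `h'' = k h`, the second equation says that a quadratic form in `h` and `h'`
  -- is constant. Its derivative is `m` times this expression.
  have e2 : ∀ t, 2 * (h t * h' t) - h' t ^ 2 - k * h t ^ 2 = 0 := by
    intro t
    have hd := (((((d0 t).pow 2).const_mul (k + lam0)).add (((d1 t).pow 2).const_mul (m - 1))).sub
      (((d0 t).mul (d1 t)).const_mul m))
    have hc : (fun t => (k + lam0) * h t ^ 2 + (m - 1) * h' t ^ 2 - m * (h t * h' t)) =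
        fun _ => lamN := by
      funext t
      rw [← h2 t, e1 t]
      ring
    change HasDerivAt
      (fun t => (k + lam0) * h t ^ 2 + (m - 1) * h' t ^ 2 - m * (h t * h' t)) _ t at hd
    rw [hc] at hd
    have h3 := hd.unique (hasDerivAt_const t lamN)
    rw [e1 t, hk] at h3
    have h4 : m * (2 * (h t * h' t) - h' t ^ 2 - k * h t ^ 2) = 0 := by
      norm_num at h3
      linear_combination h3
    exact (mul_eq_zero.1 h4).resolve_left hm
  -- The derivative of the relation is `2 h'² + 2 k h² - 4 k h h' = 0`. Adding twice the relation
  -- leaves `4 (1 - k) h h' = 0`, and `h` has no zero.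
  have e3 : ∀ t, (1 - k) * h' t = 0 := by
    intro t
    have hd := ((((d0 t).mul (d1 t)).const_mul 2).sub ((d1 t).pow 2)).sub
      (((d0 t).pow 2).const_mul k)
    have hc : (fun t => 2 * (h t * h' t) - h' t ^ 2 - k * h t ^ 2) = fun _ => 0 := funext e2
    change HasDerivAt (fun t => 2 * (h t * h' t) - h' t ^ 2 - k * h t ^ 2) _ t at hd
    rw [hc] at hd
    have h3 := hd.unique (hasDerivAt_const t 0)
    rw [e1 t] at h3
    have h4 : h t * ((1 - k) * h' t) = 0 := by
      norm_num at h3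
      linear_combination h3 / 4 + e2 t / 2
    exact (mul_eq_zero.1 h4).resolve_left (h0 t)
  -- For `k = 1` the quadratic relation is a perfect square and forces `h' = h`. Otherwise `h' = 0`,
  -- and the relation is reduced to `k h² = 0`.
  by_cases hk1 : k = 1
  · left
    have e4 : ∀ t, h' t = h t := by
      intro t
      have h3 := e2 t
      rw [hk1] at h3
      have h4 : (h' t - h t) ^ 2 = 0 := by linear_combination -h3
      exact sub_eq_zero.1 (pow_eq_zero_iff two_ne_zero |>.1 h4)
    have hl : lam0 = 0 := by rw [hk, hk1]; ring
    refine ⟨hl, ?_, h 0, fun t => ?_⟩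
    · rw [← h2 0, e1, e4, hk1, hl]
      ring
    · have hd : ∀ t, HasDerivAt (fun t => h t * Real.exp (-t)) 0 t := by
        intro t
        have h3 := (d0 t).mul ((hasDerivAt_neg t).exp)
        have h4 : h' t * Real.exp (-t) + h t * (Real.exp (-t) * -1) = 0 := by
          rw [e4]
          ring
        rw [h4] at h3
        exact h3
      have hc := is_const_of_deriv_eq_zero (fun t => (hd t).differentiableAt)
        (fun t => (hd t).deriv) t 0
      simp only [neg_zero, Real.exp_zero, mul_one] at hc
      rw [← hc, mul_assoc, ← Real.exp_add, neg_add_cancel, Real.exp_zero, mul_one]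
  · right
    have e4 : ∀ t, h' t = 0 := fun t =>
      (mul_eq_zero.1 (e3 t)).resolve_left (sub_ne_zero.2 (Ne.symm hk1))
    have hk0 : k = 0 := by
      have h3 := e2 0
      rw [e4] at h3
      have h4 : k * h 0 ^ 2 = 0 := by linear_combination -h3
      exact (mul_eq_zero.1 h4).resolve_right (pow_ne_zero 2 (h0 0))
    have hl : lam0 = m := by rw [hk, hk0]; ring
    refine ⟨hl, h 0, ?_, fun t => ?_⟩
    -- With `h` constant the second equation reads `m h² = lamN`, so the root of the quotient is
    -- `|h|` and the sign of `h` decides the alternative.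
    · have hN : lamN / m = h 0 ^ 2 := by
        rw [← h2 0, e1, e4, hk0, hl]
        field_simp
        ring
      rw [hN, Real.sqrt_sq_eq_abs]
      rcases abs_choice (h 0) with h3 | h3
      · exact Or.inl h3.symm
      · right
        rw [h3, neg_neg]
    · exact is_const_of_deriv_eq_zero (fun t => (d0 t).differentiableAt)
        (fun t => (d0 t).deriv.trans (e4 t)) t 0

/-- The functions of the classification solve the warping equations. -/
theorem warping_equations (h0 : ∀ t, H.1 t ≠ 0) {m lam0 lamN : ℝ} (hm : m ≠ 0)
    (h : (lam0 = 0 ∧ lamN = 0 ∧ ∃ c₁ : ℝ, ∀ t, H.1 t = c₁ * Real.exp t) ∨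
      (lam0 = m ∧ ∃ c₁ : ℝ, (c₁ = √(lamN / m) ∨ c₁ = -√(lamN / m)) ∧ ∀ t, H.1 t = c₁))
    (t : ℝ) :
    m * (1 - (SmoothFn.deriv (SmoothFn.deriv H)).1 t / H.1 t) = lam0 ∧
    H.1 t * (SmoothFn.deriv (SmoothFn.deriv H)).1 t +
      (m - 1) * (SmoothFn.deriv H).1 t ^ 2 - m * (H.1 t * (SmoothFn.deriv H).1 t) +
      lam0 * H.1 t ^ 2 = lamN := by
  rcases h with ⟨rfl, rfl, c, hc⟩ | ⟨rfl, c, hc, hH⟩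
  · have e1 : SmoothFn.deriv H = H := by
      apply Subtype.ext
      have h1 : H.1 = fun t => c * Real.exp t := funext hc
      show deriv H.1 = H.1
      rw [h1]
      funext t
      exact ((Real.hasDerivAt_exp t).const_mul c).deriv
    rw [e1, e1, div_self (h0 t)]
    constructor <;> ring
  · have e1 : SmoothFn.deriv H = 0 := by
      apply Subtype.ext
      have h1 : H.1 = fun _ => c := funext hH
      show deriv H.1 = 0
      rw [h1]
      funext t
      exact deriv_const t c
    have e2 : SmoothFn.deriv (0 : SmoothFn) = 0 := by
      have := SmoothFn.deriv_algebraMap 0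
      rwa [map_zero] at this
    have hz : ∀ t, (0 : SmoothFn).1 t = 0 := fun _ => rfl
    -- After substitution `lam0` stands for `m`. The real square root is `0` on negative numbers, so
    -- the sign of the radicand needs an argument: `c` is a value of `H`, hence nonzero, and so the
    -- root is nonzero.
    have hsq : c ^ 2 = lamN / lam0 := by
      have hne : c ≠ 0 := by rw [← hH t]; exact h0 t
      have hs : √(lamN / lam0) ≠ 0 := by
        rcases hc with hc | hc
        · rwa [← hc]
        · intro h3
          rw [h3, neg_zero] at hc
          exact hne hc
      have hnn : 0 ≤ lamN / lam0 := by
        by_contra h3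
        exact hs (Real.sqrt_eq_zero_of_nonpos (le_of_not_ge h3))
      rcases hc with hc | hc
      · rw [hc, Real.sq_sqrt hnn]
      · rw [hc, neg_sq, Real.sq_sqrt hnn]
    rw [e1, e2, hz, hH t, hsq]
    constructor
    · ring
    · field_simp
      ring

end Solutions

/-! ### Einstein warped products -/

section WarpEinstein

variable {ι : Type} [Fintype ι] [DecidableEq ι] {κ : Type} [Fintype κ] [DecidableEq κ]
  {W : Opens (Option ι → ℝ)} {V : Opens (ι → ℝ)}
  (hW : ∀ z : W, (fun a => z.1 (some a)) ∈ V)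
  (H ψ : SmoothFn) (s : ℝ) {g : ι ⊕ κ → ι ⊕ κ → SFun κ V} (D : AffineConnection κ V)
  (hg : ∀ I J, g I J ∈ SFun.homog κ V (deg I + deg J))
  (hΓ : ∀ I J, (D.cov (Vect.frame I) (Vect.frame J)).IsHomog (deg I + deg J))

open Vect

theorem warp_ricci_none_none :
    ricci (warpConnection hW H ψ s hg hΓ).cov (deg (Sum.inl none : Option ι ⊕ κ))
      (deg (Sum.inl none : Option ι ⊕ κ)) (frame (Sum.inl none)) (frame (Sum.inl none)) =
      ((Fintype.card ι : ℝ) - Fintype.card κ) •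
        timeHom κ W (algebraMap ℝ SmoothFn s ^ 2 - ψ ^ 2 - SmoothFn.deriv ψ) := by
  rw [ricci_frame_frame, warp_ricciTrace_none_none, deg_none, sgn_zero_left, one_smul, ← two_smul ℝ,
    smul_smul, one_div, inv_mul_cancel₀ two_ne_zero, one_smul]

theorem warp_ricci_up_up (hs : ∀ I J, g I J = sgn (deg I) (deg J) • g J I) (I J : ι ⊕ κ) :
    ricci (warpConnection hW H ψ s hg hΓ).cov (deg (up I)) (deg (up J)) (frame (up I))
      (frame (up J)) = SFun.pr hW (ricci D.cov (deg I) (deg J) (frame I) (frame J)) +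
        timeHom κ W (warpRicciFn H ψ s ((Fintype.card ι : ℝ) - Fintype.card κ)) *
          SFun.pr hW (g I J) := by
  have e : ∀ x : SFun κ W, x = (1 / 2 : ℝ) • (x + x) := by
    intro x
    rw [← two_smul ℝ, smul_smul, one_div, inv_mul_cancel₀ two_ne_zero, one_smul]
  have hx : ∀ c : SFun κ W, sgn (deg I) (deg J) • (c * SFun.pr hW (g J I)) =
      c * SFun.pr hW (g I J) := by
    intro c
    rw [← mul_smul_comm, ← map_smul, ← hs I J]
  rw [ricci_frame_frame, ricci_frame_frame, warp_ricciTrace_up_up, warp_ricciTrace_up_up, deg_up,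
    deg_up, smul_add (sgn (deg I) (deg J)), hx, map_smul, map_add, map_smul]
  conv_rhs => rw [e (timeHom κ W _ * SFun.pr hW (g I J))]
  rw [← smul_add]
  congr 1
  abel

/-- The first warping equation settles the `tt` component, where `g_tt = -1` turns `-lam0` into
`lam0`. In the fibre components the second equation makes the warping term equal to `lamN - lam0
h²`, and `lamN` cancels the Ricci tensor of the fibre. -/
theorem warp_ricci_eq (hs : ∀ I J, g I J = sgn (deg I) (deg J) • g J I)
    (hD : ∀ I J, D.cov (frame I) (frame J) = sgn (deg I) (deg J) • D.cov (frame J) (frame I))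
    {lam0 lamN : ℝ}
    (h1 : ∀ t, ((Fintype.card ι : ℝ) - Fintype.card κ) *
      (algebraMap ℝ SmoothFn s ^ 2 - ψ ^ 2 - SmoothFn.deriv ψ).1 t = lam0)
    (h2 : ∀ t, (warpRicciFn H ψ s ((Fintype.card ι : ℝ) - Fintype.card κ)).1 t +
      lam0 * H.1 t ^ 2 = lamN)
    (hE : ∀ I J, ricci D.cov (deg I) (deg J) (frame I) (frame J) = (-lamN) • g I J)
    (I J : Option ι ⊕ κ) :
    ricci (warpConnection hW H ψ s hg hΓ).cov (deg I) (deg J) (frame I) (frame J) =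
      (-lam0) • warpComp hW H.1 (SmoothFn.contDiff H) g I J := by
  rcases index_cases I with rfl | ⟨I, rfl⟩ <;> rcases index_cases J with rfl | ⟨J, rfl⟩
  · have e : ((Fintype.card ι : ℝ) - Fintype.card κ) •
        (algebraMap ℝ SmoothFn s ^ 2 - ψ ^ 2 - SmoothFn.deriv ψ) = lam0 • (1 : SmoothFn) := by
      apply Subtype.ext
      funext t
      exact (h1 t).trans (mul_one _).symm
    rw [warp_ricci_none_none, warpComp_none_none, ← map_smul, e, map_smul, map_one, smul_neg,
      neg_smul, neg_neg]
  · rw [ricci_frame_frame, warp_ricciTrace_none_up, warp_ricciTrace_up_none hW H ψ s D hg hΓ hs hD,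
      warpComp_none_up, smul_zero, smul_zero, add_zero, smul_zero]
  · rw [ricci_frame_frame, warp_ricciTrace_none_up, warp_ricciTrace_up_none hW H ψ s D hg hΓ hs hD,
      warpComp_up_none, smul_zero, smul_zero, add_zero, smul_zero]
  · have e : warpRicciFn H ψ s ((Fintype.card ι : ℝ) - Fintype.card κ) =
        lamN • (1 : SmoothFn) + (-lam0) • H ^ 2 := by
      apply Subtype.ext
      funext t
      show _ = lamN * 1 + (-lam0) * H.1 t ^ 2
      linarith [h2 t]
    rw [warp_ricci_up_up hW H ψ s D hg hΓ hs, hE, e, warpComp_up_up_timeHom, map_add, map_smul,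
      map_smul, map_smul, map_one, add_mul, smul_mul_assoc, smul_mul_assoc, one_mul, ← add_assoc,
      ← add_smul, neg_add_cancel, zero_smul, zero_add]

/-- A non-degenerate metric has a component whose body does not vanish at a given point. -/
theorem exists_body_ne_zero [Nonempty (ι ⊕ κ)] (hn : IsUnit (Matrix.of g)) (x : V) :
    ∃ I J, (SFun.body (g I J)).1 x ≠ 0 := by
  by_contra! hc
  obtain ⟨A, hA⟩ := hn
  have hAB := A.mul_inv
  rw [hA] at hAB
  obtain ⟨I⟩ := ‹Nonempty (ι ⊕ κ)›
  -- A diagonal entry of `g g⁻¹` is `1`. Its body is a sum of products of bodies, which would be `0`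
  -- if all bodies of `g` vanished at `x`.
  have h1 := congrFun (congrFun hAB I) I
  rw [Matrix.mul_apply, Matrix.one_apply_eq] at h1
  have h2 := congrArg (fun y => (SFun.body y).1 x) h1
  simp only [map_sum, map_mul, map_one, Matrix.of_apply] at h2
  rw [AddSubmonoidClass.coe_finsetSum, Finset.sum_apply] at h2
  have h3 : (0 : ℝ) = 1 := by
    rw [← Finset.sum_const_zero (s := (Finset.univ : Finset (ι ⊕ κ)))]
    refine Eq.trans (Finset.sum_congr rfl fun K _ => ?_) h2
    exact (mul_eq_zero_of_left (hc I K) _).symm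
  exact zero_ne_one h3

theorem body_timeHom (F : SmoothFn) (z : W) :
    (SFun.body (timeHom κ W F)).1 z = F.1 (z.1 none) := by
  show (SFun.body (SFun.ofCInf (timeFn W F.1 (SmoothFn.contDiff F)) : SFun κ W)).1 z = _
  rw [SFun.body_ofCInf]
  rfl

theorem body_timeHom_mul_pr (F : SmoothFn) (x : SFun κ V) (z : W) :
    (SFun.body (timeHom κ W F * SFun.pr hW x)).1 z =
      F.1 (z.1 none) * (SFun.body x).1 ⟨fun a => z.1 (some a), hW z⟩ := by
  rw [map_mul, SFun.body_pr, ← body_timeHom (κ := κ) F z]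
  rfl

end WarpEinstein

/-! ### The Einstein equation on the whole supermanifold. -/

section Main

variable {ι : Type} [Fintype ι] [DecidableEq ι] {κ : Type} [Fintype κ] [DecidableEq κ]
  {M : Supermanifold.{u, v} ι κ}

open Vect

theorem Supermanifold.slice_mem (M : Supermanifold.{u, v} ι κ) (i : M.Index) (x : M.dom i) :
    (fun o : Option ι => (o.elim (0 : CInf (M.dom i)) (CInf.coord (M.dom i))).1 x) ∈
      M.line.dom i := (mem_lineChart_target (M.chart i) _).2 x.2

theorem AffineConnection.cov_frame_isHomog {U : Opens (ι → ℝ)} (D : AffineConnection κ U)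
    (I J : ι ⊕ κ) : (D.cov (frame I) (frame J)).IsHomog (deg I + deg J) :=
  D.cov_homog _ _ _ _ (frame_isHomog I) (frame_isHomog J)

variable (g : EvenMetric M) (H : SmoothFn) (h0 : ∀ t, H.1 t ≠ 0)

/-- The connection of the warped product over the `i`-th chart. -/
def EvenMetric.warpConn (D : g.LeviCivita) (s : ℝ) (i : M.Index) :
    AffineConnection κ (M.line.dom i) :=
  warpConnection (M.line_dom i) H (SmoothFn.logDeriv H h0) s (g.comp_homog i)
    (D.conn i).cov_frame_isHomog

/-- The Levi-Civita connection of the warped product. -/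
def EvenMetric.LeviCivita.warp {g : EvenMetric M} (D : g.LeviCivita) :
    (g.warp H.1 (SmoothFn.contDiff H) h0).LeviCivita where
  conn := g.warpConn H h0 D 0
  isLeviCivita i := warpConnection_isLeviCivita (M.line_dom i) (SmoothFn.logDeriv_mul H h0)
    (g.comp_homog i) (g.comp_symm i) (D.conn i) (D.isLeviCivita i) _

/-- The Levi-Civita connection of the slice `t = 0` of the warped product. -/
def EvenMetric.LeviCivita.slice {g : EvenMetric M} {H : SmoothFn} {h0 : ∀ t, H.1 t ≠ 0}
    (D : (g.warp H.1 (SmoothFn.contDiff H) h0).LeviCivita) : g.LeviCivita where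
  conn i := sliceConnection (M.line_dom i) (M.slice_mem i) (D.conn i)
  isLeviCivita i := sliceConnection_isLeviCivita (M.line_dom i) (M.slice_mem i) (h0 0) (D.conn i)
    (D.isLeviCivita i)

/-- Uniqueness replaces an arbitrary Levi-Civita connection of the product by the explicit one built
from `D`, so the curvature computation applies to both directions of the equivalence. -/
theorem semiSymm_leviCivita_warp (D : g.LeviCivita)
    (D' : (g.warp H.1 (SmoothFn.contDiff H) h0).LeviCivita) (i : M.Index) :
    semiSymm (D'.conn i).cov ((g.warp H.1 (SmoothFn.contDiff H) h0).comp i) ((dt M).comp i) =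
      (g.warpConn H h0 D 1 i).cov := by
  have h := AffineConnection.IsLeviCivita.cov_unique
    ((g.warp H.1 (SmoothFn.contDiff H) h0).comp_symm i)
    ((g.warp H.1 (SmoothFn.contDiff H) h0).nondeg i) (D'.isLeviCivita i)
    ((D.warp H h0).isLeviCivita i)
  rw [h]
  exact semiSymm_warpConnection (M.line_dom i) H (SmoothFn.logDeriv H h0) (g.comp_homog i)
    (D.conn i).cov_frame_isHomog

/-- The Einstein equation of a warped product for the semi-symmetric non-metric connection, in
terms of the warping function and the metric of the fibre. -/
theorem isEinsteinSemiSymm_warp_iff [Nonempty (ι ⊕ κ)] [Nonempty M.carrier] (lam0 : ℝ) :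
    (g.warp H.1 (SmoothFn.contDiff H) h0).IsEinsteinSemiSymm (dt M) (-lam0) ↔
      ∃ lamN : ℝ, g.IsEinstein (-lamN) ∧
        (∀ t, ((Fintype.card ι : ℝ) - Fintype.card κ) *
          (1 - (SmoothFn.deriv (SmoothFn.deriv H)).1 t / H.1 t) = lam0) ∧
        ∀ t, H.1 t * (SmoothFn.deriv (SmoothFn.deriv H)).1 t +
          ((Fintype.card ι : ℝ) - Fintype.card κ - 1) * (SmoothFn.deriv H).1 t ^ 2 -
          ((Fintype.card ι : ℝ) - Fintype.card κ) * (H.1 t * (SmoothFn.deriv H).1 t) +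
          lam0 * H.1 t ^ 2 = lamN := by
  simp only [← SmoothFn.one_sub_logDeriv_apply H h0, ← warpRicciFn_apply H h0]
  constructor
  · rintro ⟨D', hD'⟩
    set D := D'.slice with hDdef
    have hcov := semiSymm_leviCivita_warp g H h0 D D'
    set m : ℝ := (Fintype.card ι : ℝ) - Fintype.card κ with hm
    set F := warpRicciFn H (SmoothFn.logDeriv H h0) 1 m with hF
    have hf : ∀ i (I J : Option ι ⊕ κ),
        ricci (g.warpConn H h0 D 1 i).cov (deg I) (deg J) (frame I) (frame J) =
          (-lam0) • warpComp (M.line_dom i) H.1 (SmoothFn.contDiff H) (g.comp i) I J := by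
      intro i I J
      have h := hD' i _ _ _ _ (frame_isHomog I) (frame_isHomog J)
      rw [pair_frame_frame] at h
      exact (congrArg (fun c => ricci c (deg I) (deg J) (frame I) (frame J)) (hcov i)).symm.trans h
    -- The Einstein equation in the fibre directions, with variables separated: the left side is
    -- pulled back from the fibre, and on the right only the factor `F + lam0 h²` depends on `t`.
    have hup : ∀ i I J, SFun.pr (M.line_dom i)
        (ricci (D.conn i).cov (deg I) (deg J) (frame I) (frame J)) =
        -(timeHom κ (M.line.dom i) (F + lam0 • H ^ 2) * SFun.pr (M.line_dom i) (g.comp i I J)) := by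
      intro i I J
      have h := hf i (up I) (up J)
      rw [EvenMetric.warpConn, warp_ricci_up_up _ _ _ _ _ _ _ (g.comp_symm i),
        warpComp_up_up_timeHom] at h
      rw [eq_sub_of_add_eq h, map_add, map_smul, add_mul, smul_mul_assoc, neg_smul, neg_add',
        sub_eq_add_neg, add_comm, ← sub_eq_add_neg]
    obtain ⟨p⟩ := ‹Nonempty M.carrier›
    obtain ⟨i, hi⟩ := M.cover p
    have hx : M.chart i p ∈ M.dom i := (M.chart i).map_source hi
    have hz : ∀ t : ℝ, (fun o : Option ι => o.elim t (M.chart i p)) ∈ M.line.dom i :=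
      fun t => (mem_lineChart_target (M.chart i) _).2 hx
    -- The constant of the fibre is read off at `t = 0`. Restricting `hup` to that slice gives the
    -- Einstein equation of the fibre on every chart with the same constant.
    refine ⟨F.1 0 + lam0 * H.1 0 ^ 2, ⟨D, fun j a b X Y hX hY => ?_⟩, fun t => ?_, fun t => ?_⟩
    · refine (D.conn j).ricci_eq_of_frames (fun I J => ?_) hX hY
      have h := congrArg (slice (M.slice_mem j)) (hup j I J)
      rw [slice_pr, map_neg, map_mul, slice_timeHom, slice_pr, smul_mul_assoc, one_mul,
        ← neg_smul] at h
      exact h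
    · have h := congrArg (fun y => (SFun.body y).1 ⟨_, hz t⟩) (hf i (Sum.inl none) (Sum.inl none))
      rw [EvenMetric.warpConn, warp_ricci_none_none, warpComp_none_none, smul_neg, neg_smul,
        neg_neg] at h
      have e1 := body_timeHom (κ := κ) (m • (algebraMap ℝ SmoothFn 1 ^ 2 -
        SmoothFn.logDeriv H h0 ^ 2 - SmoothFn.deriv (SmoothFn.logDeriv H h0)))
        (⟨_, hz t⟩ : M.line.dom i)
      have e2 := body_timeHom (κ := κ) (lam0 • (1 : SmoothFn)) (⟨_, hz t⟩ : M.line.dom i)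
      rw [map_smul] at e1
      rw [map_smul, map_one] at e2
      exact (e1.symm.trans (h.trans e2)).trans (mul_one lam0)
    · obtain ⟨I, J, hIJ⟩ := exists_body_ne_zero (g.nondeg i) (⟨_, hx⟩ : M.dom i)
      -- The point of the fibre is fixed and only `t` varies, so the right side is a constant;
      -- cancelling the nonzero body then shows that `F + lam0 h²` does not depend on `t`.
      have key : ∀ t, (F + lam0 • H ^ 2).1 t * (SFun.body (g.comp i I J)).1 ⟨_, hx⟩ =
          -(SFun.body (ricci (D.conn i).cov (deg I) (deg J) (frame I) (frame J))).1 ⟨_, hx⟩ := by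
        intro t
        have h := body_timeHom_mul_pr (M.line_dom i) (F + lam0 • H ^ 2) (g.comp i I J) ⟨_, hz t⟩
        have h2 := body_timeHom_mul_pr (M.line_dom i) 1
          (ricci (D.conn i).cov (deg I) (deg J) (frame I) (frame J)) ⟨_, hz t⟩
        rw [map_one, one_mul, hup i I J, map_neg] at h2
        have h3 := h.symm.trans (neg_eq_iff_eq_neg.1 h2)
        refine h3.trans ?_
        show -((1 : ℝ) * _) = _
        rw [one_mul]
        rfl
      exact mul_right_cancel₀ hIJ ((key t).trans (key 0).symm)
  · rintro ⟨lamN, ⟨D, hD⟩, h1, h2⟩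
    refine ⟨D.warp H h0, fun i a b X Y hX hY => ?_⟩
    refine (congrArg (fun c => ricci c a b X Y)
      (semiSymm_leviCivita_warp g H h0 D (D.warp H h0) i)).trans ?_
    refine (g.warpConn H h0 D 1 i).ricci_eq_of_frames (fun I J => ?_) hX hY
    refine warp_ricci_eq (M.line_dom i) H (SmoothFn.logDeriv H h0) 1 (D.conn i) (g.comp_homog i)
      (D.conn i).cov_frame_isHomog (g.comp_symm i) (D.isLeviCivita i).symm_frames h1 h2
      (fun I J => ?_) I J
    have h := hD i _ _ _ _ (frame_isHomog I) (frame_isHomog J)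
    rwa [pair_frame_frame] at h

end Main

end SuperGeom

end

/-! ### The classification theorem. -/

theorem theorem4p6 (q n : ℕ) (hqn0 : (q : ℤ) - n ≠ 0) (hqn1 : (q : ℤ) - n ≠ 1)
    (M₂ : SuperGeom.Supermanifold.{u, v} (Fin q) (Fin n)) (hM₂ : Nonempty M₂.carrier)
    (g₂ : SuperGeom.EvenMetric M₂) (h : ℝ → ℝ) (hs : ContDiff ℝ ∞ h) (h0 : ∀ t, h t ≠ 0)
    (lam0 : ℝ) :
    (g₂.warp h hs h0).IsEinsteinSemiSymm (SuperGeom.dt M₂) (-lam0) ↔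
      ∃ lamN : ℝ, g₂.IsEinstein (-lamN) ∧
        ((lam0 = 0 ∧ lamN = 0 ∧ ∃ c₁ : ℝ, ∀ t, h t = c₁ * Real.exp t) ∨
          (lam0 = (q : ℝ) - n ∧ ∃ c₁ : ℝ, (c₁ = √(lamN / ((q : ℝ) - n)) ∨
            c₁ = -√(lamN / ((q : ℝ) - n))) ∧ ∀ t, h t = c₁)) := by
  have hm : (q : ℝ) - n ≠ 0 := by exact_mod_cast hqn0
  -- A nonzero superdimension excludes a fibre of dimension `0|0`, so the fibre metric has a
  -- component with which to separate variables.
  have hne : Nonempty (Fin q ⊕ Fin n) := by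
    rcases Nat.eq_zero_or_pos q with rfl | hq
    · rcases Nat.eq_zero_or_pos n with rfl | hn
      · exact absurd rfl hqn0
      · exact ⟨Sum.inr ⟨0, hn⟩⟩
    · exact ⟨Sum.inl ⟨0, hq⟩⟩
  have key := SuperGeom.isEinsteinSemiSymm_warp_iff g₂ (⟨h, hs⟩ : SuperGeom.SmoothFn) h0 lam0
  rw [Fintype.card_fin, Fintype.card_fin] at key
  refine key.trans (exists_congr fun lamN => and_congr_right fun _ =>
    ⟨fun ⟨h1, h2⟩ => ?_, fun h3 => ?_⟩)
  · exact SuperGeom.warping_solutions (H := ⟨h, hs⟩) h0 hm h1 h2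
  · have h4 := SuperGeom.warping_equations (H := ⟨h, hs⟩) h0 hm h3
    exact ⟨fun t => (h4 t).1, fun t => (h4 t).2⟩
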